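/- Let $T>0$, $x_a<x_b$, $I=[x_a,x_b]$, $\mathsf L=x_b-x_a$, $Q=[0,T]\times I$. Let $g\in C^6([0,\infty);\mathbb R)$ and let $u\in C^6(Q;\mathbb C)$ be a solution of $$u_t=\mathrm i\,u_{xx}+\mathrm i\,g(|u|^2)\,u+f\ \text{ on } Q,\qquad u(t,x_a)=u(t,x_b)=0\ \ (t\in[0,T]),\qquad u(0,\cdot)=u_0\ \text{ on } I .$$ For integers $N,J\ge 1$ put $\tau=T/N$, $t_n=n\tau$, $t^{n+\frac12}=t_n+\frac\tau2$, $h=\mathsf L/(J+1)$, $x_j=x_a+jh$ ($0\le j\le J+1$). For a grid function $v=(v_j)_{j=0}^{J+1}$ let $(\Delta_hv)_j=h^{-2}(v_{j-1}-2v_j+v_{j+1})$ for $1\le j\le J$, $(\Delta_hv)_0=(\Delta_hv)_{J+1}=0$, and $$\|v\|_{1,h}=\Big(h\sum_{j=0}^{J+1}|v_j|^2+h\sum_{j=0}^{J}\Big|\frac{v_{j+1}-v_j}{h}\Big|^2\Big)^{1/2}.$$ Products of grid functions, and functions applied to them, are taken nodewise. Write $u^n=(u(t_n,x_j))_j$ and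 $u^{n+\frac12}=(u(t^{n+\frac12},x_j))_j$; for a function $z$ on $I$ let $\mathring{\mathsf I}_hz$ be the grid function with values $z(x_j)$ for $1\le j\le J$ and $0$ for $j\in\{0,J+1\}$. The Relaxation Finite Difference (RFD) approximations with the first-order start are the complex grid functions $W^n$ ($0\le n\le N$), vanishing at $j=0$ and $j=J+1$, and the real grid functions $\Phi^{n+\frac12}$ ($0\le n\le N-1$) determined by $\Delta_hW^0=\mathring{\mathsf I}_h(u_0'')$, $\ \Phi^{\frac12}=g(|u^0|^2)$, $\ \Phi^{n+\frac12}=2g(|W^n|^2)-\Phi^{n-\frac12}$ for $1\le n\le N-1$, and, for $0\le n\le N-1$, $$W^{n+1}-W^n=\mathrm i\tau\,\Delta_h\Big(\frac{W^{n+1}+W^n}{2}\Big)+\mathrm i\tau\,\Phi^{n+\frac12}\,\frac{W^{n+1}+W^n}{2}+\tau\,\mathring{\mathsf I}_h\Big[\frac{f(t_{n+1},\cdot)+f(t_n,\cdot)}{2}\Big].$$ **Theorem.** Let $u_{\max}=\max_Q|u|$, $g_{\max}=\max_Q|g(|u|^2)|$ and $\delta_\star\ge 2\max\{u_{\max},g_{\max}\}$.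 There exist positive constants $\widehat{\mathsf C}^{\mathsf A},\widehat{\mathsf C}^{\mathsf B},\widehat{\mathsf C}^{\mathsf D},\widehat{\mathsf C}^{\mathsf E}$ with $\widehat{\mathsf C}^{\mathsf D}\ge\widehat{\mathsf C}^{\mathsf A}$, independent of $\tau$ and $h$ (they may depend on $T,x_a,x_b,g,f,u_0,u,\delta_\star$), such that for all $N,J\ge1$ with $$\tau\,\widehat{\mathsf C}^{\mathsf A}\le\tfrac12\qquad\text{and}\qquad \widehat{\mathsf C}^{\mathsf B}\sqrt{\mathsf L}\,(\tau+h^2)\le\tfrac{\delta_\star}{2}$$ the RFD approximations satisfy $$\max_{0\le m\le N-1}\big\|g(|u^{m+\frac12}|^2)-\Phi^{m+\frac12}\big\|_{1,h}\le\widehat{\mathsf C}^{\mathsf B}\,(\tau+h^2),$$ and, if in addition $\tau\,\widehat{\mathsf C}^{\mathsf D}\le\frac12$, $$\max_{0\le m\le N}\|u^m-W^m\|_{1,h}\le\widehat{\mathsf C}^{\mathsf E}\,(\tau^2+h^2).$$ -/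

import Mathlib

open Set

noncomputable section

namespace RFD

/-- The time step `τ = T / N`. -/
def timeStep (T : ℝ) (N : ℕ) : ℝ := T / N

/-- The time nodes `t_n = n τ`. -/
def timeNode (T : ℝ) (N n : ℕ) : ℝ := n * timeStep T N

/-- The intermediate time nodes `t^{n+1/2} = t_n + τ / 2`. -/
def midTimeNode (T : ℝ) (N n : ℕ) : ℝ := timeNode T N n + timeStep T N / 2

/-- The mesh width `h = (x_b - x_a) / (J + 1)`. -/
def meshWidth (xa xb : ℝ) (J : ℕ) : ℝ := (xb - xa) / (J + 1)

/-- The space nodes `x_j = x_a + j h`, for `j = 0, …, J + 1`. -/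
def node (xa xb : ℝ) (J : ℕ) (j : Fin (J + 2)) : ℝ := xa + (j : ℕ) * meshWidth xa xb J

/-- Grid functions with values in `E`, that is, families `(v_j)` with `j = 0, …, J + 1`. -/
abbrev Grid (J : ℕ) (E : Type*) := Fin (J + 2) → E

/-- The grid function vanishes at both endpoints. -/
def VanishesAtEnds {J : ℕ} (v : Grid J ℂ) : Prop := v 0 = 0 ∧ v (Fin.last (J + 1)) = 0

/-- The discrete Laplacian: the centred second difference at the interior nodes, and `0` at the
two end nodes. -/
def discreteLaplacian {J : ℕ} (h : ℝ) (v : Grid J ℂ) : Grid J ℂ := fun j =>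
  if hj : 0 < (j : ℕ) ∧ (j : ℕ) < J + 1 then
    (v ⟨(j : ℕ) - 1, by omega⟩ - 2 * v j + v ⟨(j : ℕ) + 1, by omega⟩) / (h : ℂ) ^ 2
  else 0

/-- Nodal values of `z` at the interior nodes, and `0` at the two end nodes. -/
def interpZero (xa xb : ℝ) (J : ℕ) (z : ℝ → ℂ) : Grid J ℂ := fun j =>
  if 0 < (j : ℕ) ∧ (j : ℕ) < J + 1 then z (node xa xb J j) else 0

/-- `w` is the discrete elliptic projection of `v`: it vanishes at the end nodes, and its discrete
Laplacian takes the values of `v''` at the interior nodes. -/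
def IsEllipticProjection (xa xb : ℝ) (J : ℕ) (v : ℝ → ℂ) (w : Grid J ℂ) : Prop :=
  VanishesAtEnds w ∧
    discreteLaplacian (meshWidth xa xb J) w
      = interpZero xa xb J (iteratedDerivWithin 2 v (Icc xa xb))

section Norms

variable {E : Type*} [NormedAddCommGroup E] [NormedSpace ℝ E] {J : ℕ}

/-- The discrete derivative `(v_{j+1} - v_j) / h`, for `j = 0, …, J`. -/
def discreteDeriv (h : ℝ) (v : Grid J E) : Fin (J + 1) → E := fun j =>
  h⁻¹ • (v j.succ - v j.castSucc)

/-- The discrete `L²` norm. -/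
def normL2 (h : ℝ) (v : Grid J E) : ℝ := √(h * ∑ j, ‖v j‖ ^ 2)

/-- The discrete `H¹` seminorm. -/
def seminormH1 (h : ℝ) (v : Grid J E) : ℝ := √(h * ∑ j, ‖discreteDeriv h v j‖ ^ 2)

/-- The discrete `H¹` norm. -/
def normH1 (h : ℝ) (v : Grid J E) : ℝ := √(normL2 h v ^ 2 + seminormH1 h v ^ 2)

end Norms

/-- The space-time cylinder `Q = [0, T] × [x_a, x_b]`. -/
def cylinder (T xa xb : ℝ) : Set (ℝ × ℝ) := Icc 0 T ×ˢ Icc xa xb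

/-- `u` solves `u_t = i u_xx + i g(|u|²) u + f` on `Q`, with homogeneous Dirichlet boundary
conditions and the initial condition `u(0, ·) = u₀`. Derivatives at the boundary of `Q` are
one-sided. -/
structure IsSolution (T xa xb : ℝ) (g : ℝ → ℝ) (f : ℝ → ℝ → ℂ) (u₀ : ℝ → ℂ)
    (u : ℝ → ℝ → ℂ) : Prop where
  pde : ∀ t ∈ Icc 0 T, ∀ x ∈ Icc xa xb,
    derivWithin (fun s => u s x) (Icc 0 T) t
      = Complex.I * iteratedDerivWithin 2 (u t) (Icc xa xb) x
        + Complex.I * (g (‖u t x‖ ^ 2) : ℂ) * u t x + f t x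
  boundary : ∀ t ∈ Icc 0 T, u t xa = 0 ∧ u t xb = 0
  initial : ∀ x ∈ Icc xa xb, u 0 x = u₀ x

/-- `max_Q |u|`. -/
def uMax (T xa xb : ℝ) (u : ℝ → ℝ → ℂ) : ℝ :=
  sSup ((fun p : ℝ × ℝ => ‖u p.1 p.2‖) '' cylinder T xa xb)

/-- `max_Q |g(|u|²)|`. -/
def gMax (T xa xb : ℝ) (g : ℝ → ℝ) (u : ℝ → ℝ → ℂ) : ℝ :=
  sSup ((fun p : ℝ × ℝ => |g (‖u p.1 p.2‖ ^ 2)|) '' cylinder T xa xb)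

/-- One Crank-Nicolson type step of length `τ` from the grid function `v` to the grid function `w`,
with potential `φ` and forcing `F`:
`w - v = i τ Δ_h((w + v)/2) + i τ φ ⊗ (w + v)/2 + τ F`. -/
def LinearStep {J : ℕ} (τ h : ℝ) (φ : Grid J ℝ) (F v w : Grid J ℂ) : Prop :=
  ∀ j, w j - v j
    = Complex.I * τ * discreteLaplacian h (fun k => (w k + v k) / 2) j
      + Complex.I * τ * (φ j * ((w j + v j) / 2)) + τ * F j

/-- `(W, Φ)` are the approximations produced by the Relaxation Finite Difference method with `N`
time steps and `J` interior space nodes, started with the first-order choice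
`Φ^{1/2} = g(|u⁰|²)`. Here `W n` stands for `W^n` with `n = 0, …, N`, and `Φ n` stands for
`Φ^{n+1/2}` with `n = 0, …, N - 1`; the other entries are irrelevant. -/
structure IsApprox (T xa xb : ℝ) (g : ℝ → ℝ) (f : ℝ → ℝ → ℂ) (u₀ : ℝ → ℂ) (N J : ℕ)
    (W : ℕ → Grid J ℂ) (Φ : ℕ → Grid J ℝ) : Prop where
  vanish : ∀ n ≤ N, VanishesAtEnds (W n)
  start : IsEllipticProjection xa xb J u₀ (W 0)
  relax_start : ∀ j, Φ 0 j = g (‖u₀ (node xa xb J j)‖ ^ 2)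
  relax_step : ∀ n, 1 ≤ n → n < N → ∀ j, Φ n j = 2 * g (‖W n j‖ ^ 2) - Φ (n - 1) j
  step : ∀ n < N, LinearStep (timeStep T N) (meshWidth xa xb J) (Φ n)
    (interpZero xa xb J fun x => (f (timeNode T N (n + 1)) x + f (timeNode T N n) x) / 2)
    (W n) (W (n + 1))

/-- Summation by parts: `Σ_j conj(v_j) (Δ_h v)_j = -h⁻² Σ_j |v_{j+1} - v_j|²` for grid functions
that vanish at both endpoints. -/
theorem sum_conj_mul_discreteLaplacian {J : ℕ} (h : ℝ) (v : Grid J ℂ) (hv : VanishesAtEnds v) :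
    ∑ j, (starRingEnd ℂ) (v j) * discreteLaplacian h v j
      = ((-(∑ j : Fin (J + 1), ‖v j.succ - v j.castSucc‖ ^ 2) / h ^ 2 : ℝ) : ℂ) := by
  have key : ∀ (V : ℕ → ℂ) (K : ℕ),
      ∑ j ∈ Finset.range K, (starRingEnd ℂ) (V (j + 1)) * (V j - 2 * V (j + 1) + V (j + 2))
        + ∑ j ∈ Finset.range K, (starRingEnd ℂ) (V (j + 1) - V j) * (V (j + 1) - V j)
        = (starRingEnd ℂ) (V K) * (V (K + 1) - V K) - (starRingEnd ℂ) (V 0) * (V 1 - V 0) := by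
    intro V K
    induction K with
    | zero => simp
    | succ K ih =>
      rw [Finset.sum_range_succ, Finset.sum_range_succ]
      simp only [map_sub] at ih ⊢
      linear_combination ih
  set V : ℕ → ℂ := fun n => if hn : n < J + 2 then v ⟨n, hn⟩ else 0 with hV
  have hVj : ∀ n (hn : n < J + 2), V n = v ⟨n, hn⟩ := fun n hn => by simp [hV, hn]
  have h0 : V 0 = 0 := by rw [hVj 0 (by omega)]; exact hv.1
  have h1 : V (J + 1) = 0 := by rw [hVj (J + 1) (by omega)]; exact hv.2
  have hL : ∑ j, (starRingEnd ℂ) (v j) * discreteLaplacian h v j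
      = ∑ j ∈ Finset.range J,
        (starRingEnd ℂ) (V (j + 1)) * (V j - 2 * V (j + 1) + V (j + 2)) / (h : ℂ) ^ 2 := by
    rw [Fin.sum_univ_succ, Fin.sum_univ_castSucc, Finset.sum_range]
    have e1 : v 0 = 0 := hv.1
    have e2 : v (Fin.last J).succ = 0 := hv.2
    simp only [e1, e2, map_zero, zero_mul, zero_add, add_zero]
    refine Finset.sum_congr rfl fun i _ => ?_
    have hi := i.isLt
    rw [hVj (i + 1) (by omega), hVj i (by omega), hVj (i + 2) (by omega)]
    simp only [discreteLaplacian]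
    rw [dif_pos ⟨by simp, by simp⟩, mul_div_assoc]
    rfl
  have hR : ∑ j : Fin (J + 1), (‖v j.succ - v j.castSucc‖ ^ 2 : ℂ)
      = ∑ j ∈ Finset.range (J + 1), (starRingEnd ℂ) (V (j + 1) - V j) * (V (j + 1) - V j) := by
    rw [Finset.sum_range]
    refine Finset.sum_congr rfl fun i _ => ?_
    have hi := i.isLt
    rw [hVj (i + 1) (by omega), hVj i (by omega), mul_comm, Complex.mul_conj,
      Complex.normSq_eq_norm_sq]
    push_cast
    rfl
  rw [hL, ← Finset.sum_div]
  push_cast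
  rw [hR, Finset.sum_range_succ]
  congr 1
  have hk := key V J
  rw [h0, h1] at hk
  rw [h1]
  simp only [map_sub, map_neg, map_zero, zero_sub] at hk ⊢
  linear_combination hk

/-- The equation `a v - b Δ_h v - c φ ⊗ v = F`, with zero values at both endpoints, is solvable
as soon as the homogeneous equation has only the trivial solution. -/
theorem exists_of_injective {J : ℕ} (h : ℝ) (a b c : ℂ) (φ : Grid J ℝ) (F : Grid J ℂ)
    (hF : VanishesAtEnds F)
    (hinj : ∀ v : Grid J ℂ, VanishesAtEnds v →
      (∀ j, a * v j - b * discreteLaplacian h v j - c * (φ j * v j) = 0) → v = 0) :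
    ∃ v : Grid J ℂ, VanishesAtEnds v ∧
      ∀ j, a * v j - b * discreteLaplacian h v j - c * (φ j * v j) = F j := by
  let A : Grid J ℂ →ₗ[ℂ] Grid J ℂ :=
    { toFun := fun v j => if 0 < (j : ℕ) ∧ (j : ℕ) < J + 1 then
        a * v j - b * discreteLaplacian h v j - c * (φ j * v j) else v j
      map_add' := by
        intro v w
        ext j
        by_cases hj : 0 < (j : ℕ) ∧ (j : ℕ) < J + 1
        · simp only [discreteLaplacian, hj, and_self, if_true, dif_pos, Pi.add_apply]
          ring
        · simp only [if_neg hj, Pi.add_apply]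
      map_smul' := by
        intro r v
        ext j
        by_cases hj : 0 < (j : ℕ) ∧ (j : ℕ) < J + 1
        · simp only [discreteLaplacian, hj, and_self, if_true, dif_pos, Pi.smul_apply,
            smul_eq_mul, RingHom.id_apply]
          ring
        · simp only [if_neg hj, Pi.smul_apply, RingHom.id_apply] }
  have hends : ∀ (v G : Grid J ℂ), A v = G → VanishesAtEnds G → VanishesAtEnds v := by
    intro v G e hG
    have e0 := congrFun e 0
    have e1 := congrFun e (Fin.last (J + 1))
    simp only [A, LinearMap.coe_mk, AddHom.coe_mk] at e0 e1
    rw [if_neg (by simp)] at e0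
    rw [if_neg (by simp)] at e1
    exact ⟨e0.trans hG.1, e1.trans hG.2⟩
  have heq : ∀ (v G : Grid J ℂ), A v = G → VanishesAtEnds G →
      ∀ j, a * v j - b * discreteLaplacian h v j - c * (φ j * v j) = G j := by
    intro v G e hG j
    by_cases hj : 0 < (j : ℕ) ∧ (j : ℕ) < J + 1
    · have ej := congrFun e j
      simpa only [A, LinearMap.coe_mk, AddHom.coe_mk, if_pos hj] using ej
    · have hv := hends v G e hG
      have hvj : v j = 0 ∧ G j = 0 := by
        rcases Nat.eq_zero_or_pos (j : ℕ) with h0 | h0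
        · have : j = 0 := Fin.ext h0
          exact this ▸ ⟨hv.1, hG.1⟩
        · have : j = Fin.last (J + 1) := Fin.ext (by
            have := j.isLt
            simp only [Fin.val_last]
            omega)
          exact this ▸ ⟨hv.2, hG.2⟩
      simp only [discreteLaplacian, dif_neg hj, hvj.1, hvj.2, mul_zero, sub_zero]
  have hA : Function.Injective A := by
    refine (injective_iff_map_eq_zero A).2 fun v hv => ?_
    have hz : VanishesAtEnds (0 : Grid J ℂ) := ⟨rfl, rfl⟩
    exact hinj v (hends v 0 hv hz) (fun j => by simpa using heq v 0 hv hz j)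
  obtain ⟨v, hv⟩ := LinearMap.surjective_of_injective hA F
  exact ⟨v, hends v F hv hF, heq v F hv hF⟩

theorem vanishesAtEnds_interpZero (xa xb : ℝ) (J : ℕ) (z : ℝ → ℂ) :
    VanishesAtEnds (interpZero xa xb J z) := by
  simp [VanishesAtEnds, interpZero]

theorem vanishesAtEnds_discreteLaplacian {J : ℕ} (h : ℝ) (v : Grid J ℂ) :
    VanishesAtEnds (discreteLaplacian h v) := by
  simp [VanishesAtEnds, discreteLaplacian]

/-- Every function has a discrete elliptic projection. -/
theorem exists_isEllipticProjection {xa xb : ℝ} (hx : xa < xb) (J : ℕ) (v : ℝ → ℂ) :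
    ∃ w, IsEllipticProjection xa xb J v w := by
  have hh : meshWidth xa xb J ≠ 0 := by
    have : 0 < meshWidth xa xb J := div_pos (by linarith) (by positivity)
    exact this.ne'
  obtain ⟨w, hw, e⟩ := exists_of_injective (meshWidth xa xb J) 0 (-1) 0 (fun _ => 0)
    (interpZero xa xb J (iteratedDerivWithin 2 v (Icc xa xb)))
    (vanishesAtEnds_interpZero _ _ _ _) (fun w hw e => by
      have e' : ∀ j, discreteLaplacian (meshWidth xa xb J) w j = 0 := fun j => by
        simpa using e j
      have s := sum_conj_mul_discreteLaplacian (meshWidth xa xb J) w hw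
      simp only [e', mul_zero, Finset.sum_const_zero] at s
      have s' := (Complex.ofReal_eq_zero.1 s.symm)
      rw [div_eq_zero_iff, neg_eq_zero] at s'
      have s2 := s'.resolve_right (pow_ne_zero 2 hh)
      rw [Finset.sum_eq_zero_iff_of_nonneg (fun _ _ => by positivity)] at s2
      funext j
      induction j using Fin.induction with
      | zero => exact hw.1
      | succ i ih =>
        have := s2 i (Finset.mem_univ _)
        rw [sq_eq_zero_iff, norm_eq_zero, ih, sub_eq_zero] at this
        exact this)
  exact ⟨w, hw, funext fun j => by simpa using e j⟩

/-- Every linear step of the method is solvable. -/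
theorem exists_linearStep {J : ℕ} (τ h : ℝ) (φ : Grid J ℝ) (F v : Grid J ℂ)
    (hF : VanishesAtEnds F) (hv : VanishesAtEnds v) :
    ∃ w, VanishesAtEnds w ∧ LinearStep τ h φ F v w := by
  obtain ⟨y, hy, e⟩ := exists_of_injective h 2 (Complex.I * τ) (Complex.I * τ) φ
    (fun j => 2 * v j + τ * F j) (by simp [VanishesAtEnds, hF.1, hF.2, hv.1, hv.2])
    (fun y hy e => by
      have s := sum_conj_mul_discreteLaplacian h y hy
      have e2 : ∑ j, (starRingEnd ℂ) (y j)
          * (2 * y j - Complex.I * τ * discreteLaplacian h y j - Complex.I * τ * (φ j * y j))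
          = 0 := Finset.sum_eq_zero fun j _ => by rw [e j, mul_zero]
      have e3 : ∑ j, (starRingEnd ℂ) (y j)
          * (2 * y j - Complex.I * τ * discreteLaplacian h y j - Complex.I * τ * (φ j * y j))
          = 2 * ((∑ j, ‖y j‖ ^ 2 : ℝ) : ℂ)
            - Complex.I * τ * ∑ j, (starRingEnd ℂ) (y j) * discreteLaplacian h y j
            - Complex.I * τ * ((∑ j, φ j * ‖y j‖ ^ 2 : ℝ) : ℂ) := by
        push_cast
        rw [Finset.mul_sum, Finset.mul_sum, Finset.mul_sum, ← Finset.sum_sub_distrib,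
          ← Finset.sum_sub_distrib]
        refine Finset.sum_congr rfl fun j _ => ?_
        have hn : (starRingEnd ℂ) (y j) * y j = (‖y j‖ : ℂ) ^ 2 := Complex.conj_mul' (y j)
        rw [← hn]
        ring
      rw [e3, s] at e2
      have e4 := congrArg Complex.re e2
      rw [mul_assoc Complex.I, mul_assoc Complex.I, ← Complex.ofReal_mul, ← Complex.ofReal_mul,
        Complex.sub_re, Complex.sub_re, Complex.re_mul_ofReal] at e4
      simp only [Complex.re_ofNat, Complex.re_mul_ofReal, Complex.I_re, zero_mul, sub_zero,
        Complex.zero_re] at e4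
      have e5 : ∑ j, ‖y j‖ ^ 2 = 0 := by linarith
      rw [Finset.sum_eq_zero_iff_of_nonneg (fun _ _ => by positivity)] at e5
      funext j
      simpa using e5 j (Finset.mem_univ _))
  refine ⟨fun j => 2 * y j - v j, by simp [VanishesAtEnds, hy.1, hy.2, hv.1, hv.2], fun j => ?_⟩
  have hm : (fun k => (2 * y k - v k + v k) / 2) = y := by
    funext k
    ring
  rw [hm]
  linear_combination e j

/-- The approximations of the method exist, whatever the data are. -/
theorem exists_isApprox {T xa xb : ℝ} (hx : xa < xb) (g : ℝ → ℝ) (f : ℝ → ℝ → ℂ) (u₀ : ℝ → ℂ)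
    (N J : ℕ) : ∃ W Φ, IsApprox T xa xb g f u₀ N J W Φ := by
  classical
  let F : ℕ → Grid J ℂ := fun n => interpZero xa xb J fun x =>
    (f (timeNode T N (n + 1)) x + f (timeNode T N n) x) / 2
  have hF : ∀ n, VanishesAtEnds (F n) := fun n => vanishesAtEnds_interpZero _ _ _ _
  obtain ⟨w0, hw0⟩ := exists_isEllipticProjection hx J u₀
  choose nx hnx using fun (n : ℕ) (v : {v : Grid J ℂ // VanishesAtEnds v}) (φ : Grid J ℝ) =>
    exists_linearStep (timeStep T N) (meshWidth xa xb J) φ (F n) v.1 (hF n) v.2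
  let P : ℕ → {v : Grid J ℂ // VanishesAtEnds v} × Grid J ℝ := fun n =>
    Nat.rec (⟨w0, hw0.1⟩, fun j => g (‖u₀ (node xa xb J j)‖ ^ 2))
      (fun n p => (⟨nx n p.1 p.2, (hnx n p.1 p.2).1⟩,
        fun j => 2 * g (‖nx n p.1 p.2 j‖ ^ 2) - p.2 j)) n
  refine ⟨fun n => (P n).1.1, fun n => (P n).2, fun n _ => (P n).1.2, hw0, fun j => rfl, ?_, ?_⟩
  · intro n hn _ j
    obtain ⟨k, rfl⟩ := Nat.exists_eq_add_of_le' hn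
    rfl
  · intro n _
    exact (hnx n (P n).1 (P n).2).2

end RFD

end

/-! Write e and ρ for the errors of the solution and of the potential, and θ for the discrete
elliptic projection of the exact solution minus W. The projection error is O(h²) in the discrete H¹
seminorm, and its first and second time differences gain factors τ and τ²
(`exists_projection_bounds`). So it suffices to bound θ, which starts at 0 and solves a
Crank-Nicolson equation whose forcing F is built from the products Pe, ρU, ρe and a consistency
error (`exists_errorSystem`).

The energy is `stepNorm`, the seminorm of v - i(τ/2)Δ_h v. As iΔ_h is skew-adjoint, changing the
sign of τ does not change it, so one step adds at most τ|F|₁, whatever the relation between τ and h.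
In one dimension the discrete H¹ seminorm controls the maximum, and products and smooth compositions
are estimated in it directly.

The difficulty is the relaxation equation, ρ^{n+1} + ρ^n = 2(G(u^{n+1}) - G(u^{n+1} - e^{n+1})) +
O(τ²) with G(z) = g(|z|²): solved for ρ^{n+1}, it adds a term of size e at every step with no factor
τ. Subtracting consecutive equations instead bounds ρ^{n+2} - ρ^n by e^{n+2} - e^{n+1} plus τ times
the errors (`exists_ρ_sub_le`). One-step differences of θ are recovered from two-step ones through
the equation itself (`seminormH1_le_of_step`), and θ^{n+2} - θ^n is propagated with forcing F^{n+2}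
- F^n, which is again controlled by ρ^{n+2} - ρ^n (`ErrorSystem.forcing_sub_le`). Grönwall for the
sizes of θ, ρ and (θ^{n+2} - θ^n)/τ closes the loop (`RelaxationRecursion.bounds`): ρ = O(τ + h²)
and θ^{n+1} - θ^n = O(τ(τ + h²)).

For second order in time, the first-order part of ρ alternates in sign, so that ρ^{n+1} + ρ^n is
bounded by e^{n+1} and τ² + h². In F^{n+1} + F^n the error ρ enters only through this sum, with a
factor τ, or multiplied by e. A second Grönwall argument gives θ^{n+1} + θ^n = O(τ² + h²), and half
sums and half differences give θ^n itself.

The nonlinear estimates hold only while the errors stay below 1. The Grönwall inequality carries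
this threshold along provided τ + h² is small, which a large constant in the mesh condition
guarantees. -/

noncomputable section

namespace RFD

/-! ### Discrete H¹ seminorm and stability of the free Crank-Nicolson step. -/

section GridNorms

variable {J : ℕ} {h : ℝ}

theorem seminormH1_eq_norm (hh : 0 < h) (v : Grid J ℂ) :
    seminormH1 h v
      = (√h)⁻¹ * ‖WithLp.toLp 2 (fun j : Fin (J + 1) => v j.succ - v j.castSucc)‖ := by
  rw [EuclideanSpace.norm_eq, seminormH1, ← Real.sqrt_inv, ← Real.sqrt_mul (by positivity)]
  congr 1
  rw [Finset.mul_sum, Finset.mul_sum]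
  refine Finset.sum_congr rfl fun j _ => ?_
  rw [discreteDeriv, norm_smul, Real.norm_eq_abs, mul_pow, sq_abs]
  field_simp

theorem seminormH1_nonneg (v : Grid J ℂ) : 0 ≤ seminormH1 h v := Real.sqrt_nonneg _

theorem seminormH1_add_le (hh : 0 < h) (v w : Grid J ℂ) :
    seminormH1 h (v + w) ≤ seminormH1 h v + seminormH1 h w := by
  simp only [seminormH1_eq_norm hh]
  rw [← mul_add]
  refine mul_le_mul_of_nonneg_left ?_ (by positivity)
  refine le_trans (le_of_eq ?_) (norm_add_le _ _)
  congr 1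
  ext j
  simp
  ring

theorem seminormH1_smul (hh : 0 < h) (c : ℂ) (v : Grid J ℂ) :
    seminormH1 h (c • v) = ‖c‖ * seminormH1 h v := by
  simp only [seminormH1_eq_norm hh]
  rw [mul_left_comm, ← norm_smul]
  congr 2
  ext j
  simp
  ring

theorem seminormH1_neg (hh : 0 < h) (v : Grid J ℂ) : seminormH1 h (-v) = seminormH1 h v := by
  simpa using seminormH1_smul hh (-1) v

theorem seminormH1_sub_le (hh : 0 < h) (v w : Grid J ℂ) :
    seminormH1 h (v - w) ≤ seminormH1 h v + seminormH1 h w := by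
  rw [sub_eq_add_neg, ← seminormH1_neg hh w]
  exact seminormH1_add_le hh _ _

theorem seminormH1_zero (hh : 0 < h) : seminormH1 h (0 : Grid J ℂ) = 0 := by
  simpa using seminormH1_smul hh 0 (0 : Grid J ℂ)

/-- A bound on the increments gives a bound on the discrete `H¹` seminorm. -/
theorem seminormH1_le_of_increments (hh : 0 < h) {v a b : Grid J ℂ} {α β γ : ℝ} (hα : 0 ≤ α)
    (hβ : 0 ≤ β) (hγ : 0 ≤ γ)
    (H : ∀ j : Fin (J + 1), ‖v j.succ - v j.castSucc‖
      ≤ α * h + β * ‖a j.succ - a j.castSucc‖ + γ * ‖b j.succ - b j.castSucc‖) :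
    seminormH1 h v
      ≤ α * √(h * (J + 1)) + β * seminormH1 h a + γ * seminormH1 h b := by
  set x : EuclideanSpace ℝ (Fin (J + 1)) := WithLp.toLp 2 (fun _ => h)
  set y : EuclideanSpace ℝ (Fin (J + 1)) := WithLp.toLp 2 (fun j => ‖a j.succ - a j.castSucc‖)
  set z : EuclideanSpace ℝ (Fin (J + 1)) := WithLp.toLp 2 (fun j => ‖b j.succ - b j.castSucc‖)
  have hx : (√h)⁻¹ * ‖x‖ = √(h * (J + 1)) := by
    rw [EuclideanSpace.norm_eq, ← Real.sqrt_inv, ← Real.sqrt_mul (by positivity)]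
    congr 1
    simp [x]
    field_simp
  have e : ∀ w : Grid J ℂ, seminormH1 h w = (√h)⁻¹ *
      ‖(WithLp.toLp 2 (fun j => ‖w j.succ - w j.castSucc‖) : EuclideanSpace ℝ (Fin (J + 1)))‖ := by
    intro w
    rw [seminormH1_eq_norm hh, EuclideanSpace.norm_eq, EuclideanSpace.norm_eq]
    simp
  rw [← hx, e a, e b, seminormH1_eq_norm hh]
  calc (√h)⁻¹ * ‖WithLp.toLp 2 (fun j : Fin (J + 1) => v j.succ - v j.castSucc)‖
      ≤ (√h)⁻¹ * ‖α • x + β • y + γ • z‖ := by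
        refine mul_le_mul_of_nonneg_left ?_ (by positivity)
        rw [EuclideanSpace.norm_eq, EuclideanSpace.norm_eq]
        refine Real.sqrt_le_sqrt (Finset.sum_le_sum fun j _ => ?_)
        refine pow_le_pow_left₀ (norm_nonneg _) ((H j).trans (le_trans (le_of_eq ?_)
          (le_abs_self _))) 2
        simp [x, y, z]
    _ ≤ (√h)⁻¹ * (α * ‖x‖ + β * ‖y‖ + γ * ‖z‖) := by
        refine mul_le_mul_of_nonneg_left ?_ (by positivity)
        refine (norm_add₃_le).trans (le_of_eq ?_)
        rw [norm_smul, norm_smul, norm_smul, Real.norm_of_nonneg hα, Real.norm_of_nonneg hβ,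
          Real.norm_of_nonneg hγ]
    _ = _ := by ring

/-- The discrete Sobolev inequality. -/
theorem norm_le_seminormH1 (hh : 0 < h) {v : Grid J ℂ} (hv : v 0 = 0) (j : Fin (J + 2)) :
    ‖v j‖ ≤ √(h * (J + 1)) * seminormH1 h v := by
  -- Telescoping from the left end, where v vanishes; Cauchy-Schwarz on the increments follows.
  have key : ∀ j : Fin (J + 2), ‖v j‖ ≤ ∑ i : Fin (J + 1) with i.val < j.val,
      ‖v i.succ - v i.castSucc‖ := by
    intro j
    induction j using Fin.induction with
    | zero => simp [hv]
    | succ i ih =>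
      have hs : (Finset.univ.filter fun k : Fin (J + 1) => k.val < i.succ.val)
          = insert i (Finset.univ.filter fun k : Fin (J + 1) => k.val < i.castSucc.val) := by
        ext k
        simp only [Finset.mem_filter, Finset.mem_univ, true_and, Finset.mem_insert, Fin.val_succ,
          Fin.val_castSucc, Fin.ext_iff]
        omega
      rw [hs, Finset.sum_insert (by simp)]
      calc ‖v i.succ‖ = ‖(v i.succ - v i.castSucc) + v i.castSucc‖ := by rw [sub_add_cancel]
        _ ≤ _ := norm_add_le _ _
        _ ≤ _ := by gcongr
  have h2 : ‖v j‖ ≤ ∑ i : Fin (J + 1), ‖v i.succ - v i.castSucc‖ :=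
    (key j).trans (Finset.sum_le_sum_of_subset_of_nonneg (Finset.filter_subset _ _)
      fun _ _ _ => norm_nonneg _)
  refine h2.trans ?_
  rw [seminormH1_eq_norm hh, EuclideanSpace.norm_eq]
  have h3 : (∑ i : Fin (J + 1), ‖v i.succ - v i.castSucc‖) ^ 2
      ≤ (J + 1) * ∑ i : Fin (J + 1), ‖v i.succ - v i.castSucc‖ ^ 2 := by
    simpa using sq_sum_le_card_mul_sum_sq (s := Finset.univ)
      (f := fun i : Fin (J + 1) => ‖v i.succ - v i.castSucc‖)
  have h4 := Real.abs_le_sqrt h3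
  rw [abs_of_nonneg (by positivity)] at h4
  refine h4.trans (le_of_eq ?_)
  have : √h ≠ 0 := (Real.sqrt_pos.2 hh).ne'
  rw [Real.sqrt_mul (by positivity), Real.sqrt_mul hh.le]
  field_simp

/-- Poincaré: the pointwise Sobolev bound is summed over the J + 2 nodes, and J + 2 ≤ 2(J + 1)
produces the factor 2. -/
theorem normH1_le (hh : 0 < h) {v : Grid J ℂ} (hv : VanishesAtEnds v) :
    normH1 h v ≤ √(1 + 2 * (h * (J + 1)) ^ 2) * seminormH1 h v := by
  have hs := seminormH1_nonneg (h := h) v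
  rw [normH1]
  conv_rhs => rw [← Real.sqrt_sq hs]
  rw [← Real.sqrt_mul (by positivity)]
  refine Real.sqrt_le_sqrt ?_
  have : normL2 h v ^ 2 ≤ 2 * (h * (J + 1)) ^ 2 * seminormH1 h v ^ 2 := by
    rw [normL2, Real.sq_sqrt (by positivity)]
    calc h * ∑ j, ‖v j‖ ^ 2
        ≤ h * ∑ _j : Fin (J + 2), (√(h * (J + 1)) * seminormH1 h v) ^ 2 := by
          gcongr with j
          exact norm_le_seminormH1 hh hv.1 j
      _ = h * (J + 2) * (h * (J + 1)) * seminormH1 h v ^ 2 := by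
          rw [mul_pow, Real.sq_sqrt (by positivity)]
          simp
          ring
      _ ≤ _ := by
          have : (J : ℝ) + 2 ≤ 2 * (J + 1) := by linarith [(Nat.cast_nonneg J : (0 : ℝ) ≤ J)]
          have : h * (J + 2) * (h * (J + 1)) ≤ 2 * (h * (J + 1)) ^ 2 := by
            calc h * (J + 2) * (h * (J + 1)) ≤ h * (2 * (J + 1)) * (h * (J + 1)) := by gcongr
              _ = _ := by ring
          gcongr
  linarith

theorem discreteLaplacian_add (v w : Grid J ℂ) :
    discreteLaplacian h (v + w) = discreteLaplacian h v + discreteLaplacian h w := by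
  ext j
  simp only [discreteLaplacian, Pi.add_apply]
  split_ifs <;> ring

theorem discreteLaplacian_smul (c : ℂ) (v : Grid J ℂ) :
    discreteLaplacian h (c • v) = c • discreteLaplacian h v := by
  ext j
  simp only [discreteLaplacian, Pi.smul_apply, smul_eq_mul]
  split_ifs <;> ring

theorem discreteLaplacian_sub (v w : Grid J ℂ) :
    discreteLaplacian h (v - w) = discreteLaplacian h v - discreteLaplacian h w := by
  have : v - w = v + (-1 : ℂ) • w := by simp [sub_eq_add_neg]
  rw [this, discreteLaplacian_add, discreteLaplacian_smul]
  simp [sub_eq_add_neg]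

theorem VanishesAtEnds.add {v w : Grid J ℂ} (hv : VanishesAtEnds v) (hw : VanishesAtEnds w) :
    VanishesAtEnds (v + w) := by simp [VanishesAtEnds, hv.1, hv.2, hw.1, hw.2]

theorem VanishesAtEnds.sub {v w : Grid J ℂ} (hv : VanishesAtEnds v) (hw : VanishesAtEnds w) :
    VanishesAtEnds (v - w) := by simp [VanishesAtEnds, hv.1, hv.2, hw.1, hw.2]

theorem VanishesAtEnds.smul {v : Grid J ℂ} (c : ℂ) (hv : VanishesAtEnds v) :
    VanishesAtEnds (c • v) := by simp [VanishesAtEnds, hv.1, hv.2]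

theorem seminormH1_sq (hh : 0 < h) {v : Grid J ℂ} (hv : VanishesAtEnds v) :
    ((seminormH1 h v ^ 2 : ℝ) : ℂ)
      = -(h : ℂ) * ∑ j, (starRingEnd ℂ) (v j) * discreteLaplacian h v j := by
  rw [sum_conj_mul_discreteLaplacian h v hv, seminormH1_eq_norm hh, mul_pow,
    EuclideanSpace.norm_sq_eq, inv_pow, Real.sq_sqrt hh.le]
  push_cast
  have : (h : ℂ) ≠ 0 := by exact_mod_cast hh.ne'
  field_simp

/-- `v ± i c Δ_h v` have the same discrete `H¹` seminorm, since `i Δ_h` is skew-adjoint. -/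
theorem seminormH1_sq_add_smul_discreteLaplacian (hh : 0 < h) {v : Grid J ℂ}
    (hv : VanishesAtEnds v) (c : ℝ) :
    seminormH1 h (v + (Complex.I * c) • discreteLaplacian h v) ^ 2
      = seminormH1 h v ^ 2 + c ^ 2 * seminormH1 h (discreteLaplacian h v) ^ 2 := by
  set d := discreteLaplacian h v with hd
  have hdv : VanishesAtEnds d := vanishesAtEnds_discreteLaplacian h v
  set X : ℂ := ∑ j, (starRingEnd ℂ) (v j) * discreteLaplacian h d j
  set Y : ℝ := ∑ j, ‖d j‖ ^ 2 with hY
  have hYc : (Y : ℂ) = ∑ j, (starRingEnd ℂ) (d j) * d j := by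
    rw [hY]
    push_cast
    exact Finset.sum_congr rfl fun j _ => (Complex.conj_mul' (d j)).symm
  have expand : ∀ z : ℂ, ((seminormH1 h (v + z • d) ^ 2 : ℝ) : ℂ)
      = ((seminormH1 h v ^ 2 : ℝ) : ℂ)
        + (starRingEnd ℂ) z * z * ((seminormH1 h d ^ 2 : ℝ) : ℂ)
        - h * (z * X + (starRingEnd ℂ) z * Y) := by
    intro z
    rw [seminormH1_sq hh (hv.add (hdv.smul z)), seminormH1_sq hh hv, seminormH1_sq hh hdv,
      discreteLaplacian_add, discreteLaplacian_smul, hYc, ← hd]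
    simp only [Pi.add_apply, Pi.smul_apply, smul_eq_mul, map_add, map_mul, X, Finset.mul_sum,
      ← Finset.sum_add_distrib, ← Finset.sum_sub_distrib]
    refine Finset.sum_congr rfl fun j _ => ?_
    ring
  -- Polarization: the squared seminorm is real, so the imaginary parts at z = 1 and z = i give Im X
  -- = 0 and Re X = Y. This is the symmetry of Δ_h, read off from the summation by parts formula.
  -- For purely imaginary z the cross term then vanishes.
  have i1 := congrArg Complex.im (expand 1)
  have i2 := congrArg Complex.im (expand Complex.I)
  have hX : X = Y := by
    have hh' := hh.ne'
    simp [-Complex.ofReal_pow] at i1 i2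
    apply Complex.ext
    · rcases i2 with i2 | i2
      · exact absurd i2 hh'
      · simp; linarith
    · rcases i1 with i1 | i1
      · exact absurd i1 hh'
      · simpa using i1
  have i3 := expand (Complex.I * c)
  rw [hX] at i3
  have i4 : ((seminormH1 h (v + (Complex.I * c) • d) ^ 2 : ℝ) : ℂ)
      = ((seminormH1 h v ^ 2 + c ^ 2 * seminormH1 h d ^ 2 : ℝ) : ℂ) := by
    rw [i3]
    simp only [map_mul, Complex.conj_I, Complex.conj_ofReal]
    push_cast
    ring_nf
    simp
  exact_mod_cast i4

/-- Discrete elliptic regularity in its weakest form. -/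
theorem seminormH1_le_of_discreteLaplacian_le (hh : 0 < h) {v : Grid J ℂ} (hv : VanishesAtEnds v)
    {A : ℝ} (H : ∀ j, ‖discreteLaplacian h v j‖ ≤ A) :
    seminormH1 h v ≤ 2 * (h * (J + 1)) * √(h * (J + 1)) * A := by
  have hA : 0 ≤ A := (norm_nonneg _).trans (H 0)
  have hs := seminormH1_nonneg (h := h) v
  have h1 := congrArg norm (seminormH1_sq hh hv)
  rw [Complex.norm_real, Real.norm_of_nonneg (by positivity)] at h1
  have h2 : seminormH1 h v ^ 2
      ≤ 2 * (h * (J + 1)) * √(h * (J + 1)) * A * seminormH1 h v := by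
    rw [h1, norm_mul, norm_neg, Complex.norm_real, Real.norm_of_nonneg hh.le]
    calc h * ‖∑ j, (starRingEnd ℂ) (v j) * discreteLaplacian h v j‖
        ≤ h * ∑ _j : Fin (J + 2), √(h * (J + 1)) * seminormH1 h v * A := by
          refine mul_le_mul_of_nonneg_left ?_ hh.le
          refine (norm_sum_le _ _).trans (Finset.sum_le_sum fun j _ => ?_)
          rw [norm_mul, RCLike.norm_conj]
          exact mul_le_mul (norm_le_seminormH1 hh hv.1 j) (H j) (norm_nonneg _) (by positivity)
      _ = (h * (J + 2)) * (√(h * (J + 1)) * seminormH1 h v * A) := by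
          simp
          ring
      _ ≤ (2 * (h * (J + 1))) * (√(h * (J + 1)) * seminormH1 h v * A) := by
          refine mul_le_mul_of_nonneg_right ?_ (by positivity)
          nlinarith [(Nat.cast_nonneg J : (0 : ℝ) ≤ J)]
      _ = _ := by ring
  -- One factor of the seminorm is cancelled from h2; arguing by contradiction makes it positive.
  by_contra! hc
  have h0 : 0 ≤ 2 * (h * (J + 1)) * √(h * (J + 1)) * A := by positivity
  have : 0 < seminormH1 h v := h0.trans_lt hc
  nlinarith

/-- The norm `|v - i (τ/2) Δ_h v|₁`, in which the Crank-Nicolson step is stable. -/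
def stepNorm (τ h : ℝ) (v : Grid J ℂ) : ℝ :=
  seminormH1 h (v - (Complex.I * (τ / 2)) • discreteLaplacian h v)

theorem stepNorm_nonneg (τ : ℝ) (v : Grid J ℂ) : 0 ≤ stepNorm τ h v := seminormH1_nonneg _

theorem stepNorm_sq (hh : 0 < h) (τ : ℝ) {v : Grid J ℂ} (hv : VanishesAtEnds v) :
    stepNorm τ h v ^ 2
      = seminormH1 h v ^ 2 + (τ / 2) ^ 2 * seminormH1 h (discreteLaplacian h v) ^ 2 := by
  have := seminormH1_sq_add_smul_discreteLaplacian hh hv (-(τ / 2))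
  rw [stepNorm]
  rw [neg_sq] at this
  rw [← this, sub_eq_add_neg, ← neg_smul]
  push_cast
  simp

theorem stepNorm_eq_add (hh : 0 < h) (τ : ℝ) {v : Grid J ℂ} (hv : VanishesAtEnds v) :
    stepNorm τ h v = seminormH1 h (v + (Complex.I * (τ / 2)) • discreteLaplacian h v) := by
  have h1 := stepNorm_sq hh τ hv
  have h2 := seminormH1_sq_add_smul_discreteLaplacian hh hv (τ / 2)
  rw [← h2] at h1
  have := (sq_eq_sq₀ (stepNorm_nonneg _ _) (seminormH1_nonneg _)).1 h1
  rw [this]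
  push_cast
  rfl

theorem seminormH1_le_stepNorm (hh : 0 < h) (τ : ℝ) {v : Grid J ℂ} (hv : VanishesAtEnds v) :
    seminormH1 h v ≤ stepNorm τ h v := by
  refine (sq_le_sq₀ (seminormH1_nonneg _) (stepNorm_nonneg _ _)).1 ?_
  rw [stepNorm_sq hh τ hv]
  have : 0 ≤ (τ / 2) ^ 2 * seminormH1 h (discreteLaplacian h v) ^ 2 := by positivity
  linarith

theorem stepNorm_add_le (hh : 0 < h) (τ : ℝ) (v w : Grid J ℂ) :
    stepNorm τ h (v + w) ≤ stepNorm τ h v + stepNorm τ h w := by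
  refine le_trans (le_of_eq ?_) (seminormH1_add_le hh _ _)
  rw [stepNorm, discreteLaplacian_add]
  congr 1
  ext j
  simp
  ring

/-- Stability of one Crank-Nicolson step for the free equation. -/
theorem stepNorm_le_of_step (hh : 0 < h) {τ : ℝ} (hτ : 0 ≤ τ) {a b F : Grid J ℂ}
    (hb : VanishesAtEnds b)
    (H : a - b = (Complex.I * (τ / 2)) • discreteLaplacian h (a + b) + (τ : ℂ) • F) :
    stepNorm τ h a ≤ stepNorm τ h b + τ * seminormH1 h F := by
  have e : a - (Complex.I * (τ / 2)) • discreteLaplacian h a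
      = (b + (Complex.I * (τ / 2)) • discreteLaplacian h b) + (τ : ℂ) • F := by
    rw [discreteLaplacian_add] at H
    ext j
    have := congrFun H j
    simp only [Pi.sub_apply, Pi.add_apply, Pi.smul_apply, smul_eq_mul] at this ⊢
    linear_combination this
  rw [stepNorm, e, stepNorm_eq_add hh τ hb]
  refine (seminormH1_add_le hh _ _).trans ?_
  rw [seminormH1_smul hh, Complex.norm_real, Real.norm_of_nonneg hτ]

/-- If `a - b` is produced by a Crank-Nicolson step, then `a` and `b` are separately controlled
by `a + b` in the step norm. -/
theorem seminormH1_le_of_step (hh : 0 < h) {τ : ℝ} (hτ : 0 ≤ τ) {a b F : Grid J ℂ}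
    (hab : VanishesAtEnds (a + b))
    (H : a - b = (Complex.I * (τ / 2)) • discreteLaplacian h (a + b) + (τ : ℂ) • F) :
    seminormH1 h a ≤ stepNorm τ h (a + b) + τ * seminormH1 h F
      ∧ seminormH1 h b ≤ stepNorm τ h (a + b) + τ * seminormH1 h F := by
  have n2 : ∀ v : Grid J ℂ, seminormH1 h ((2 : ℂ) • v) = 2 * seminormH1 h v := fun v => by
    rw [seminormH1_smul hh]; simp
  have nF : seminormH1 h ((τ : ℂ) • F) = τ * seminormH1 h F := by
    rw [seminormH1_smul hh, Complex.norm_real, Real.norm_of_nonneg hτ]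
  have e1 : (2 : ℂ) • a = ((a + b) + (Complex.I * (τ / 2)) • discreteLaplacian h (a + b))
      + (τ : ℂ) • F := by
    rw [add_assoc, ← H, two_smul]; abel
  have e2 : (2 : ℂ) • b = ((a + b) - (Complex.I * (τ / 2)) • discreteLaplacian h (a + b))
      - (τ : ℂ) • F := by
    rw [sub_sub, ← H, two_smul]; abel
  have h1 := seminormH1_add_le hh ((a + b) + (Complex.I * (τ / 2)) • discreteLaplacian h (a + b))
    ((τ : ℂ) • F)
  have h2 := seminormH1_sub_le hh ((a + b) - (Complex.I * (τ / 2)) • discreteLaplacian h (a + b))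
    ((τ : ℂ) • F)
  rw [← e1, n2, nF, ← stepNorm_eq_add hh τ hab] at h1
  rw [← e2, n2, nF, ← stepNorm] at h2
  have p1 := seminormH1_nonneg (h := h) a
  have p2 := seminormH1_nonneg (h := h) b
  constructor <;> linarith

end GridNorms

/-! ### Multiplication in the discrete H¹ seminorm. -/

section Products

variable {J : ℕ} {h : ℝ}

/-- The values of the grid function are bounded by `A`, and its increments by `A h`. -/
def Tame (A h : ℝ) (v : Grid J ℂ) : Prop :=
  (∀ j, ‖v j‖ ≤ A) ∧ ∀ j : Fin (J + 1), ‖v j.succ - v j.castSucc‖ ≤ A * h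

theorem Tame.nonneg {A : ℝ} {v : Grid J ℂ} (hv : Tame A h v) : 0 ≤ A :=
  (norm_nonneg _).trans (hv.1 0)

theorem Tame.mono {A B : ℝ} (hh : 0 < h) (hAB : A ≤ B) {v : Grid J ℂ} (hv : Tame A h v) :
    Tame B h v :=
  ⟨fun j => (hv.1 j).trans hAB, fun j => (hv.2 j).trans (by gcongr)⟩

theorem Tame.add {A B : ℝ} {v w : Grid J ℂ} (hv : Tame A h v) (hw : Tame B h w) :
    Tame (A + B) h (v + w) := by
  refine ⟨fun j => (norm_add_le _ _).trans (add_le_add (hv.1 j) (hw.1 j)), fun j => ?_⟩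
  have : (v + w) j.succ - (v + w) j.castSucc
      = (v j.succ - v j.castSucc) + (w j.succ - w j.castSucc) := by
    simp only [Pi.add_apply]; ring
  rw [this, add_mul]
  exact (norm_add_le _ _).trans (add_le_add (hv.2 j) (hw.2 j))

theorem Tame.smul {A : ℝ} (c : ℂ) {v : Grid J ℂ} (hv : Tame A h v) :
    Tame (‖c‖ * A) h (c • v) := by
  refine ⟨fun j => ?_, fun j => ?_⟩
  · rw [Pi.smul_apply, norm_smul]
    exact mul_le_mul_of_nonneg_left (hv.1 j) (norm_nonneg _)
  · rw [Pi.smul_apply, Pi.smul_apply, ← smul_sub, norm_smul, mul_assoc]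
    exact mul_le_mul_of_nonneg_left (hv.2 j) (norm_nonneg _)

/-- The factor 2 comes from the two terms of the discrete product rule; the values do not need it,
but one constant has to serve both conditions. -/
theorem Tame.mul {A B : ℝ} {v w : Grid J ℂ} (hv : Tame A h v) (hw : Tame B h w) :
    Tame (2 * (A * B)) h (v * w) := by
  have hA := hv.nonneg
  have hB := hw.nonneg
  refine ⟨fun j => ?_, fun j => ?_⟩
  · rw [Pi.mul_apply, norm_mul]
    have := mul_le_mul (hv.1 j) (hw.1 j) (norm_nonneg _) hA
    nlinarith [mul_nonneg hA hB]
  · have : (v * w) j.succ - (v * w) j.castSucc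
        = v j.succ * (w j.succ - w j.castSucc) + (v j.succ - v j.castSucc) * w j.castSucc := by
      simp only [Pi.mul_apply]; ring
    rw [this]
    refine (norm_add_le _ _).trans ?_
    rw [norm_mul, norm_mul]
    have h1 := mul_le_mul (hv.1 j.succ) (hw.2 j) (norm_nonneg _) hA
    have h2 := mul_le_mul (hv.2 j) (hw.1 j.castSucc) (norm_nonneg _)
      ((norm_nonneg _).trans (hv.2 j))
    linarith

theorem Tame.seminormH1_le (hh : 0 < h) {A : ℝ} {v : Grid J ℂ} (hv : Tame A h v) :
    seminormH1 h v ≤ A * √(h * (J + 1)) := by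
  have := seminormH1_le_of_increments hh (v := v) (a := 0) (b := 0) hv.nonneg le_rfl le_rfl
    (fun j => by simpa using hv.2 j)
  simpa using this

/-- By the discrete product rule, the increments of m are O(h) and meet the Sobolev bound for v.
This treats the linear terms Pe and ρU, where one factor is smooth and need not vanish at the ends.
-/
theorem Tame.seminormH1_mul_le (hh : 0 < h) {A : ℝ} {m v : Grid J ℂ} (hm : Tame A h m)
    (hv : v 0 = 0) :
    seminormH1 h (m * v) ≤ A * (1 + h * (J + 1)) * seminormH1 h v := by
  have hA := hm.nonneg
  have hs := seminormH1_nonneg (h := h) v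
  have hL : (0 : ℝ) ≤ h * (J + 1) := by positivity
  have := seminormH1_le_of_increments hh (v := m * v) (a := v) (b := 0)
    (α := A * (√(h * (J + 1)) * seminormH1 h v)) (β := A) (γ := 0) (by positivity) hA le_rfl
    (fun j => by
      have e : (m * v) j.succ - (m * v) j.castSucc
          = m j.succ * (v j.succ - v j.castSucc)
            + (m j.succ - m j.castSucc) * v j.castSucc := by
        simp only [Pi.mul_apply]; ring
      rw [e]
      refine (norm_add_le _ _).trans ?_
      rw [norm_mul, norm_mul]
      have h1 := mul_le_mul_of_nonneg_right (hm.1 j.succ)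
        (norm_nonneg (v j.succ - v j.castSucc))
      have h2 := mul_le_mul (hm.2 j) (norm_le_seminormH1 hh hv j.castSucc) (norm_nonneg _)
        ((norm_nonneg _).trans (hm.2 j))
      linarith)
  refine this.trans (le_of_eq ?_)
  have e2 := Real.mul_self_sqrt hL
  linear_combination (A * seminormH1 h v) * e2

/-- The algebra property of H¹ in one dimension: each factor is bounded in the maximum norm by
Sobolev. It is what the quadratic term ρe requires. -/
theorem seminormH1_mul_le (hh : 0 < h) {a b : Grid J ℂ} (ha : a 0 = 0) (hb : b 0 = 0) :
    seminormH1 h (a * b) ≤ 2 * √(h * (J + 1)) * seminormH1 h a * seminormH1 h b := by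
  have sa := seminormH1_nonneg (h := h) a
  have sb := seminormH1_nonneg (h := h) b
  have := seminormH1_le_of_increments hh (v := a * b) (a := a) (b := b)
    (α := 0) (β := √(h * (J + 1)) * seminormH1 h b) (γ := √(h * (J + 1)) * seminormH1 h a)
    le_rfl (by positivity) (by positivity)
    (fun j => by
      have e : (a * b) j.succ - (a * b) j.castSucc
          = a j.succ * (b j.succ - b j.castSucc)
            + (a j.succ - a j.castSucc) * b j.castSucc := by
        simp only [Pi.mul_apply]; ring
      rw [e]
      refine (norm_add_le _ _).trans ?_
      rw [norm_mul, norm_mul]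
      have h1 := mul_le_mul_of_nonneg_right (norm_le_seminormH1 hh ha j.succ)
        (norm_nonneg (b j.succ - b j.castSucc))
      have h2 := mul_le_mul_of_nonneg_left (norm_le_seminormH1 hh hb j.castSucc)
        (norm_nonneg (a j.succ - a j.castSucc))
      linarith)
  linarith

end Products

/-! ### Composition with a smooth nonlinearity. -/

section Nonlinearity

theorem exists_lipschitz_closedBall {E : Type*} [NormedAddCommGroup E] [NormedSpace ℝ E]
    {F : ℂ → E} (hF : ContDiff ℝ 1 F) (R : ℝ) :
    ∃ B ≥ 0, ∀ x ∈ Metric.closedBall (0 : ℂ) R, ‖F x‖ ≤ B ∧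
      ∀ y ∈ Metric.closedBall (0 : ℂ) R, ‖F x - F y‖ ≤ B * ‖x - y‖ := by
  have hc := isCompact_closedBall (0 : ℂ) R
  obtain ⟨B₁, h₁⟩ := hc.exists_bound_of_continuousOn hF.continuous.continuousOn
  obtain ⟨B₂, h₂⟩ := hc.exists_bound_of_continuousOn
    (hF.continuous_fderiv (by norm_num)).continuousOn
  refine ⟨max 0 (max B₁ B₂), le_max_left _ _, fun x hx => ⟨(h₁ x hx).trans (by simp), ?_⟩⟩
  intro y hy
  refine Convex.norm_image_sub_le_of_norm_fderiv_le (𝕜 := ℝ)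
    (fun z _ => (hF.differentiable (by norm_num)).differentiableAt)
    (fun z hz => (h₂ z hz).trans (by simp)) (convex_closedBall _ _) hy hx

/-- Bounds for the derivative of a `C³` function on a ball, including one for second
differences. -/
theorem exists_fderiv_bounds {G : ℂ → ℂ} (hG : ContDiff ℝ 3 G) (R : ℝ) :
    ∃ B ≥ 0, ∀ a ∈ Metric.closedBall (0 : ℂ) R, ∀ b ∈ Metric.closedBall (0 : ℂ) R,
      ‖fderiv ℝ G a‖ ≤ B ∧ ‖fderiv ℝ G a - fderiv ℝ G b‖ ≤ B * ‖a - b‖ ∧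
      ∀ c ∈ Metric.closedBall (0 : ℂ) R, ∀ d ∈ Metric.closedBall (0 : ℂ) R,
      ‖fderiv ℝ G a - fderiv ℝ G b - fderiv ℝ G c + fderiv ℝ G d‖
        ≤ B * (‖a - b - c + d‖ + ‖b - d‖ * ‖c - d‖) := by
  have hD : ContDiff ℝ 2 (fderiv ℝ G) := hG.fderiv_right (by norm_num)
  have hD2 : ContDiff ℝ 1 (fderiv ℝ (fderiv ℝ G)) := hD.fderiv_right (by norm_num)
  -- The points b + s(c - d) and d + s(c - d), 0 ≤ s ≤ 1, leave the ball of radius R but not that of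
  -- radius 3R.
  obtain ⟨B₁, h₁, H₁⟩ := exists_lipschitz_closedBall (hD.of_le (by norm_num)) (3 * R)
  obtain ⟨B₂, h₂, H₂⟩ := exists_lipschitz_closedBall hD2 (3 * R)
  refine ⟨B₁ + B₂, add_nonneg h₁ h₂, fun a ha b hb => ?_⟩
  have sub3 : ∀ x ∈ Metric.closedBall (0 : ℂ) R, x ∈ Metric.closedBall (0 : ℂ) (3 * R) := by
    intro x hx
    rw [mem_closedBall_zero_iff] at hx ⊢
    linarith [norm_nonneg x]
  have hL := (H₁ a (sub3 a ha)).2 b (sub3 b hb)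
  refine ⟨(H₁ a (sub3 a ha)).1.trans (by linarith), hL.trans ?_, fun c hc d hd => ?_⟩
  · nlinarith [norm_nonneg (a - b)]
  have ms : ∀ s ∈ Icc (0 : ℝ) 1, ∀ x ∈ Metric.closedBall (0 : ℂ) R,
      x + (s : ℂ) * (c - d) ∈ Metric.closedBall (0 : ℂ) (3 * R) := by
    intro s hs x hx
    rw [mem_closedBall_zero_iff] at hx hc hd ⊢
    have e1 := norm_add_le x ((s : ℂ) * (c - d))
    have e2 := norm_sub_le c d
    rw [norm_mul, Complex.norm_real, Real.norm_of_nonneg hs.1] at e1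
    nlinarith [norm_nonneg (c - d), hs.2]
  have hm : ∀ s ∈ Icc (0 : ℝ) 1, HasDerivWithinAt
      (fun s : ℝ => fderiv ℝ G (b + (s : ℂ) * (c - d)) - fderiv ℝ G (d + (s : ℂ) * (c - d)))
      (fderiv ℝ (fderiv ℝ G) (b + (s : ℂ) * (c - d)) (c - d)
        - fderiv ℝ (fderiv ℝ G) (d + (s : ℂ) * (c - d)) (c - d)) (Icc 0 1) s := by
    intro s _
    have hl : ∀ x : ℂ, HasDerivAt (fun s : ℝ => x + (s : ℂ) * (c - d)) (c - d) s := fun x => by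
      simpa using ((Complex.ofRealCLM.hasDerivAt (x := s)).mul_const (c - d)).const_add x
    have hf : ∀ y, HasFDerivAt (fderiv ℝ G) (fderiv ℝ (fderiv ℝ G) y) y := fun y =>
      ((hD.differentiable (by norm_num)) y).hasFDerivAt
    exact (((hf _).comp_hasDerivAt s (hl b)).sub
      ((hf _).comp_hasDerivAt s (hl d))).hasDerivWithinAt
  have h4 := norm_image_sub_le_of_norm_deriv_le_segment_01' hm (C := B₂ * (‖b - d‖ * ‖c - d‖))
    (fun s hs => by
      have hs' := Ico_subset_Icc_self hs
      rw [← _root_.sub_apply]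
      refine (ContinuousLinearMap.le_opNorm _ _).trans ?_
      have := (H₂ _ (ms s hs' b hb)).2 _ (ms s hs' d hd)
      rw [add_sub_add_right_eq_sub] at this
      rw [← mul_assoc]
      gcongr)
  simp only [Complex.ofReal_one, one_mul, Complex.ofReal_zero, zero_mul, add_zero] at h4
  rw [add_sub_cancel] at h4
  have hx : b + (c - d) ∈ Metric.closedBall (0 : ℂ) (3 * R) := by
    simpa using ms 1 (by simp) b hb
  have h5 := (H₁ a (sub3 a ha)).2 _ hx
  -- The point b + (c - d) completes b, c, d to a parallelogram. Replacing a by it costs a Lipschitz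
  -- term in a - b - c + d; for the exact parallelogram, h4 transports the difference between b and
  -- d along c - d.
  have e : fderiv ℝ G a - fderiv ℝ G b - fderiv ℝ G c + fderiv ℝ G d
      = (fderiv ℝ G a - fderiv ℝ G (b + (c - d)))
        + (fderiv ℝ G (b + (c - d)) - fderiv ℝ G c - (fderiv ℝ G b - fderiv ℝ G d)) := by abel
  have e' : a - (b + (c - d)) = a - b - c + d := by ring
  rw [e]
  rw [e'] at h5
  refine (norm_add_le _ _).trans ((add_le_add h5 h4).trans ?_)
  have p1 := norm_nonneg (a - b - c + d)
  have p2 : 0 ≤ ‖b - d‖ * ‖c - d‖ := by positivity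
  nlinarith

variable {J : ℕ} {h : ℝ}

/-- `v ↦ G ∘ v` is locally Lipschitz in the discrete `H¹` norm, near a tame grid function. -/
theorem exists_seminormH1_comp_sub_le {G : ℂ → ℂ} (hG : ContDiff ℝ 3 G) {L : ℝ} (hL : 0 < L)
    (K M : ℝ) :
    ∃ C ≥ 0, ∀ (J : ℕ) (h : ℝ), 0 < h → h * (J + 1) = L → ∀ U e : Grid J ℂ, Tame K h U →
      e 0 = 0 → seminormH1 h e ≤ M →
      seminormH1 h (fun j => G (U j) - G (U j - e j)) ≤ C * seminormH1 h e := by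
  obtain ⟨B, hB, H⟩ := exists_fderiv_bounds hG (K + √L * M)
  refine ⟨B * (1 + √L * |M|) + B * |K| * L, by positivity, ?_⟩
  intro J h hh hJ U e hU he hM
  have hK := hU.nonneg
  have hs := seminormH1_nonneg (h := h) e
  have hM0 : 0 ≤ M := hs.trans hM
  rw [abs_of_nonneg hM0, abs_of_nonneg hK]
  have sup : ∀ j, ‖e j‖ ≤ √L * seminormH1 h e := fun j => by
    rw [← hJ]; exact norm_le_seminormH1 hh he j
  have supM : ∀ j, ‖e j‖ ≤ √L * M := fun j => (sup j).trans (by gcongr)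
  have mem : ∀ s ∈ Icc (0 : ℝ) 1, ∀ j,
      U j - (s : ℂ) * e j ∈ Metric.closedBall (0 : ℂ) (K + √L * M) := by
    intro s hs j
    rw [mem_closedBall_zero_iff]
    refine (norm_sub_le _ _).trans (add_le_add (hU.1 j) ?_)
    rw [norm_mul, Complex.norm_real, Real.norm_of_nonneg hs.1]
    exact (mul_le_of_le_one_left (norm_nonneg _) hs.2).trans (supM j)
  have hder : ∀ (j : Fin (J + 2)) (s : ℝ), HasDerivAt (fun s : ℝ => G (U j - (s : ℂ) * e j))
      (fderiv ℝ G (U j - (s : ℂ) * e j) (-e j)) s := by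
    intro j s
    have h1 : HasDerivAt (fun s : ℝ => U j - (s : ℂ) * e j) (-e j) s := by
      simpa using ((Complex.ofRealCLM.hasDerivAt (x := s)).mul_const (e j)).const_sub (U j)
    exact ((hG.differentiable (by norm_num)) _).hasFDerivAt.comp_hasDerivAt s h1
  have main := seminormH1_le_of_increments hh (v := fun j => G (U j) - G (U j - e j))
    (a := e) (b := 0) (α := B * K * (√L * seminormH1 h e)) (β := B * (1 + √L * M)) (γ := 0)
    (by positivity) (by positivity) le_rfl (fun j => by
      -- The increment of G(U) - G(U - e) between adjacent nodes is the change, from s = 0 to s = 1,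
      -- of the increment of G(U - s e). The mean value inequality in s therefore reduces the claim
      -- to first derivatives of G at two adjacent nodes.
      have h4 := norm_image_sub_le_of_norm_deriv_le_segment_01'
        (f := fun s : ℝ => G (U j.succ - (s : ℂ) * e j.succ)
          - G (U j.castSucc - (s : ℂ) * e j.castSucc))
        (fun s _ => ((hder j.succ s).sub (hder j.castSucc s)).hasDerivWithinAt)
        (C := B * K * (√L * seminormH1 h e) * h
          + B * (1 + √L * M) * ‖e j.succ - e j.castSucc‖) (fun s hs => by
          have hs' := Ico_subset_Icc_self hs
          set q1 := U j.succ - (s : ℂ) * e j.succ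
          set q0 := U j.castSucc - (s : ℂ) * e j.castSucc
          obtain ⟨b1, b2, -⟩ := H q1 (mem s hs' _) q0 (mem s hs' _)
          have eq : fderiv ℝ G q1 (-e j.succ) - fderiv ℝ G q0 (-e j.castSucc)
              = -(fderiv ℝ G q1 (e j.succ - e j.castSucc)
                + (fderiv ℝ G q1 - fderiv ℝ G q0) (e j.castSucc)) := by
            simp only [map_neg, map_sub, _root_.sub_apply]; abel
          rw [eq, norm_neg]
          have c1 := (fderiv ℝ G q1).le_of_opNorm_le b1 (e j.succ - e j.castSucc)
          have c2 := (fderiv ℝ G q1 - fderiv ℝ G q0).le_of_opNorm_le b2 (e j.castSucc)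
          have c3 : ‖q1 - q0‖ ≤ K * h + ‖e j.succ - e j.castSucc‖ := by
            have : q1 - q0 = (U j.succ - U j.castSucc) - (s : ℂ) * (e j.succ - e j.castSucc) := by
              simp only [q1, q0]; ring
            rw [this]
            refine (norm_sub_le _ _).trans (add_le_add (hU.2 j) ?_)
            rw [norm_mul, Complex.norm_real, Real.norm_of_nonneg hs'.1]
            exact mul_le_of_le_one_left (norm_nonneg _) hs'.2
          have c4 : B * ‖q1 - q0‖ * ‖e j.castSucc‖
              ≤ B * (K * h) * (√L * seminormH1 h e)
                + B * ‖e j.succ - e j.castSucc‖ * (√L * M) := by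
            calc _ ≤ B * (K * h + ‖e j.succ - e j.castSucc‖) * ‖e j.castSucc‖ := by gcongr
              _ = B * (K * h) * ‖e j.castSucc‖
                + B * ‖e j.succ - e j.castSucc‖ * ‖e j.castSucc‖ := by ring
              _ ≤ _ := by
                gcongr
                · exact sup _
                · exact supM _
          refine (norm_add_le _ _).trans ((add_le_add c1 (c2.trans c4)).trans (le_of_eq ?_))
          ring)
      simp only [Complex.ofReal_one, one_mul, Complex.ofReal_zero, zero_mul, sub_zero] at h4
      rw [norm_sub_rev] at h4
      have e3 : (G (U j.succ) - G (U j.succ - e j.succ))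
            - (G (U j.castSucc) - G (U j.castSucc - e j.castSucc))
          = G (U j.succ) - G (U j.castSucc)
            - (G (U j.succ - e j.succ) - G (U j.castSucc - e j.castSucc)) := by ring
      rw [e3]
      simpa using h4)
  refine main.trans (le_of_eq ?_)
  rw [hJ]
  linear_combination (B * K * seminormH1 h e) * Real.mul_self_sqrt hL.le

/-- A bound in the discrete `H¹` norm for the difference of `G ∘ U - G ∘ (U - e)` at two time
levels. -/
theorem exists_seminormH1_comp_sub_sub_le {G : ℂ → ℂ} (hG : ContDiff ℝ 3 G) {L : ℝ}
    (hL : 0 < L) (K M T : ℝ) :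
    ∃ C ≥ 0, ∀ (J : ℕ) (h τ : ℝ), 0 < h → h * (J + 1) = L → 0 ≤ τ → τ ≤ T →
      ∀ U₀ U₁ e₀ e₁ : Grid J ℂ, Tame K h U₀ → Tame K h U₁ → Tame (K * τ) h (U₁ - U₀) →
      e₀ 0 = 0 → e₁ 0 = 0 → seminormH1 h e₀ ≤ M → seminormH1 h e₁ ≤ M →
      seminormH1 h ((fun j => G (U₁ j) - G (U₁ j - e₁ j)) - fun j => G (U₀ j) - G (U₀ j - e₀ j))
        ≤ C * (seminormH1 h (e₁ - e₀) + τ * (seminormH1 h e₀ + seminormH1 h e₁)) := by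
  obtain ⟨B, hB, H⟩ := exists_fderiv_bounds hG (K + √L * M)
  set m : ℝ := √L * |M| with hm
  have hm0 : 0 ≤ m := by positivity
  set C1 : ℝ := B * (|K| + K ^ 2) * L + B * (m + 1) * |K| + B * (m + 2) * |K| with hC1
  set C2 : ℝ := B * (m + 1) * |K| * L + B * (m + 2) * m + B * (m + 1 + |K| * |T| + 2 * m) with hC2
  have hC10 : 0 ≤ C1 := by positivity
  have hC20 : 0 ≤ C2 := by positivity
  refine ⟨C1 + C2, by positivity, ?_⟩
  intro J h τ hh hJ hτ hτT U₀ U₁ e₀ e₁ hU0 hU1 hU he0 he1 hM0 hM1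
  have hK := hU0.nonneg
  have hs0 := seminormH1_nonneg (h := h) e₀
  have hs1 := seminormH1_nonneg (h := h) e₁
  have hsE := seminormH1_nonneg (h := h) (e₁ - e₀)
  have hMp : 0 ≤ M := hs0.trans hM0
  rw [abs_of_nonneg hMp] at hm
  rw [abs_of_nonneg hK] at hC1 hC2
  rw [abs_of_nonneg (hτ.trans hτT)] at hC2
  set n0 := seminormH1 h e₀
  set n1 := seminormH1 h e₁
  set nE := seminormH1 h (e₁ - e₀)
  set ε := √L * nE with hε
  have hε0 : 0 ≤ ε := by positivity
  have sup : ∀ e : Grid J ℂ, e 0 = 0 → ∀ j, ‖e j‖ ≤ √L * seminormH1 h e := fun e he j => by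
    rw [← hJ]; exact norm_le_seminormH1 hh he j
  have supM0 : ∀ j, ‖e₀ j‖ ≤ √L * M := fun j => (sup e₀ he0 j).trans (by gcongr)
  have supM1 : ∀ j, ‖e₁ j‖ ≤ √L * M := fun j => (sup e₁ he1 j).trans (by gcongr)
  have supE : ∀ j, ‖e₁ j - e₀ j‖ ≤ ε := sup (e₁ - e₀) (by simp [he0, he1])
  have hnE : nE ≤ 2 * M := (seminormH1_sub_le hh _ _).trans (by linarith)
  have hε2 : ε ≤ 2 * m := by
    rw [hε, hm]; nlinarith [mul_le_mul_of_nonneg_left hnE (Real.sqrt_nonneg L)]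
  have mem : ∀ s ∈ Icc (0 : ℝ) 1, ∀ U e : Grid J ℂ, Tame K h U → (∀ j, ‖e j‖ ≤ √L * M) → ∀ j,
      U j - (s : ℂ) * e j ∈ Metric.closedBall (0 : ℂ) (K + √L * M) := by
    intro s hs U e hU he j
    rw [mem_closedBall_zero_iff]
    refine (norm_sub_le _ _).trans (add_le_add (hU.1 j) ?_)
    rw [norm_mul, Complex.norm_real, Real.norm_of_nonneg hs.1]
    exact (mul_le_of_le_one_left (norm_nonneg _) hs.2).trans (he j)
  have hder : ∀ (U e : Grid J ℂ) (j : Fin (J + 2)) (s : ℝ),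
      HasDerivAt (fun s : ℝ => G (U j - (s : ℂ) * e j))
      (fderiv ℝ G (U j - (s : ℂ) * e j) (-e j)) s := by
    intro U e j s
    have h1 : HasDerivAt (fun s : ℝ => U j - (s : ℂ) * e j) (-e j) s := by
      simpa using ((Complex.ofRealCLM.hasDerivAt (x := s)).mul_const (e j)).const_sub (U j)
    exact ((hG.differentiable (by norm_num)) _).hasFDerivAt.comp_hasDerivAt s h1
  have scale : ∀ s ∈ Icc (0 : ℝ) 1, ∀ z : ℂ, ‖(s : ℂ) * z‖ ≤ ‖z‖ := fun s hs z => by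
    rw [norm_mul, Complex.norm_real, Real.norm_of_nonneg hs.1]
    exact mul_le_of_le_one_left (norm_nonneg _) hs.2
  have main := seminormH1_le_of_increments hh
    (v := (fun j => G (U₁ j) - G (U₁ j - e₁ j)) - fun j => G (U₀ j) - G (U₀ j - e₀ j))
    (a := e₀) (b := e₁ - e₀)
    (α := B * ((K + K ^ 2) * τ * (√L * n1) + (m + 1) * K * ε))
    (β := B * ((m + 1) * K * τ + (m + 2) * ε)) (γ := B * (m + 1 + K * T + 2 * m))
    (by positivity) (by positivity) (by have := hτ.trans hτT; positivity) (fun j => by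
      set d := ‖(e₁ - e₀) j.succ - (e₁ - e₀) j.castSucc‖ with hd
      set x0 := ‖e₀ j.succ - e₀ j.castSucc‖ with hx0
      have hd0 : 0 ≤ d := norm_nonneg _
      have hx00 : 0 ≤ x0 := norm_nonneg _
      have h4 := norm_image_sub_le_of_norm_deriv_le_segment_01'
        (f := fun s : ℝ => G (U₁ j.succ - (s : ℂ) * e₁ j.succ)
          - G (U₁ j.castSucc - (s : ℂ) * e₁ j.castSucc)
          - (G (U₀ j.succ - (s : ℂ) * e₀ j.succ)
          - G (U₀ j.castSucc - (s : ℂ) * e₀ j.castSucc)))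
        (fun s _ => (((hder U₁ e₁ j.succ s).sub (hder U₁ e₁ j.castSucc s)).sub
          ((hder U₀ e₀ j.succ s).sub (hder U₀ e₀ j.castSucc s))).hasDerivWithinAt)
        (C := B * ((K + K ^ 2) * τ * (√L * n1) + (m + 1) * K * ε) * h
          + B * ((m + 1) * K * τ + (m + 2) * ε) * x0
          + B * (m + 1 + K * T + 2 * m) * d) (fun s hs => by
          have hs' := Ico_subset_Icc_self hs
          set q11 := U₁ j.succ - (s : ℂ) * e₁ j.succ with hq11
          set q10 := U₁ j.castSucc - (s : ℂ) * e₁ j.castSucc with hq10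
          set q01 := U₀ j.succ - (s : ℂ) * e₀ j.succ with hq01
          set q00 := U₀ j.castSucc - (s : ℂ) * e₀ j.castSucc with hq00
          have m11 := mem s hs' U₁ e₁ hU1 supM1 j.succ
          have m10 := mem s hs' U₁ e₁ hU1 supM1 j.castSucc
          have m01 := mem s hs' U₀ e₀ hU0 supM0 j.succ
          have m00 := mem s hs' U₀ e₀ hU0 supM0 j.castSucc
          have b4 := (H q11 m11 q10 m10).2.2 q01 m01 q00 m00
          have bt := (H q10 m10 q00 m00).2.1
          have bx := (H q01 m01 q00 m00).2.1
          have b0 := (H q00 m00 q00 m00).1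
          -- A product rule for the mixed difference in node and time level of DG(q)e. Both
          -- differences may fall on DG, where the second-difference bound is needed, or one on each
          -- factor, or both on e.
          have eq : fderiv ℝ G q11 (-e₁ j.succ) - fderiv ℝ G q10 (-e₁ j.castSucc)
              - (fderiv ℝ G q01 (-e₀ j.succ) - fderiv ℝ G q00 (-e₀ j.castSucc))
              = -((fderiv ℝ G q11 - fderiv ℝ G q10 - fderiv ℝ G q01 + fderiv ℝ G q00) (e₁ j.succ)
                + (fderiv ℝ G q10 - fderiv ℝ G q00) (e₁ j.succ - e₁ j.castSucc)
                + (fderiv ℝ G q01 - fderiv ℝ G q00) (e₁ j.succ - e₀ j.succ)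
                + fderiv ℝ G q00 ((e₁ - e₀) j.succ - (e₁ - e₀) j.castSucc)) := by
            simp only [map_neg, map_sub, _root_.sub_apply, _root_.add_apply, Pi.sub_apply]; abel
          rw [eq, norm_neg]
          have r4 : ‖q11 - q10 - q01 + q00‖ ≤ K * τ * h + d := by
            have : q11 - q10 - q01 + q00 = ((U₁ - U₀) j.succ - (U₁ - U₀) j.castSucc)
                - (s : ℂ) * ((e₁ - e₀) j.succ - (e₁ - e₀) j.castSucc) := by
              simp only [hq11, hq10, hq01, hq00, Pi.sub_apply]; ring
            rw [this]
            exact (norm_sub_le _ _).trans (add_le_add (hU.2 j) (scale s hs' _))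
          have rt : ‖q10 - q00‖ ≤ K * τ + ε := by
            have : q10 - q00 = (U₁ - U₀) j.castSucc
                - (s : ℂ) * (e₁ j.castSucc - e₀ j.castSucc) := by
              simp only [hq10, hq00, Pi.sub_apply]; ring
            rw [this]
            exact (norm_sub_le _ _).trans
              (add_le_add (hU.1 _) ((scale s hs' _).trans (supE _)))
          have rx : ‖q01 - q00‖ ≤ K * h + x0 := by
            have : q01 - q00 = (U₀ j.succ - U₀ j.castSucc)
                - (s : ℂ) * (e₀ j.succ - e₀ j.castSucc) := by
              simp only [hq01, hq00]; ring
            rw [this]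
            exact (norm_sub_le _ _).trans (add_le_add (hU0.2 _) (scale s hs' _))
          have rx1 : ‖e₁ j.succ - e₁ j.castSucc‖ ≤ x0 + d := by
            have : e₁ j.succ - e₁ j.castSucc = (e₀ j.succ - e₀ j.castSucc)
                + ((e₁ - e₀) j.succ - (e₁ - e₀) j.castSucc) := by
              simp only [Pi.sub_apply]; ring
            rw [this]
            exact norm_add_le _ _
          have hE1 : ‖e₁ j.succ‖ ≤ √L * n1 := sup e₁ he1 _
          have hE1m : ‖e₁ j.succ‖ ≤ m := (supM1 _).trans hm.ge
          have hE10 := norm_nonneg (e₁ j.succ)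
          set y := ‖e₁ j.succ‖
          have c1 := ContinuousLinearMap.le_of_opNorm_le _ b4 (e₁ j.succ)
          have c2 := ContinuousLinearMap.le_of_opNorm_le _ bt (e₁ j.succ - e₁ j.castSucc)
          have c3 := ContinuousLinearMap.le_of_opNorm_le _ bx (e₁ j.succ - e₀ j.succ)
          have c4 := ContinuousLinearMap.le_of_opNorm_le _ b0
            ((e₁ - e₀) j.succ - (e₁ - e₀) j.castSucc)
          have d1 : B * (‖q11 - q10 - q01 + q00‖ + ‖q10 - q00‖ * ‖q01 - q00‖) * y
              ≤ B * ((K * τ * h + d) + (K * τ + ε) * (K * h + x0)) * y := by gcongr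
          have d2 : B * ‖q10 - q00‖ * ‖e₁ j.succ - e₁ j.castSucc‖
              ≤ B * (K * τ + ε) * (x0 + d) := by gcongr
          have d3 : B * ‖q01 - q00‖ * ‖e₁ j.succ - e₀ j.succ‖
              ≤ B * (K * h + x0) * ε := by
            gcongr
            exact supE _
          have f1 : B * ((K * τ * h + d) + (K * τ + ε) * (K * h + x0)) * y
              ≤ B * (((K + K ^ 2) * τ * (√L * n1) + m * K * ε) * h
                + m * (K * τ + ε) * x0 + m * d) := by
            have g1 : (K + K ^ 2) * τ * h * y ≤ (K + K ^ 2) * τ * h * (√L * n1) := by gcongr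
            have g2 : (d + ε * K * h + (K * τ + ε) * x0) * y
                ≤ (d + ε * K * h + (K * τ + ε) * x0) * m := by gcongr
            rw [mul_assoc]
            refine mul_le_mul_of_nonneg_left ?_ hB
            linarith
          have f2 : B * (K * τ + ε) * (x0 + d) ≤ B * ((K * τ + ε) * x0 + (K * T + 2 * m) * d) := by
            have : (K * τ + ε) * d ≤ (K * T + 2 * m) * d := by gcongr
            rw [mul_assoc]
            refine mul_le_mul_of_nonneg_left ?_ hB
            linarith
          refine (norm_add_le _ _).trans ((add_le_add ((norm_add_le _ _).trans (add_le_add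
            ((norm_add_le _ _).trans (add_le_add (c1.trans (d1.trans f1)) (c2.trans (d2.trans f2))))
            (c3.trans d3))) c4).trans (le_of_eq ?_))
          ring)
      simp only [Complex.ofReal_one, one_mul, Complex.ofReal_zero, zero_mul, sub_zero] at h4
      rw [norm_sub_rev] at h4
      refine le_trans (le_of_eq ?_) h4
      congr 1
      simp only [Pi.sub_apply]
      ring)
  refine main.trans ?_
  rw [hJ]
  have eL := Real.mul_self_sqrt hL.le
  have t1 : B * ((K + K ^ 2) * τ * (√L * n1) + (m + 1) * K * ε) * √L
      = B * (K + K ^ 2) * L * (τ * n1) + B * (m + 1) * K * L * nE := by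
    rw [hε]
    linear_combination (B * ((K + K ^ 2) * τ * n1 + (m + 1) * K * nE)) * eL
  have t2 : B * ((m + 1) * K * τ + (m + 2) * ε) * n0
      ≤ B * (m + 1) * K * (τ * n0) + B * (m + 2) * m * nE := by
    -- The term quadratic in the errors becomes linear in the difference e₁ - e₀ by bounding the
    -- other factor with M.
    have : ε * n0 ≤ m * nE := by
      rw [hε, hm]
      calc √L * nE * n0 ≤ √L * nE * M := by gcongr
        _ = _ := by ring
    have := mul_le_mul_of_nonneg_left this (by positivity : 0 ≤ B * (m + 2))
    linarith
  have u1 : B * (K + K ^ 2) * L * (τ * n1) + B * (m + 1) * K * (τ * n0)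
      ≤ C1 * (τ * (n0 + n1)) := by
    have a1 : 0 ≤ B * (K + K ^ 2) * L * (τ * n0) := by positivity
    have a2 : 0 ≤ B * (m + 1) * K * (τ * n1) := by positivity
    have a3 : 0 ≤ B * (m + 2) * K * (τ * (n0 + n1)) := by positivity
    rw [hC1]
    linarith
  have u2 : C1 * (τ * (n0 + n1)) + C2 * nE ≤ (C1 + C2) * (nE + τ * (n0 + n1)) := by
    have a1 : 0 ≤ C1 * nE := by positivity
    have a2 : 0 ≤ C2 * (τ * (n0 + n1)) := by positivity
    linarith
  have u3 : C2 * nE = B * (m + 1) * K * L * nE + B * (m + 2) * m * nE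
      + B * (m + 1 + K * T + 2 * m) * nE := by rw [hC2]; ring
  rw [t1]
  linarith

end Nonlinearity

/-! ### The error equations and the size of their forcing. -/

section ErrorSystem

variable {J : ℕ}

/-- The nonlinear part of the forcing in the error equation, where `U`, `P` are the exact solution
and the exact potential, and `e`, `ρ` are the respective errors. -/
def potentialDefect (U P e ρ : ℕ → Grid J ℂ) (n : ℕ) : Grid J ℂ :=
  (1 / 2 : ℂ) • (P n * (e (n + 1) + e n)) + (1 / 2 : ℂ) • (ρ n * (U (n + 1) + U n))
    - (1 / 2 : ℂ) • (ρ n * (e (n + 1) + e n))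

/-- The forcing in the error equation. -/
def errorForcing (U P e ρ R : ℕ → Grid J ℂ) (n : ℕ) : Grid J ℂ :=
  Complex.I • potentialDefect U P e ρ n + R n

/-- The error equations of the relaxation scheme. Here `U n` and `P n` are the exact solution at
`t_n` and the exact potential at `t^{n+1/2}`, `e` and `ρ` are the respective errors, `θ` is the
difference between the elliptic projection of the exact solution and the approximation, and `R` is
the consistency error. -/
structure ErrorSystem (G : ℂ → ℂ) (K L T h τ : ℝ) (N : ℕ) (U P e ρ θ R : ℕ → Grid J ℂ) :
    Prop where
  h_pos : 0 < h
  h_mul : h * (J + 1) = L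
  τ_pos : 0 < τ
  mul_τ : N * τ = T
  one_le : 1 ≤ N
  e_ends : ∀ n ≤ N, VanishesAtEnds (e n)
  θ_ends : ∀ n ≤ N, VanishesAtEnds (θ n)
  ρ_ends : ∀ n < N, VanishesAtEnds (ρ n)
  U_tame : ∀ n ≤ N, Tame K h (U n)
  U_diff : ∀ n < N, Tame (K * τ) h (U (n + 1) - U n)
  P_tame : ∀ n < N, Tame K h (P n)
  P_diff : ∀ n, n + 1 < N → Tame (K * τ) h (P (n + 1) - P n)
  P_mid : ∀ n, n + 1 < N →
    seminormH1 h (P (n + 1) + P n - (2 : ℂ) • fun j => G (U (n + 1) j)) ≤ K * τ ^ 2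
  e_sub : ∀ n ≤ N, seminormH1 h (e n - θ n) ≤ K * h ^ 2
  e_diff : ∀ n < N, seminormH1 h ((e (n + 1) - θ (n + 1)) - (e n - θ n)) ≤ K * (τ * h ^ 2)
  R_le : ∀ n < N, seminormH1 h (R n) ≤ K * (τ ^ 2 + h ^ 2)
  R_diff : ∀ n, n + 2 < N → seminormH1 h (R (n + 2) - R n) ≤ K * (τ * (τ + h ^ 2))
  θ_zero : θ 0 = 0
  ρ_zero : seminormH1 h (ρ 0) ≤ K * τ
  step : ∀ n < N, θ (n + 1) - θ n = (Complex.I * (τ / 2)) • discreteLaplacian h (θ (n + 1) + θ n)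
    + (τ : ℂ) • errorForcing U P e ρ R n
  relax : ∀ n, n + 1 < N → ρ (n + 1) + ρ n = (P (n + 1) + P n - (2 : ℂ) • fun j => G (U (n + 1) j))
    + (2 : ℂ) • fun j => G (U (n + 1) j) - G (U (n + 1) j - e (n + 1) j)

namespace ErrorSystem

variable {G : ℂ → ℂ} {K L T h τ : ℝ} {N : ℕ} {U P e ρ θ R : ℕ → Grid J ℂ}

theorem K_nonneg (S : ErrorSystem G K L T h τ N U P e ρ θ R) : 0 ≤ K :=
  (S.U_tame 0 (Nat.zero_le _)).nonneg

theorem L_pos (S : ErrorSystem G K L T h τ N U P e ρ θ R) : 0 < L := by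
  rw [← S.h_mul]
  have := S.h_pos
  positivity

theorem h_le (S : ErrorSystem G K L T h τ N U P e ρ θ R) : h ≤ L := by
  rw [← S.h_mul]
  have := S.h_pos
  nlinarith [(Nat.cast_nonneg J : (0 : ℝ) ≤ J)]

theorem τ_le (S : ErrorSystem G K L T h τ N U P e ρ θ R) : τ ≤ T := by
  rw [← S.mul_τ]
  have h1 : (1 : ℝ) ≤ N := by exact_mod_cast S.one_le
  nlinarith [S.τ_pos]

theorem e_le (S : ErrorSystem G K L T h τ N U P e ρ θ R) {n : ℕ} (hn : n ≤ N) :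
    seminormH1 h (e n) ≤ seminormH1 h (θ n) + K * h ^ 2 := by
  have h1 := seminormH1_add_le S.h_pos (θ n) (e n - θ n)
  rw [add_sub_cancel] at h1
  linarith [S.e_sub n hn]

theorem e_sub_succ_le (S : ErrorSystem G K L T h τ N U P e ρ θ R) {n : ℕ} (hn : n < N) :
    seminormH1 h (e (n + 1) - e n) ≤ seminormH1 h (θ (n + 1) - θ n) + K * (τ * h ^ 2) := by
  have h1 := seminormH1_add_le S.h_pos (θ (n + 1) - θ n) ((e (n + 1) - θ (n + 1)) - (e n - θ n))
  have h2 : (θ (n + 1) - θ n) + ((e (n + 1) - θ (n + 1)) - (e n - θ n)) = e (n + 1) - e n := by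
    abel
  rw [h2] at h1
  linarith [S.e_diff n hn]

theorem e_sub_two_le (S : ErrorSystem G K L T h τ N U P e ρ θ R) {n : ℕ} (hn : n + 1 < N) :
    seminormH1 h (e (n + 2) - e n)
      ≤ stepNorm τ h (θ (n + 2) - θ n) + 2 * K * (τ * h ^ 2) := by
  have h1 := seminormH1_add_le S.h_pos (θ (n + 2) - θ n)
    (((e (n + 2) - θ (n + 2)) - (e (n + 1) - θ (n + 1))) + ((e (n + 1) - θ (n + 1)) - (e n - θ n)))
  have h2 : (θ (n + 2) - θ n) + (((e (n + 2) - θ (n + 2)) - (e (n + 1) - θ (n + 1)))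
      + ((e (n + 1) - θ (n + 1)) - (e n - θ n))) = e (n + 2) - e n := by abel
  rw [h2] at h1
  have h3 := seminormH1_add_le S.h_pos
    ((e (n + 2) - θ (n + 2)) - (e (n + 1) - θ (n + 1))) ((e (n + 1) - θ (n + 1)) - (e n - θ n))
  have h4 := S.e_diff (n + 1) hn
  have h5 := S.e_diff n (by omega)
  have h6 := seminormH1_le_stepNorm S.h_pos τ
    ((S.θ_ends (n + 2) (by omega)).sub (S.θ_ends n (by omega)))
  rw [show n + 1 + 1 = n + 2 from rfl] at h4
  linarith

theorem half (S : ErrorSystem G K L T h τ N U P e ρ θ R) (v : Grid J ℂ) :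
    seminormH1 h ((1 / 2 : ℂ) • v) = 1 / 2 * seminormH1 h v := by
  rw [seminormH1_smul S.h_pos]; norm_num

theorem tame_mul (S : ErrorSystem G K L T h τ N U P e ρ θ R) {A : ℝ} {m v : Grid J ℂ}
    (hm : Tame A h m) (hv : VanishesAtEnds v) :
    seminormH1 h (m * v) ≤ A * (1 + L) * seminormH1 h v := by
  rw [← S.h_mul]; exact hm.seminormH1_mul_le S.h_pos hv.1

theorem mul_le (S : ErrorSystem G K L T h τ N U P e ρ θ R) {a b : Grid J ℂ}
    (ha : VanishesAtEnds a) (hb : VanishesAtEnds b) :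
    seminormH1 h (a * b) ≤ 2 * √L * seminormH1 h a * seminormH1 h b := by
  rw [← S.h_mul]; exact seminormH1_mul_le S.h_pos ha.1 hb.1

/-- A triangle inequality for the three terms of `potentialDefect`. -/
theorem norm_three_le (S : ErrorSystem G K L T h τ N U P e ρ θ R) (a b c r : Grid J ℂ) :
    seminormH1 h (Complex.I • ((1 / 2 : ℂ) • a + (1 / 2 : ℂ) • b - (1 / 2 : ℂ) • c) + r)
      ≤ 1 / 2 * (seminormH1 h a + seminormH1 h b + seminormH1 h c) + seminormH1 h r := by
  have h1 := seminormH1_add_le S.h_pos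
    (Complex.I • ((1 / 2 : ℂ) • a + (1 / 2 : ℂ) • b - (1 / 2 : ℂ) • c)) r
  have h2 := seminormH1_sub_le S.h_pos ((1 / 2 : ℂ) • a + (1 / 2 : ℂ) • b) ((1 / 2 : ℂ) • c)
  have h3 := seminormH1_add_le S.h_pos ((1 / 2 : ℂ) • a) ((1 / 2 : ℂ) • b)
  rw [seminormH1_smul S.h_pos, Complex.norm_I, one_mul] at h1
  rw [S.half] at h2
  rw [S.half, S.half] at h3
  linarith

/-- Products by P and U are bounded multipliers; the quadratic term ρe is made linear in e by the
hypothesis that ρ is at most 1. -/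
theorem forcing_le (S : ErrorSystem G K L T h τ N U P e ρ θ R) {n : ℕ} (hn : n < N)
    (hr : seminormH1 h (ρ n) ≤ 1) :
    seminormH1 h (errorForcing U P e ρ R n)
      ≤ (K * (1 + L) + √L + K + (K * (1 + L) + 2 * √L) * K)
        * (seminormH1 h (ρ n) + seminormH1 h (θ n) + seminormH1 h (θ (n + 1)) + τ ^ 2 + h ^ 2) := by
  have hK := S.K_nonneg
  have hL := S.L_pos
  have hE := (S.e_ends (n + 1) hn).add (S.e_ends n hn.le)
  have h0 := S.norm_three_le (P n * (e (n + 1) + e n)) (ρ n * (U (n + 1) + U n))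
    (ρ n * (e (n + 1) + e n)) (R n)
  have h1 := S.tame_mul (S.P_tame n hn) hE
  have h2 := S.tame_mul ((S.U_tame (n + 1) hn).add (S.U_tame n hn.le)) (S.ρ_ends n hn)
  rw [mul_comm] at h2
  have h3 := S.mul_le (S.ρ_ends n hn) hE
  have h4 := seminormH1_add_le S.h_pos (e (n + 1)) (e n)
  have h5 := S.e_le (n := n + 1) hn
  have h6 := S.e_le (n := n) hn.le
  have h7 := S.R_le n hn
  rw [errorForcing, potentialDefect]
  have r0 := seminormH1_nonneg (h := h) (ρ n)
  have x0 := seminormH1_nonneg (h := h) (θ n)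
  have x1 := seminormH1_nonneg (h := h) (θ (n + 1))
  have E0 := seminormH1_nonneg (h := h) (e (n + 1) + e n)
  have t1 := sq_nonneg τ
  have t2 := sq_nonneg h
  have hs := Real.sqrt_nonneg L
  set r := seminormH1 h (ρ n)
  set x := seminormH1 h (θ n)
  set y := seminormH1 h (θ (n + 1))
  set E := seminormH1 h (e (n + 1) + e n)
  have hE' : E ≤ x + y + 2 * (K * h ^ 2) := by linarith
  have h1' : K * (1 + L) * E ≤ K * (1 + L) * (x + y + 2 * (K * h ^ 2)) := by gcongr
  have h3' : 2 * √L * r * E ≤ 2 * √L * 1 * (x + y + 2 * (K * h ^ 2)) := by gcongr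
  set c := K * (1 + L) with hc
  have hc0 : 0 ≤ c := by positivity
  have m1 := mul_nonneg hc0 r0
  have m2 := mul_nonneg hc0 x0
  have m3 := mul_nonneg hc0 x1
  have m4 := mul_nonneg hc0 t1
  have m5 := mul_nonneg hc0 t2
  have k1 := mul_nonneg hs r0
  have k2 := mul_nonneg hs x0
  have k3 := mul_nonneg hs x1
  have k4 := mul_nonneg hs t1
  have k5 := mul_nonneg hs t2
  have j1 := mul_nonneg hK r0
  have j2 := mul_nonneg hK x0
  have j3 := mul_nonneg hK x1
  have l1 := mul_nonneg hK (add_nonneg (add_nonneg (add_nonneg m1 m2) m3) m4)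
  have l2 := mul_nonneg hK (add_nonneg (add_nonneg (add_nonneg k1 k2) k3) k4)
  have l3 := mul_nonneg hK k5
  nlinarith

/-- Subtracting consecutive relaxation equations cancels ρ^{n+1} and leaves only a time difference
of the nonlinear term, which is what gains the missing factor τ. -/
theorem ρ_sub_eq (S : ErrorSystem G K L T h τ N U P e ρ θ R) {n : ℕ} (hn : n + 2 < N) :
    ρ (n + 2) - ρ n
      = ((P (n + 2) + P (n + 1) - (2 : ℂ) • fun j => G (U (n + 2) j))
        - (P (n + 1) + P n - (2 : ℂ) • fun j => G (U (n + 1) j)))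
        + (2 : ℂ) • ((fun j => G (U (n + 2) j) - G (U (n + 2) j - e (n + 2) j))
          - fun j => G (U (n + 1) j) - G (U (n + 1) j - e (n + 1) j)) := by
  have h1 := S.relax n (by omega)
  have h2 := S.relax (n + 1) hn
  rw [show n + 1 + 1 = n + 2 from rfl] at h2
  rw [smul_sub]
  have : ρ (n + 2) - ρ n = (ρ (n + 2) + ρ (n + 1)) - (ρ (n + 1) + ρ n) := by abel
  rw [this, h1, h2]
  abel

end ErrorSystem

end ErrorSystem

/-! ### Differences and sums over consecutive time levels. -/

section Estimates

variable {G : ℂ → ℂ}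

/-- The two-step differences of the error of the potential. -/
theorem exists_ρ_sub_le (hG : ContDiff ℝ 3 G) {K L T : ℝ} (hK : 0 ≤ K) (hL : 0 < L) :
    ∃ C ≥ 0, ∀ (J N : ℕ) (h τ : ℝ) (U P e ρ θ R : ℕ → Grid J ℂ),
      ErrorSystem G K L T h τ N U P e ρ θ R → ∀ n, n + 2 < N →
      seminormH1 h (θ (n + 1)) ≤ 1 → seminormH1 h (θ (n + 2)) ≤ 1 →
      seminormH1 h (ρ (n + 2) - ρ n) ≤ C * (seminormH1 h (θ (n + 2) - θ (n + 1))
        + τ * (seminormH1 h (θ (n + 1)) + seminormH1 h (θ (n + 2)) + (τ + h ^ 2))) := by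
  -- The a priori bound 1 + K L² for e comes from |θ|₁ ≤ 1, |e - θ|₁ ≤ K h² and h ≤ L.
  obtain ⟨C, hC, H⟩ := exists_seminormH1_comp_sub_sub_le hG hL K (1 + K * L ^ 2) T
  refine ⟨2 * C + 6 * C * K + 2 * K, by positivity, ?_⟩
  intro J N h τ U P e ρ θ R S n hn hx1 hx2
  have hh := S.h_pos
  have hτ := S.τ_pos
  have hhL : h ^ 2 ≤ L ^ 2 := pow_le_pow_left₀ hh.le S.h_le 2
  have e1 := S.e_le (n := n + 1) (by omega)
  have e2 := S.e_le (n := n + 2) (by omega)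
  have hKL : K * h ^ 2 ≤ K * L ^ 2 := by gcongr
  have main := H J h τ hh S.h_mul hτ.le S.τ_le (U (n + 1)) (U (n + 2)) (e (n + 1)) (e (n + 2))
    (S.U_tame _ (by omega)) (S.U_tame _ (by omega)) (S.U_diff (n + 1) (by omega))
    (S.e_ends _ (by omega)).1 (S.e_ends _ (by omega)).1 (by linarith) (by linarith)
  have e3 := S.e_sub_succ_le (n := n + 1) (by omega)
  rw [show n + 1 + 1 = n + 2 from rfl] at e3
  have g1 := S.P_mid n (by omega)
  have g2 := S.P_mid (n + 1) (by omega)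
  rw [show n + 1 + 1 = n + 2 from rfl] at g2
  rw [S.ρ_sub_eq hn]
  have t1 := seminormH1_add_le hh
    ((P (n + 2) + P (n + 1) - (2 : ℂ) • fun j => G (U (n + 2) j))
        - (P (n + 1) + P n - (2 : ℂ) • fun j => G (U (n + 1) j)))
    ((2 : ℂ) • ((fun j => G (U (n + 2) j) - G (U (n + 2) j - e (n + 2) j))
          - fun j => G (U (n + 1) j) - G (U (n + 1) j - e (n + 1) j)))
  have t2 := seminormH1_sub_le hh (P (n + 2) + P (n + 1) - (2 : ℂ) • fun j => G (U (n + 2) j))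
        (P (n + 1) + P n - (2 : ℂ) • fun j => G (U (n + 1) j))
  rw [seminormH1_smul hh, Complex.norm_ofNat] at t1
  have E0 := seminormH1_nonneg (h := h) (θ (n + 2) - θ (n + 1))
  have x1 := seminormH1_nonneg (h := h) (θ (n + 1))
  have x2 := seminormH1_nonneg (h := h) (θ (n + 2))
  set E := seminormH1 h (θ (n + 2) - θ (n + 1))
  set x := seminormH1 h (θ (n + 1))
  set y := seminormH1 h (θ (n + 2))
  have main2 : C * (seminormH1 h (e (n + 2) - e (n + 1))
      + τ * (seminormH1 h (e (n + 1)) + seminormH1 h (e (n + 2))))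
      ≤ C * ((E + K * (τ * h ^ 2)) + τ * ((x + K * h ^ 2) + (y + K * h ^ 2))) := by gcongr
  have p1 : 0 ≤ C * K * E := by positivity
  have p2 : 0 ≤ C * K * (τ * (x + y)) := by positivity
  have p3 : 0 ≤ C * K * τ ^ 2 := by positivity
  have p4 : 0 ≤ K * E := by positivity
  have p5 : 0 ≤ K * (τ * (x + y + h ^ 2)) := by positivity
  have p6 : 0 ≤ C * (τ * (τ + h ^ 2)) := by positivity
  nlinarith

/-- The sums of consecutive errors of the potential. -/
theorem exists_ρ_add_le (hG : ContDiff ℝ 3 G) {K L T : ℝ} (hK : 0 ≤ K) (hL : 0 < L) :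
    ∃ C ≥ 0, ∀ (J N : ℕ) (h τ : ℝ) (U P e ρ θ R : ℕ → Grid J ℂ),
      ErrorSystem G K L T h τ N U P e ρ θ R → ∀ n, n + 1 < N →
      seminormH1 h (θ (n + 1)) ≤ 1 →
      seminormH1 h (ρ (n + 1) + ρ n) ≤ C * (seminormH1 h (θ (n + 1)) + τ ^ 2 + h ^ 2) := by
  obtain ⟨C, hC, H⟩ := exists_seminormH1_comp_sub_le hG hL K (1 + K * L ^ 2)
  refine ⟨2 * C + 2 * C * K + K, by positivity, ?_⟩
  intro J N h τ U P e ρ θ R S n hn hx1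
  have hh := S.h_pos
  have hhL : h ^ 2 ≤ L ^ 2 := pow_le_pow_left₀ hh.le S.h_le 2
  have e1 := S.e_le (n := n + 1) (by omega)
  have hKL : K * h ^ 2 ≤ K * L ^ 2 := by gcongr
  have main := H J h hh S.h_mul (U (n + 1)) (e (n + 1))
    (S.U_tame _ (by omega)) (S.e_ends _ (by omega)).1 (by linarith)
  have g1 := S.P_mid n (by omega)
  rw [S.relax n hn]
  have t1 := seminormH1_add_le hh (P (n + 1) + P n - (2 : ℂ) • fun j => G (U (n + 1) j))
    ((2 : ℂ) • fun j => G (U (n + 1) j) - G (U (n + 1) j - e (n + 1) j))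
  rw [seminormH1_smul hh, Complex.norm_ofNat] at t1
  have x1 := seminormH1_nonneg (h := h) (θ (n + 1))
  set x := seminormH1 h (θ (n + 1))
  have main2 : C * seminormH1 h (e (n + 1)) ≤ C * (x + K * h ^ 2) := by gcongr
  have p1 : 0 ≤ C * K * x := by positivity
  have p2 : 0 ≤ C * K * τ ^ 2 := by positivity
  have p3 : 0 ≤ K * (x + h ^ 2) := by positivity
  have p4 : 0 ≤ C * (τ ^ 2 + h ^ 2) := by positivity
  nlinarith

variable {J : ℕ} {K L T h τ : ℝ} {N : ℕ} {U P e ρ θ R : ℕ → Grid J ℂ}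

/-- The two-step differences of the forcing. -/
theorem ErrorSystem.forcing_sub_le (S : ErrorSystem G K L T h τ N U P e ρ θ R) {n : ℕ}
    (hn : n + 2 < N) (hr : seminormH1 h (ρ (n + 2)) ≤ 1) (hx0 : seminormH1 h (θ n) ≤ 1)
    (hx1 : seminormH1 h (θ (n + 1)) ≤ 1) :
    seminormH1 h (errorForcing U P e ρ R (n + 2) - errorForcing U P e ρ R n)
      ≤ (6 * K * (1 + L) * (1 + K) + 8 * √L * (1 + K) * (1 + L ^ 2) + K)
        * (seminormH1 h (ρ (n + 2) - ρ n) + stepNorm τ h (θ (n + 3) - θ (n + 1))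
          + stepNorm τ h (θ (n + 2) - θ n)
          + τ * (seminormH1 h (ρ n) + seminormH1 h (θ n) + seminormH1 h (θ (n + 1))
            + (τ + h ^ 2))) := by
  have hK := S.K_nonneg
  have hL := S.L_pos
  have hh := S.h_pos
  have hτ := S.τ_pos
  have hP2 : Tame (2 * (K * τ)) h (P (n + 2) - P n) := by
    have := (S.P_diff (n + 1) (by omega)).add (S.P_diff n (by omega))
    rwa [show n + 1 + 1 = n + 2 from rfl, sub_add_sub_cancel, ← two_mul] at this
  have hU2 : Tame (4 * (K * τ)) h ((U (n + 3) + U (n + 2)) - (U (n + 1) + U n)) := by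
    have := ((S.U_diff (n + 2) (by omega)).add (S.U_diff (n + 1) (by omega))).add
      ((S.U_diff (n + 1) (by omega)).add (S.U_diff n (by omega)))
    have e1 : U (n + 2 + 1) - U (n + 2) + (U (n + 1 + 1) - U (n + 1))
        + (U (n + 1 + 1) - U (n + 1) + (U (n + 1) - U n))
        = (U (n + 3) + U (n + 2)) - (U (n + 1) + U n) := by
      rw [show n + 2 + 1 = n + 3 from rfl, show n + 1 + 1 = n + 2 from rfl]; abel
    rw [e1] at this
    convert this using 1
    ring
  have hU4 := (S.U_tame (n + 3) (by omega)).add (S.U_tame (n + 2) (by omega))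
  have vE0 := (S.e_ends (n + 1) (by omega)).add (S.e_ends n (by omega))
  have vE2 := (S.e_ends (n + 3) (by omega)).add (S.e_ends (n + 2) (by omega))
  have vρ0 := S.ρ_ends n (by omega)
  have vρ2 := S.ρ_ends (n + 2) (by omega)
  set E0 := e (n + 1) + e n with hE0
  set E2 := e (n + 3) + e (n + 2) with hE2
  set V0 := U (n + 1) + U n with hV0
  set V2 := U (n + 3) + U (n + 2) with hV2
  -- The discrete product rule. In the quadratic term the undifferenced factors are ρ^{n+2}, at most
  -- 1, and E0, bounded a priori; thus every term is linear in a two-step difference or carries a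
  -- factor τ from P or U.
  have eq : errorForcing U P e ρ R (n + 2) - errorForcing U P e ρ R n
      = Complex.I • ((1 / 2 : ℂ) • (P (n + 2) * (E2 - E0) + (P (n + 2) - P n) * E0)
        + (1 / 2 : ℂ) • (V2 * (ρ (n + 2) - ρ n) + (V2 - V0) * ρ n)
        - (1 / 2 : ℂ) • (ρ (n + 2) * (E2 - E0) + (ρ (n + 2) - ρ n) * E0))
        + (R (n + 2) - R n) := by
    ext j
    simp only [errorForcing, potentialDefect, hE0, hE2, hV0, hV2, Pi.sub_apply, Pi.add_apply,
      Pi.smul_apply, Pi.mul_apply, smul_eq_mul, show n + 2 + 1 = n + 3 from rfl]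
    ring
  rw [eq]
  have h0 := S.norm_three_le (P (n + 2) * (E2 - E0) + (P (n + 2) - P n) * E0)
    (V2 * (ρ (n + 2) - ρ n) + (V2 - V0) * ρ n)
    (ρ (n + 2) * (E2 - E0) + (ρ (n + 2) - ρ n) * E0) (R (n + 2) - R n)
  have a1 := seminormH1_add_le hh (P (n + 2) * (E2 - E0)) ((P (n + 2) - P n) * E0)
  have a2 := seminormH1_add_le hh (V2 * (ρ (n + 2) - ρ n)) ((V2 - V0) * ρ n)
  have a3 := seminormH1_add_le hh (ρ (n + 2) * (E2 - E0)) ((ρ (n + 2) - ρ n) * E0)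
  have b1 := S.tame_mul (S.P_tame (n + 2) hn) (vE2.sub vE0)
  have b2 := S.tame_mul hP2 vE0
  have b3 := S.tame_mul hU4 (vρ2.sub vρ0)
  have b4 := S.tame_mul hU2 vρ0
  have b5 := S.mul_le vρ2 (vE2.sub vE0)
  have b6 := S.mul_le (vρ2.sub vρ0) vE0
  have c1 := seminormH1_add_le hh (e (n + 3) - e (n + 1)) (e (n + 2) - e n)
  rw [show e (n + 3) - e (n + 1) + (e (n + 2) - e n) = E2 - E0 by rw [hE0, hE2]; abel] at c1
  have c2 := S.e_sub_two_le (n := n + 1) (by omega)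
  have c3 := S.e_sub_two_le (n := n) (by omega)
  rw [show n + 1 + 2 = n + 3 from rfl] at c2
  have d1 := seminormH1_add_le hh (e (n + 1)) (e n)
  rw [← hE0] at d1
  have d2 := S.e_le (n := n + 1) (by omega)
  have d3 := S.e_le (n := n) (by omega)
  have d4 := S.R_diff n hn
  have s1 := stepNorm_nonneg (h := h) τ (θ (n + 3) - θ (n + 1))
  have s0 := stepNorm_nonneg (h := h) τ (θ (n + 2) - θ n)
  have x0 := seminormH1_nonneg (h := h) (θ n)
  have x1 := seminormH1_nonneg (h := h) (θ (n + 1))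
  have r0 := seminormH1_nonneg (h := h) (ρ n)
  have r2 := seminormH1_nonneg (h := h) (ρ (n + 2))
  have dd0 := seminormH1_nonneg (h := h) (ρ (n + 2) - ρ n)
  have dE0 := seminormH1_nonneg (h := h) (E2 - E0)
  have nE0 := seminormH1_nonneg (h := h) E0
  set s' := stepNorm τ h (θ (n + 3) - θ (n + 1))
  set s := stepNorm τ h (θ (n + 2) - θ n)
  set x := seminormH1 h (θ n)
  set y := seminormH1 h (θ (n + 1))
  set r := seminormH1 h (ρ n)
  set d := seminormH1 h (ρ (n + 2) - ρ n)
  set a := seminormH1 h (E2 - E0)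
  set b := seminormH1 h E0
  have ha : a ≤ s' + s + 4 * K * (τ * h ^ 2) := by linarith
  have hb : b ≤ x + y + 2 * K * h ^ 2 := by linarith
  have hhL : h ^ 2 ≤ L ^ 2 := pow_le_pow_left₀ hh.le S.h_le 2
  have hb' : b ≤ 2 + 2 * K * L ^ 2 := by
    have : K * h ^ 2 ≤ K * L ^ 2 := by gcongr
    linarith
  set Z := d + s' + s + τ * (r + x + y + (τ + h ^ 2)) with hZ
  have Zd : d ≤ Z := by
    have : 0 ≤ τ * (r + x + y + (τ + h ^ 2)) := by positivity
    linarith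
  have Zr : τ * r ≤ Z := by
    have : 0 ≤ τ * (x + y + (τ + h ^ 2)) := by positivity
    linarith
  have Zω : τ * (τ + h ^ 2) ≤ Z := by
    have : 0 ≤ τ * (r + x + y) := by positivity
    linarith
  have Zh : τ * h ^ 2 ≤ Z := by
    have : 0 ≤ τ * τ := by positivity
    linarith
  have Z0 : 0 ≤ Z := dd0.trans Zd
  have Za : a ≤ (1 + 4 * K) * Z := by
    have q1 : s' + s ≤ Z := by
      have : 0 ≤ τ * (r + x + y + (τ + h ^ 2)) := by positivity
      linarith
    have q2 : 4 * K * (τ * h ^ 2) ≤ 4 * K * Z := by gcongr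
    linarith
  have Zb : τ * b ≤ (1 + 2 * K) * Z := by
    have q1 : τ * (x + y) ≤ Z := by
      have : 0 ≤ τ * (r + (τ + h ^ 2)) := by positivity
      linarith
    have q2 : K * (τ * h ^ 2) ≤ K * Z := by gcongr
    have q3 : τ * b ≤ τ * (x + y + 2 * K * h ^ 2) := by gcongr
    linarith
  have f1 : K * (1 + L) * a ≤ K * (1 + L) * ((1 + 4 * K) * Z) := by gcongr
  have f2 : 2 * (K * τ) * (1 + L) * b ≤ 2 * K * (1 + L) * ((1 + 2 * K) * Z) := by
    calc _ = 2 * K * (1 + L) * (τ * b) := by ring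
      _ ≤ _ := by gcongr
  have f3 : (K + K) * (1 + L) * d ≤ (K + K) * (1 + L) * Z := by gcongr
  have f4 : 4 * (K * τ) * (1 + L) * r ≤ 4 * K * (1 + L) * Z := by
    calc _ = 4 * K * (1 + L) * (τ * r) := by ring
      _ ≤ _ := by gcongr
  have f5 : 2 * √L * seminormH1 h (ρ (n + 2)) * a ≤ 2 * √L * 1 * ((1 + 4 * K) * Z) := by gcongr
  have f6 : 2 * √L * d * b ≤ 2 * √L * Z * (2 + 2 * K * L ^ 2) := by gcongr
  have f7 : K * (τ * (τ + h ^ 2)) ≤ K * Z := by gcongr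
  have g1 : 0 ≤ K * (1 + L) * Z := by positivity
  have g2 : 0 ≤ K * (K * (1 + L)) * Z := by positivity
  have g3 : 0 ≤ √L * Z := by positivity
  have g4 : 0 ≤ √L * K * Z := by positivity
  have g5 : 0 ≤ √L * L ^ 2 * Z := by positivity
  have g6 : 0 ≤ √L * K * L ^ 2 * Z := by positivity
  linarith

/-- The sums of consecutive forcings. -/
theorem ErrorSystem.forcing_add_le (S : ErrorSystem G K L T h τ N U P e ρ θ R) {n : ℕ}
    (hn : n + 1 < N) (hr0 : seminormH1 h (ρ n) ≤ 1) (hr1 : seminormH1 h (ρ (n + 1)) ≤ 1) :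
    seminormH1 h (errorForcing U P e ρ R (n + 1) + errorForcing U P e ρ R n)
      ≤ (4 * K * (1 + L) * (1 + K) + 4 * √L * (1 + K) + 2 * K)
        * (seminormH1 h (ρ (n + 1) + ρ n) + τ * seminormH1 h (ρ n) + seminormH1 h (θ n)
          + seminormH1 h (θ (n + 1)) + seminormH1 h (θ (n + 2)) + τ ^ 2 + h ^ 2) := by
  have hK := S.K_nonneg
  have hL := S.L_pos
  have hh := S.h_pos
  have hτ := S.τ_pos
  have hU2 : Tame (2 * (K * τ)) h ((U (n + 2) + U (n + 1)) - (U (n + 1) + U n)) := by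
    have := (S.U_diff (n + 1) (by omega)).add (S.U_diff n (by omega))
    have e1 : (U (n + 1 + 1) - U (n + 1) + (U (n + 1) - U n))
        = (U (n + 2) + U (n + 1)) - (U (n + 1) + U n) := by
      rw [show n + 1 + 1 = n + 2 from rfl]; abel
    rwa [e1, ← two_mul] at this
  have hU4 := (S.U_tame (n + 2) (by omega)).add (S.U_tame (n + 1) (by omega))
  have vE0 := (S.e_ends (n + 1) (by omega)).add (S.e_ends n (by omega))
  have vE1 := (S.e_ends (n + 2) (by omega)).add (S.e_ends (n + 1) (by omega))
  have vρ0 := S.ρ_ends n (by omega)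
  have vρ1 := S.ρ_ends (n + 1) (by omega)
  set E0 := e (n + 1) + e n with hE0
  set E1 := e (n + 2) + e (n + 1) with hE1
  set V0 := U (n + 1) + U n with hV0
  set V1 := U (n + 2) + U (n + 1) with hV1
  -- Writing V1 ρ^{n+1} + V0 ρ^n as V1(ρ^{n+1} + ρ^n) - (V1 - V0)ρ^n isolates the alternating part
  -- of ρ, which survives only against V1 - V0 = O(τ).
  have eq : errorForcing U P e ρ R (n + 1) + errorForcing U P e ρ R n
      = Complex.I • ((1 / 2 : ℂ) • (P (n + 1) * E1 + P n * E0)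
        + (1 / 2 : ℂ) • (V1 * (ρ (n + 1) + ρ n) - (V1 - V0) * ρ n)
        - (1 / 2 : ℂ) • (ρ (n + 1) * E1 + ρ n * E0))
        + (R (n + 1) + R n) := by
    ext j
    simp only [errorForcing, potentialDefect, hE0, hE1, hV0, hV1, Pi.sub_apply, Pi.add_apply,
      Pi.smul_apply, Pi.mul_apply, smul_eq_mul, show n + 1 + 1 = n + 2 from rfl]
    ring
  rw [eq]
  have h0 := S.norm_three_le (P (n + 1) * E1 + P n * E0)
    (V1 * (ρ (n + 1) + ρ n) - (V1 - V0) * ρ n) (ρ (n + 1) * E1 + ρ n * E0) (R (n + 1) + R n)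
  have a1 := seminormH1_add_le hh (P (n + 1) * E1) (P n * E0)
  have a2 := seminormH1_sub_le hh (V1 * (ρ (n + 1) + ρ n)) ((V1 - V0) * ρ n)
  have a3 := seminormH1_add_le hh (ρ (n + 1) * E1) (ρ n * E0)
  have a4 := seminormH1_add_le hh (R (n + 1)) (R n)
  have b1 := S.tame_mul (S.P_tame (n + 1) hn) vE1
  have b2 := S.tame_mul (S.P_tame n (by omega)) vE0
  have b3 := S.tame_mul hU4 (vρ1.add vρ0)
  have b4 := S.tame_mul hU2 vρ0
  have b5 := S.mul_le vρ1 vE1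
  have b6 := S.mul_le vρ0 vE0
  have d1 := seminormH1_add_le hh (e (n + 1)) (e n)
  have d1' := seminormH1_add_le hh (e (n + 2)) (e (n + 1))
  rw [← hE0] at d1
  rw [← hE1] at d1'
  have d2 := S.e_le (n := n + 1) (by omega)
  have d3 := S.e_le (n := n) (by omega)
  have d2' := S.e_le (n := n + 2) (by omega)
  have d4 := S.R_le n (by omega)
  have d5 := S.R_le (n + 1) (by omega)
  have x0 := seminormH1_nonneg (h := h) (θ n)
  have x1 := seminormH1_nonneg (h := h) (θ (n + 1))
  have x2 := seminormH1_nonneg (h := h) (θ (n + 2))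
  have r0 := seminormH1_nonneg (h := h) (ρ n)
  have r1 := seminormH1_nonneg (h := h) (ρ (n + 1))
  have dd0 := seminormH1_nonneg (h := h) (ρ (n + 1) + ρ n)
  have nE0 := seminormH1_nonneg (h := h) E0
  have nE1 := seminormH1_nonneg (h := h) E1
  set x := seminormH1 h (θ n)
  set y := seminormH1 h (θ (n + 1))
  set z := seminormH1 h (θ (n + 2))
  set r := seminormH1 h (ρ n)
  set d := seminormH1 h (ρ (n + 1) + ρ n)
  set a := seminormH1 h E1
  set b := seminormH1 h E0
  set Z := d + τ * r + x + y + z + τ ^ 2 + h ^ 2 with hZ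
  have p0 : 0 ≤ τ * r := by positivity
  have p1 := sq_nonneg τ
  have p2 := sq_nonneg h
  have Z0 : 0 ≤ Z := by positivity
  have Zh : K * h ^ 2 ≤ K * Z := by gcongr; linarith
  have Za : a ≤ (1 + 2 * K) * Z := by linarith
  have Zb : b ≤ (1 + 2 * K) * Z := by linarith
  have f1 : K * (1 + L) * a ≤ K * (1 + L) * ((1 + 2 * K) * Z) := by gcongr
  have f2 : K * (1 + L) * b ≤ K * (1 + L) * ((1 + 2 * K) * Z) := by gcongr
  have f3 : (K + K) * (1 + L) * d ≤ (K + K) * (1 + L) * Z := by gcongr; linarith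
  have f4 : 2 * (K * τ) * (1 + L) * r ≤ 2 * K * (1 + L) * Z := by
    calc _ = 2 * K * (1 + L) * (τ * r) := by ring
      _ ≤ _ := by gcongr; linarith
  have f5 : 2 * √L * seminormH1 h (ρ (n + 1)) * a ≤ 2 * √L * 1 * ((1 + 2 * K) * Z) := by gcongr
  have f6 : 2 * √L * r * b ≤ 2 * √L * 1 * ((1 + 2 * K) * Z) := by gcongr
  have f7 : K * (τ ^ 2 + h ^ 2) ≤ K * Z := by gcongr; linarith
  have g1 : 0 ≤ K * (1 + L) * Z := by positivity
  have g2 : 0 ≤ K * (K * (1 + L)) * Z := by positivity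
  have g3 : 0 ≤ √L * Z := by positivity
  have g4 : 0 ≤ √L * K * Z := by positivity
  linarith

end Estimates

/-! ### Grönwall inequality and the scalar recursion. -/

section Recursion

/-- An implicit discrete Grönwall inequality, whose hypothesis is needed only as long as the
sequence stays below the threshold `δ`. -/
theorem implicit_gronwall {a : ℕ → ℝ} {b c δ : ℝ} (ha : ∀ n, 0 ≤ a n) (hb : 0 ≤ b) (hc : 0 ≤ c)
    (hc' : c ≤ 1 / 4) (M : ℕ) (hδ : Real.exp (4 * c * M) * (a 0 + b) ≤ δ)
    (H : ∀ n < M, a n ≤ δ → a (n + 1) ≤ a n + c * (a n + a (n + 1) + b)) :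
    ∀ n ≤ M, a n + b ≤ Real.exp (4 * c * M) * (a 0 + b) := by
  have key : ∀ n ≤ M, a n + b ≤ Real.exp (4 * c * n) * (a 0 + b) := by
    intro n
    induction n with
    | zero => simp
    | succ n ih =>
      intro hn
      have h1 := ih (by omega)
      have hmono : Real.exp (4 * c * n) * (a 0 + b) ≤ Real.exp (4 * c * M) * (a 0 + b) := by
        have : (n : ℝ) ≤ M := by exact_mod_cast (by omega : n ≤ M)
        have := ha 0
        gcongr
      have h2 := H n (by omega) (by linarith)
      have hn0 := ha n
      -- The implicit term is absorbed on the left; (1 + c)/(1 - c) ≤ 1 + 4c for 0 ≤ c ≤ 1/4.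
      have h3 : a (n + 1) + b ≤ (1 + 4 * c) * (a n + b) := by
        have h4 : (a (n + 1) + b) * (1 - c) ≤ (1 + c) * (a n + b) := by linarith [mul_nonneg hc hb]
        have h5 : (1 + c) * (a n + b) ≤ (1 + 4 * c) * (a n + b) * (1 - c) := by
          have : 1 + c ≤ (1 + 4 * c) * (1 - c) := by nlinarith
          nlinarith
        exact le_of_mul_le_mul_right (h4.trans h5) (by linarith)
      have h6 : 1 + 4 * c ≤ Real.exp (4 * c) := by linarith [Real.add_one_le_exp (4 * c)]
      calc a (n + 1) + b ≤ (1 + 4 * c) * (a n + b) := h3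
        _ ≤ Real.exp (4 * c) * (Real.exp (4 * c * n) * (a 0 + b)) := by gcongr
        _ = _ := by
          rw [← mul_assoc, ← Real.exp_add]
          congr 2
          push_cast
          ring
  intro n hn
  refine (key n hn).trans ?_
  have : (n : ℝ) ≤ M := by exact_mod_cast hn
  have := ha 0
  gcongr

/-- The scalar recursion behind the stability of the relaxation scheme: `x`, `r` bound the errors
of the solution and of the potential, `E` bounds the one-step and `s` the two-step differences of
the former, `d` the two-step differences of the latter. -/
structure RelaxationRecursion (C τ ω : ℝ) (N : ℕ) (x r s E d : ℕ → ℝ) (y : ℝ) : Prop where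
  x_nonneg : ∀ n, 0 ≤ x n
  r_nonneg : ∀ n, 0 ≤ r n
  s_nonneg : ∀ n, 0 ≤ s n
  x_zero : x 0 = 0
  r_zero : r 0 ≤ C * ω
  x_succ : ∀ n < N, x (n + 1) ≤ x n + E n
  x_one : x 1 ≤ y
  E_zero : E 0 ≤ y
  y_le : r 0 ≤ 1 → y ≤ C * τ * (r 0 + x 1 + ω)
  r_one : 1 < N → x 1 ≤ 1 → r 1 ≤ r 0 + C * (x 1 + ω)
  s_zero : 1 < N → r 0 ≤ 1 → r 1 ≤ 1 → s 0 ≤ 2 * y + C * τ * (r 0 + r 1 + 2 * x 1 + x 2 + 2 * ω)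
  x_two : 1 < N → x 2 ≤ s 0
  E_le : ∀ n, n + 1 < N → r n ≤ 1 → r (n + 1) ≤ 1 →
    E n ≤ s n + C * τ * (r n + r (n + 1) + x n + 2 * x (n + 1) + x (n + 2) + 2 * ω) ∧
    E (n + 1) ≤ s n + C * τ * (r n + r (n + 1) + x n + 2 * x (n + 1) + x (n + 2) + 2 * ω)
  d_le : ∀ n, n + 2 < N → x (n + 1) ≤ 1 → x (n + 2) ≤ 1 →
    d n ≤ C * (E (n + 1) + τ * (x (n + 1) + x (n + 2) + ω))
  r_two : ∀ n, n + 2 < N → r (n + 2) ≤ r n + d n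
  s_succ : ∀ n, n + 2 < N → r (n + 2) ≤ 1 → x n ≤ 1 → x (n + 1) ≤ 1 →
    s (n + 1) ≤ s n
      + τ * (C * (d n + s (n + 1) + s n + τ * (r n + x n + x (n + 1) + ω)))

namespace RelaxationRecursion

/-- The quantity to which Grönwall's inequality is applied. -/
def level (τ : ℝ) (x r s : ℕ → ℝ) (n : ℕ) : ℝ :=
  x n + x (n + 1) + x (n + 2) + r n + r (n + 1) + s n / τ

variable {C τ ω : ℝ} {N : ℕ} {x r s E d : ℕ → ℝ} {y : ℝ}

theorem x_le_level (S : RelaxationRecursion C τ ω N x r s E d y) (hτ : 0 < τ) (n : ℕ) :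
    x n ≤ level τ x r s n ∧ x (n + 1) ≤ level τ x r s n ∧ x (n + 2) ≤ level τ x r s n := by
  have h1 := S.x_nonneg n
  have h2 := S.x_nonneg (n + 1)
  have h3 := S.x_nonneg (n + 2)
  have h4 := S.r_nonneg n
  have h5 := S.r_nonneg (n + 1)
  have h6 : 0 ≤ s n / τ := div_nonneg (S.s_nonneg n) hτ.le
  rw [level]
  refine ⟨?_, ?_, ?_⟩ <;> linarith

theorem r_le_level (S : RelaxationRecursion C τ ω N x r s E d y) (hτ : 0 < τ) (n : ℕ) :
    r n ≤ level τ x r s n ∧ r (n + 1) ≤ level τ x r s n := by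
  have h1 := S.x_nonneg n
  have h2 := S.x_nonneg (n + 1)
  have h3 := S.x_nonneg (n + 2)
  have h4 := S.r_nonneg n
  have h5 := S.r_nonneg (n + 1)
  have h6 : 0 ≤ s n / τ := div_nonneg (S.s_nonneg n) hτ.le
  rw [level]
  refine ⟨?_, ?_⟩ <;> linarith

theorem sum_le_level (S : RelaxationRecursion C τ ω N x r s E d y) (hτ : 0 < τ) (n : ℕ) :
    r n + x n + x (n + 1) ≤ level τ x r s n ∧ x (n + 1) + x (n + 2) ≤ level τ x r s n := by
  have h1 := S.x_nonneg n
  have h2 := S.x_nonneg (n + 1)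
  have h3 := S.x_nonneg (n + 2)
  have h4 := S.r_nonneg n
  have h5 := S.r_nonneg (n + 1)
  have h6 : 0 ≤ s n / τ := div_nonneg (S.s_nonneg n) hτ.le
  rw [level]
  refine ⟨?_, ?_⟩ <;> linarith

theorem s_le_level (S : RelaxationRecursion C τ ω N x r s E d y) (hτ : 0 < τ) (n : ℕ) :
    s n ≤ τ * level τ x r s n := by
  have h1 := S.x_nonneg n
  have h2 := S.x_nonneg (n + 1)
  have h3 := S.x_nonneg (n + 2)
  have h4 := S.r_nonneg n
  have h5 := S.r_nonneg (n + 1)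
  have h7 : s n = τ * (s n / τ) := by field_simp
  rw [h7, level]
  refine mul_le_mul_of_nonneg_left ?_ hτ.le
  linarith

theorem level_nonneg (S : RelaxationRecursion C τ ω N x r s E d y) (hτ : 0 < τ) (n : ℕ) :
    0 ≤ level τ x r s n := (S.x_nonneg n).trans (S.x_le_level hτ n).1

/-- Since s n = τ · (s n / τ), every term in the bound for the one-step differences has a factor τ.
This is why `level` contains s n / τ rather than s n. -/
theorem E_le_level (S : RelaxationRecursion C τ ω N x r s E d y) (hC : 1 ≤ C) (hτ : 0 < τ)
    {n : ℕ} (hn : n + 1 < N) (h0 : r n ≤ 1) (h1 : r (n + 1) ≤ 1) :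
    E n ≤ 2 * C * τ * (level τ x r s n + ω) ∧ E (n + 1) ≤ 2 * C * τ * (level τ x r s n + ω) := by
  obtain ⟨a1, a2⟩ := S.E_le n hn h0 h1
  have h2 := S.x_nonneg (n + 2)
  have h3 := S.x_nonneg n
  have h4 := S.r_nonneg n
  have h5 := S.r_nonneg (n + 1)
  have b2 : 0 ≤ s n / τ := div_nonneg (S.s_nonneg n) hτ.le
  have c1 : s n + C * τ * (r n + r (n + 1) + x n + 2 * x (n + 1) + x (n + 2) + 2 * ω)
      ≤ 2 * C * τ * (level τ x r s n + ω) := by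
    have d1 : s n ≤ C * τ * (2 * (s n / τ)) := by
      have q1 : τ * (s n / τ) ≤ C * τ * (s n / τ) := by
        gcongr
        nlinarith
      have q2 : 0 ≤ C * τ * (s n / τ) := by positivity
      have q3 : τ * (s n / τ) = s n := by field_simp
      linarith
    have d2 : C * τ * (r n + r (n + 1) + x n + 2 * x (n + 1) + x (n + 2) + 2 * ω)
        ≤ C * τ * (2 * (x n + x (n + 1) + x (n + 2) + r n + r (n + 1)) + 2 * ω) := by
      gcongr
      linarith
    rw [level]
    linarith
  exact ⟨a1.trans c1, a2.trans c1⟩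

/-- All components grow by O(τ): x n to x (n + 3) by three one-step differences, r n to r (n + 2) by
d n, and s n / τ because the increment of s is τ times quantities that are themselves O(τ). With Z
the sum of both levels and ω, these cost at most 6, 3 and 6 times C³τZ, whence the 15. -/
theorem level_succ_le (S : RelaxationRecursion C τ ω N x r s E d y) (hC : 1 ≤ C) (hτ : 0 < τ)
    (hω : 0 ≤ ω) (hω1 : ω ≤ 1) (hCτ : 60 * C ^ 3 * τ ≤ 1) {n : ℕ} (hn : n + 2 < N)
    (hY : level τ x r s n ≤ 1 / 2) :
    level τ x r s (n + 1) ≤ level τ x r s n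
      + 15 * C ^ 3 * τ * (level τ x r s n + level τ x r s (n + 1) + ω) := by
  have C2 : C ≤ C ^ 2 := by nlinarith
  have C3 : C ^ 2 ≤ C ^ 3 := by nlinarith [sq_nonneg C]
  have C4 : C ≤ C ^ 3 := C2.trans C3
  have cτ2 : C ^ 2 * τ ≤ C ^ 3 * τ := by gcongr
  obtain ⟨x0, x1, x2⟩ := S.x_le_level hτ n
  obtain ⟨r0, r1⟩ := S.r_le_level hτ n
  obtain ⟨u1, u2⟩ := S.sum_le_level hτ n
  have sn := S.s_le_level hτ n
  have sn' := S.s_le_level hτ (n + 1)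
  have y0 := S.level_nonneg hτ n
  have y1 := S.level_nonneg hτ (n + 1)
  have eY : level τ x r s (n + 1) = x (n + 1) + x (n + 2) + x (n + 3) + r (n + 1) + r (n + 2)
    + s (n + 1) / τ := rfl
  have eY0 : level τ x r s n = x n + x (n + 1) + x (n + 2) + r n + r (n + 1) + s n / τ := rfl
  have hE0 := S.E_le_level hC hτ (n := n) (by omega) (by linarith) (by linarith)
  have hE1 := S.E_le_level hC hτ (n := n + 1) (by omega) (by linarith)
  set Y := level τ x r s n
  set Y' := level τ x r s (n + 1)
  have hd := S.d_le n hn (by linarith) (by linarith)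
  have hd' : d n ≤ 3 * C ^ 2 * τ * (Y + ω) := by
    have q : τ * (x (n + 1) + x (n + 2) + ω) ≤ C * (τ * (Y + ω)) := by
      have q1 : τ * (x (n + 1) + x (n + 2) + ω) ≤ τ * (Y + ω) := by gcongr
      have q2 : 0 ≤ τ * (Y + ω) := by positivity
      nlinarith
    have q3 : C * (E (n + 1) + τ * (x (n + 1) + x (n + 2) + ω))
        ≤ C * (2 * C * τ * (Y + ω) + C * (τ * (Y + ω))) := by
      gcongr
      exact hE0.2
    linarith
  -- The bootstrap: r n ≤ 1/2 and d n ≤ 1/2 give r (n + 2) ≤ 1, which is required before the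
  -- estimates at level n + 1 may be used.
  have hdsmall : 3 * C ^ 2 * τ * (Y + ω) ≤ 1 / 2 := by
    have q1 : 3 * C ^ 2 * τ * (Y + ω) ≤ 1 / 4 * (Y + ω) := by gcongr; linarith
    linarith
  have hr2 := S.r_two n hn
  have hr2' : r (n + 2) ≤ 1 := by linarith
  have hE1 := hE1 hr2'
  have hs := S.s_succ n hn hr2' (by linarith) (by linarith)
  have hx0 := S.x_succ n (by omega)
  have hx1 := S.x_succ (n + 1) (by omega)
  have hx2 := S.x_succ (n + 2) (by omega)
  set Z := Y + Y' + ω with hZ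
  have hZ0 : 0 ≤ Z := by positivity
  have hYZ : Y + ω ≤ Z := by linarith
  have hYZ' : Y' + ω ≤ Z := by linarith
  have g3 : 3 * C ^ 2 * τ * (Y + ω) ≤ 3 * C ^ 2 * τ * Z := by gcongr
  have hs' : s (n + 1) / τ ≤ s n / τ + 6 * C ^ 3 * τ * Z := by
    rw [div_add' _ _ _ hτ.ne', div_le_div_iff_of_pos_right hτ]
    refine hs.trans ?_
    have q0 : d n + s (n + 1) + s n + τ * (r n + x n + x (n + 1) + ω)
        ≤ 3 * C ^ 2 * τ * Z + 2 * (τ * Z) := by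
      have q1 : τ * (r n + x n + x (n + 1) + ω) ≤ τ * (Y + ω) := by gcongr
      have q2 : τ * Y' + τ * Y + τ * (Y + ω) ≤ 2 * (τ * Z) := by
        have : 0 ≤ τ * (Y' + ω) := by positivity
        rw [hZ]
        linarith
      linarith
    have q1 : τ * (C * (d n + s (n + 1) + s n + τ * (r n + x n + x (n + 1) + ω)))
        ≤ τ * (C * (3 * C ^ 2 * τ * Z + 2 * (τ * Z))) := by gcongr
    have q2 : C * (τ * (τ * Z)) ≤ C ^ 3 * (τ * (τ * Z)) := by gcongr
    have : 0 ≤ C ^ 3 * (τ * (τ * Z)) := by positivity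
    linarith
  have g1 : 2 * C * τ * (Y + ω) ≤ 2 * C ^ 3 * τ * Z := by gcongr
  have g2 : 2 * C * τ * (Y' + ω) ≤ 2 * C ^ 3 * τ * Z := by gcongr
  have g4 : C ^ 2 * τ * Z ≤ C ^ 3 * τ * Z := by gcongr
  obtain ⟨e1, e2⟩ := hE0
  obtain ⟨e1', e2'⟩ := hE1
  rw [show n + 1 + 1 = n + 2 from rfl] at e2' hx1
  rw [show n + 2 + 1 = n + 3 from rfl] at hx2
  linarith

/-- The first step starts from θ = 0, so x 1 ≤ y can be absorbed on the left of y ≤ Cτ(r 0 + x 1 +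
ω). The bound O(τω), one factor τ better than ω, starts the difference estimates. -/
theorem y_le_of_small (S : RelaxationRecursion C τ ω N x r s E d y) (hC : 1 ≤ C) (hτ : 0 < τ)
    (hω : 0 ≤ ω) (hCω : 60 * C ^ 3 * ω ≤ 1) (hCτ : 60 * C ^ 3 * τ ≤ 1) :
    y ≤ 4 * C ^ 2 * (τ * ω) ∧ r 0 ≤ 1 := by
  have C2 : C ≤ C ^ 2 := by nlinarith
  have C3 : C ^ 2 ≤ C ^ 3 := by nlinarith [sq_nonneg C]
  have C4 : C ≤ C ^ 3 := C2.trans C3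
  have cω : C * ω ≤ C ^ 3 * ω := by gcongr
  have cτ : C * τ ≤ C ^ 3 * τ := by gcongr
  have cω0 : ω ≤ C * ω := by nlinarith
  have hr := S.r_zero
  have r0 : r 0 ≤ 1 := by linarith
  have x1 := S.x_one
  have y0 := (S.x_nonneg 1).trans x1
  have h1 := S.y_le r0
  have h2 : C * τ * (r 0 + x 1 + ω) ≤ C * τ * (C * ω + y + C * ω) := by gcongr
  have h3 : C * τ * y ≤ 1 / 4 * y := by gcongr; linarith
  have : 0 ≤ C ^ 2 * (τ * ω) := by positivity
  exact ⟨by linarith, r0⟩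

/-- The delicate component is s 0 / τ: it is O(ω) because y is O(τω) and the remaining terms of s 0
carry a factor τ, with x 2 ≤ s 0 absorbed on the left. -/
theorem level_zero_le (S : RelaxationRecursion C τ ω N x r s E d y) (hC : 1 ≤ C) (hτ : 0 < τ)
    (hω : 0 ≤ ω) (hCω : 60 * C ^ 3 * ω ≤ 1) (hCτ : 60 * C ^ 3 * τ ≤ 1) (hN : 1 < N) :
    level τ x r s 0 + ω ≤ 34 * C ^ 3 * ω := by
  have hC0 : 0 < C := by linarith
  have C2 : C ≤ C ^ 2 := by nlinarith
  have C3 : C ^ 2 ≤ C ^ 3 := by nlinarith [sq_nonneg C]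
  have cω2 : C ^ 2 * ω ≤ C ^ 3 * ω := by gcongr
  have cω1 : C * ω ≤ C ^ 2 * ω := by gcongr
  have cω0 : ω ≤ C * ω := by nlinarith
  have cτ2 : C ^ 2 * τ ≤ C ^ 3 * τ := by gcongr
  have cτ1 : C * τ ≤ C ^ 2 * τ := by gcongr
  obtain ⟨hy, r0⟩ := S.y_le_of_small hC hτ hω hCω hCτ
  have p2 : C ^ 2 * (τ * ω) ≤ 1 / 60 * ω := by
    have : C ^ 2 * τ * ω ≤ 1 / 60 * ω := by gcongr; linarith
    linarith
  have p3 : C ^ 3 * (τ * ω) ≤ 1 / 60 * ω := by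
    have : C ^ 3 * τ * ω ≤ 1 / 60 * ω := by gcongr; linarith
    linarith
  have x1ω : x 1 ≤ 1 / 15 * ω := by linarith [S.x_one]
  have x11 : x 1 ≤ 1 := by linarith
  have hr0 := S.r_zero
  have hx2 := S.x_two hN
  have hx0 := S.x_zero
  have hs0 := S.s_nonneg 0
  have r1ω : r 1 ≤ 3 * C ^ 2 * ω := by
    have h1 := S.r_one hN x11
    have h2 : C * (x 1 + ω) ≤ C * (2 * ω) := by gcongr; linarith
    linarith
  have r11 : r 1 ≤ 1 := by linarith
  have s0 : s 0 ≤ 22 * C ^ 3 * (τ * ω) := by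
    have h1 := S.s_zero hN r0 r11
    have h2 : C * τ * (r 0 + r 1 + 2 * x 1 + x 2 + 2 * ω)
        ≤ C * τ * (8 * (C ^ 2 * ω) + s 0) := by
      refine mul_le_mul_of_nonneg_left ?_ (by positivity)
      linarith
    have h3 : C * τ * s 0 ≤ 1 / 60 * s 0 := by
      gcongr
      linarith
    have h4 : C ^ 2 * (τ * ω) ≤ C ^ 3 * (τ * ω) := by gcongr
    have h5 : 0 ≤ C ^ 3 * (τ * ω) := by positivity
    linarith
  have h1 : s 0 / τ ≤ 22 * C ^ 3 * ω := by
    rw [div_le_iff₀ hτ]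
    linarith
  have eY0 : level τ x r s 0 = x 0 + x 1 + x 2 + r 0 + r 1 + s 0 / τ := rfl
  linarith

/-- Grönwall applied to `level` with c = 15 C³ τ: over at most N steps the growth factor is at most
exp(60 C³ T), and the bound Aω stays below the threshold 1/2 needed by `level_succ_le`. -/
theorem bounds {C : ℝ} (T : ℝ) (hC : 1 ≤ C) :
    ∃ ε > 0, ∃ C' ≥ 0, ∀ (τ ω : ℝ) (N : ℕ) (x r s E d : ℕ → ℝ) (y : ℝ),
      RelaxationRecursion C τ ω N x r s E d y → 0 < τ → N * τ ≤ T → 1 ≤ N → τ ≤ ω → ω ≤ ε →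
      y ≤ C' * (τ * ω) ∧ (∀ n < N, r n ≤ C' * ω ∧ r n ≤ 1 ∧ E n ≤ C' * (τ * ω)) ∧
        ∀ n ≤ N, x n ≤ C' * ω ∧ x n ≤ 1 := by
  have hC0 : 0 < C := by linarith
  set X := Real.exp (60 * C ^ 3 * T) with hX
  have hX0 : 0 < X := Real.exp_pos _
  set A := X * (34 * C ^ 3) with hA
  have hA0 : 0 < A := by positivity
  -- The first bound makes c ≤ 1/4 and allows the absorptions; the second keeps Aω ≤ 1/2.
  refine ⟨min (1 / (60 * C ^ 3)) (1 / (2 * A)), by positivity, 2 * C * A + A + 4 * C ^ 2,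
    by positivity, ?_⟩
  intro τ ω N x r s E d y S hτ hT hN hτω hω
  have hω0 : 0 < ω := hτ.trans_le hτω
  have w1 : 60 * C ^ 3 * ω ≤ 1 := by
    have := hω.trans (min_le_left _ _)
    rw [le_div_iff₀ (by positivity)] at this
    linarith
  have w2 : 2 * A * ω ≤ 1 := by
    have := hω.trans (min_le_right _ _)
    rw [le_div_iff₀ (by positivity)] at this
    linarith
  have w3 : 60 * C ^ 3 * τ ≤ 1 := by
    have : 60 * C ^ 3 * τ ≤ 60 * C ^ 3 * ω := by gcongr
    linarith
  have hω1 : ω ≤ 1 := by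
    have : (1 : ℝ) ≤ C ^ 3 := one_le_pow₀ hC
    nlinarith
  obtain ⟨hy, r0⟩ := S.y_le_of_small hC hτ hω0.le w1 w3
  have hAτ : 0 ≤ A * (τ * ω) := by positivity
  have hCAτ : 0 ≤ C * A * (τ * ω) := by positivity
  have hC2τ : 0 ≤ C ^ 2 * (τ * ω) := by positivity
  have hA' : A * ω ≤ (2 * C * A + A + 4 * C ^ 2) * ω := by
    have : 0 ≤ (2 * C * A + 4 * C ^ 2) * ω := by positivity
    linarith
  rcases Nat.lt_or_ge 1 N with hN1 | hN1
  swap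
  -- With a single step there is no r 1 or x 2, so `level` carries no information and the first-step
  -- bound is used alone.
  · obtain rfl : N = 1 := by omega
    have C2 : C ≤ C ^ 2 := by nlinarith
    have C3 : C ^ 2 ≤ C ^ 3 := by nlinarith [sq_nonneg C]
    have q2 : C * ω ≤ (2 * C * A + A + 4 * C ^ 2) * ω := by
      gcongr
      have : 0 ≤ 2 * C * A + A := by positivity
      nlinarith [sq_nonneg C]
    have q3 : C ^ 2 * τ * ω ≤ 1 / 60 * ω := by
      have : C ^ 2 * τ ≤ C ^ 3 * τ := by gcongr
      gcongr
      linarith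
    have q4 : ω ≤ C * ω := by nlinarith
    have q5 := S.x_one
    refine ⟨by linarith, fun n hn => ?_, fun n hn => ?_⟩
    · obtain rfl : n = 0 := by omega
      refine ⟨S.r_zero.trans q2, r0, by linarith [S.E_zero]⟩
    · obtain rfl | rfl : n = 0 ∨ n = 1 := by omega
      · rw [S.x_zero]
        exact ⟨by positivity, by norm_num⟩
      · exact ⟨by linarith, by linarith⟩
  have hcN : Real.exp (4 * (15 * C ^ 3 * τ) * (N - 2 : ℕ)) ≤ X := by
    rw [hX]
    refine Real.exp_le_exp.2 ?_
    have : ((N - 2 : ℕ) : ℝ) ≤ N := by exact_mod_cast Nat.sub_le N 2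
    calc 4 * (15 * C ^ 3 * τ) * ((N - 2 : ℕ) : ℝ) ≤ 4 * (15 * C ^ 3 * τ) * N := by gcongr
      _ = 60 * C ^ 3 * (N * τ) := by ring
      _ ≤ _ := by gcongr
  have hexp : Real.exp (4 * (15 * C ^ 3 * τ) * (N - 2 : ℕ)) * (level τ x r s 0 + ω)
      ≤ A * ω := by
    calc _ ≤ X * (34 * C ^ 3 * ω) :=
          mul_le_mul hcN (S.level_zero_le hC hτ hω0.le w1 w3 hN1)
            (add_nonneg (S.level_nonneg hτ 0) hω0.le) hX0.le
      _ = _ := by rw [hA]; ring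
  have hYb : ∀ n ≤ N - 2, level τ x r s n + ω ≤ A * ω := fun n hn =>
    (implicit_gronwall (S.level_nonneg hτ) hω0.le (by positivity) (by linarith) (N - 2)
      (hexp.trans (by linarith)) (fun n hn hY => S.level_succ_le hC hτ hω0.le hω1 w3
        (by omega) hY) n hn).trans hexp
  -- The level is controlled up to index N - 2; x (N - 1) and x N are read off from its second and
  -- third components.
  have hmem : ∀ n ≤ N, x n ≤ A * ω := by
    intro n hn
    rcases Nat.lt_or_ge n (N - 1) with hc | hc
    · linarith [hYb n (by omega), (S.x_le_level hτ n).1]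
    · rcases Nat.lt_or_ge n N with hd | hd
      · obtain ⟨k, rfl⟩ : ∃ k, n = k + 1 := ⟨n - 1, by omega⟩
        linarith [hYb k (by omega), (S.x_le_level hτ k).2.1]
      · obtain ⟨k, rfl⟩ : ∃ k, n = k + 2 := ⟨n - 2, by omega⟩
        linarith [hYb k (by omega), (S.x_le_level hτ k).2.2]
  have hrmem : ∀ n < N, r n ≤ A * ω := by
    intro n hn
    rcases Nat.lt_or_ge n (N - 1) with hc | hc
    · linarith [hYb n (by omega), (S.r_le_level hτ n).1]
    · obtain ⟨k, rfl⟩ : ∃ k, n = k + 1 := ⟨n - 1, by omega⟩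
      linarith [hYb k (by omega), (S.r_le_level hτ k).2]
  have hr1 : ∀ n < N, r n ≤ 1 := fun n hn => by linarith [hrmem n hn]
  have hEmem : ∀ n ≤ N - 2,
      2 * C * τ * (level τ x r s n + ω) ≤ (2 * C * A + A + 4 * C ^ 2) * (τ * ω) := by
    intro n hn
    have h1 : 2 * C * τ * (level τ x r s n + ω) ≤ 2 * C * τ * (A * ω) := by
      gcongr
      exact hYb n hn
    linarith
  refine ⟨by linarith, fun n hn => ⟨(hrmem n hn).trans hA', hr1 n hn, ?_⟩, fun n hn =>
    ⟨(hmem n hn).trans hA', by linarith [hmem n hn]⟩⟩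
  rcases Nat.lt_or_ge n (N - 1) with hc | hc
  · exact (S.E_le_level hC hτ (by omega) (hr1 n hn) (hr1 (n + 1) (by omega))).1.trans
      (hEmem n (by omega))
  · obtain ⟨k, rfl⟩ : ∃ k, n = k + 1 := ⟨n - 1, by omega⟩
    exact (S.E_le_level hC hτ (by omega) (hr1 k (by omega)) (hr1 (k + 1) hn)).2.trans
      (hEmem k (by omega))

end RelaxationRecursion

end Recursion

/-! ### From the error equations to the error bounds. -/

section Stability

namespace ErrorSystem

variable {J : ℕ} {G : ℂ → ℂ} {K L T h τ : ℝ} {N : ℕ} {U P e ρ θ R : ℕ → Grid J ℂ}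

theorem step_sub (S : ErrorSystem G K L T h τ N U P e ρ θ R) {m k : ℕ} (hm : m < N) (hk : k < N) :
    (θ (m + 1) - θ (k + 1)) - (θ m - θ k)
      = (Complex.I * (τ / 2)) • discreteLaplacian h ((θ (m + 1) - θ (k + 1)) + (θ m - θ k))
        + (τ : ℂ) • (errorForcing U P e ρ R m - errorForcing U P e ρ R k) := by
  have h1 := S.step m hm
  have h2 := S.step k hk
  have e1 : (θ (m + 1) - θ (k + 1)) - (θ m - θ k)
      = (θ (m + 1) - θ m) - (θ (k + 1) - θ k) := by abel
  have e2 : (θ (m + 1) - θ (k + 1)) + (θ m - θ k)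
      = (θ (m + 1) + θ m) - (θ (k + 1) + θ k) := by abel
  rw [e1, e2, h1, h2, discreteLaplacian_sub, smul_sub, smul_sub]
  abel

theorem step_add (S : ErrorSystem G K L T h τ N U P e ρ θ R) {n : ℕ} (hn : n + 1 < N) :
    (θ (n + 2) + θ (n + 1)) - (θ (n + 1) + θ n)
      = (Complex.I * (τ / 2))
          • discreteLaplacian h ((θ (n + 2) + θ (n + 1)) + (θ (n + 1) + θ n))
        + (τ : ℂ) • (errorForcing U P e ρ R (n + 1) + errorForcing U P e ρ R n) := by
  have h1 := S.step n (by omega)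
  have h2 := S.step (n + 1) hn
  rw [show n + 1 + 1 = n + 2 from rfl] at h2
  have e1 : (θ (n + 2) + θ (n + 1)) - (θ (n + 1) + θ n)
      = (θ (n + 2) - θ (n + 1)) + (θ (n + 1) - θ n) := by abel
  rw [e1, h1, h2, discreteLaplacian_add _ (θ (n + 1) + θ n), smul_add, smul_add]
  abel

theorem stepNorm_one_le (S : ErrorSystem G K L T h τ N U P e ρ θ R) :
    stepNorm τ h (θ 1) ≤ τ * seminormH1 h (errorForcing U P e ρ R 0) := by
  have h1 := S.step 0 S.one_le
  have h2 := stepNorm_le_of_step S.h_pos S.τ_pos.le (S.θ_ends 0 (by omega)) h1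
  have h3 : stepNorm τ h (0 : Grid J ℂ) = 0 := by
    have : discreteLaplacian h (0 : Grid J ℂ) = 0 := by
      simpa using discreteLaplacian_smul (h := h) 0 (0 : Grid J ℂ)
    rw [stepNorm, this, smul_zero, sub_zero, seminormH1_zero S.h_pos]
  rwa [S.θ_zero, h3, zero_add, zero_add] at h2

/-- Reduction to scalars with ω = τ + h². The sharper quantity τ² + h² is replaced by (1 + T)ω,
which accounts for the factors 1 + T in C; second order in time is not sought at this stage. -/
theorem recursion {C₀ C₁ C₂ C₃ C : ℝ}
    (S : ErrorSystem G K L T h τ N U P e ρ θ R) (hC₀ : 0 ≤ C₀) (hC₁ : 0 ≤ C₁) (hC₂ : 0 ≤ C₂)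
    (hC₃ : 0 ≤ C₃) (hT : 0 ≤ T)
    (hC : C₀ * (1 + T) + C₁ + C₂ * (1 + T) + C₃ + K ≤ C)
    (H0 : ∀ n < N, seminormH1 h (ρ n) ≤ 1 → seminormH1 h (errorForcing U P e ρ R n) ≤ C₀
      * (seminormH1 h (ρ n) + seminormH1 h (θ n) + seminormH1 h (θ (n + 1)) + τ ^ 2 + h ^ 2))
    (H1 : ∀ n, n + 2 < N → seminormH1 h (θ (n + 1)) ≤ 1 → seminormH1 h (θ (n + 2)) ≤ 1 →
      seminormH1 h (ρ (n + 2) - ρ n) ≤ C₁ * (seminormH1 h (θ (n + 2) - θ (n + 1))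
        + τ * (seminormH1 h (θ (n + 1)) + seminormH1 h (θ (n + 2)) + (τ + h ^ 2))))
    (H2 : ∀ n, n + 1 < N → seminormH1 h (θ (n + 1)) ≤ 1 →
      seminormH1 h (ρ (n + 1) + ρ n) ≤ C₂ * (seminormH1 h (θ (n + 1)) + τ ^ 2 + h ^ 2))
    (H3 : ∀ n, n + 2 < N → seminormH1 h (ρ (n + 2)) ≤ 1 → seminormH1 h (θ n) ≤ 1 →
      seminormH1 h (θ (n + 1)) ≤ 1 →
      seminormH1 h (errorForcing U P e ρ R (n + 2) - errorForcing U P e ρ R n)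
      ≤ C₃ * (seminormH1 h (ρ (n + 2) - ρ n) + stepNorm τ h (θ (n + 3) - θ (n + 1))
          + stepNorm τ h (θ (n + 2) - θ n)
          + τ * (seminormH1 h (ρ n) + seminormH1 h (θ n) + seminormH1 h (θ (n + 1))
            + (τ + h ^ 2)))) :
    RelaxationRecursion C τ (τ + h ^ 2) N (fun n => seminormH1 h (θ n))
      (fun n => seminormH1 h (ρ n)) (fun n => stepNorm τ h (θ (n + 2) - θ n))
      (fun n => seminormH1 h (θ (n + 1) - θ n)) (fun n => seminormH1 h (ρ (n + 2) - ρ n))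
      (stepNorm τ h (θ 1)) := by
  have hh := S.h_pos
  have hτ := S.τ_pos
  have hK := S.K_nonneg
  have hω : τ ^ 2 + h ^ 2 ≤ (1 + T) * (τ + h ^ 2) := by
    have := S.τ_le
    nlinarith [sq_nonneg h]
  have hω0 : 0 ≤ τ + h ^ 2 := by positivity
  set ω := τ + h ^ 2 with hωdef
  have q0 : 0 ≤ C₀ * (1 + T) := by positivity
  have q2 : 0 ≤ C₂ * (1 + T) := by positivity
  have nn := fun v : Grid J ℂ => seminormH1_nonneg (h := h) v
  have sn := fun v : Grid J ℂ => stepNorm_nonneg (h := h) τ v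
  have F0 : ∀ n < N, seminormH1 h (ρ n) ≤ 1 → seminormH1 h (errorForcing U P e ρ R n)
      ≤ C * (seminormH1 h (ρ n) + seminormH1 h (θ n) + seminormH1 h (θ (n + 1)) + ω) := by
    intro n hn hr
    have p0 := nn (ρ n)
    have p1 := nn (θ n)
    have p2 := nn (θ (n + 1))
    set a := seminormH1 h (ρ n) + seminormH1 h (θ n) + seminormH1 h (θ (n + 1)) with ha
    have ha0 : 0 ≤ a := by positivity
    calc _ ≤ C₀ * (a + τ ^ 2 + h ^ 2) := H0 n hn hr
      _ ≤ C₀ * ((1 + T) * (a + ω)) := by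
        gcongr
        nlinarith
      _ = C₀ * (1 + T) * (a + ω) := by ring
      _ ≤ C * (a + ω) := by
        gcongr
        linarith
  have ends2 : ∀ {m k : ℕ}, m ≤ N → k ≤ N → VanishesAtEnds (θ m - θ k) :=
    fun hm hk => (S.θ_ends _ hm).sub (S.θ_ends _ hk)
  have Fsub : ∀ n, n + 1 < N → seminormH1 h (ρ n) ≤ 1 → seminormH1 h (ρ (n + 1)) ≤ 1 →
      τ * seminormH1 h (errorForcing U P e ρ R (n + 1) - errorForcing U P e ρ R n)
      ≤ C * τ * (seminormH1 h (ρ n) + seminormH1 h (ρ (n + 1)) + seminormH1 h (θ n)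
        + 2 * seminormH1 h (θ (n + 1)) + seminormH1 h (θ (n + 2)) + 2 * ω) := by
    intro n hn h0 h1
    have a1 := F0 n (by omega) h0
    have a2 := F0 (n + 1) hn h1
    have a3 := seminormH1_sub_le hh (errorForcing U P e ρ R (n + 1)) (errorForcing U P e ρ R n)
    rw [show n + 1 + 1 = n + 2 from rfl] at a2
    have a4 := mul_le_mul_of_nonneg_left (a3.trans (add_le_add a2 a1)) hτ.le
    linarith
  constructor
  case x_nonneg => exact fun n => nn _
  case r_nonneg => exact fun n => nn _
  case s_nonneg => exact fun n => sn _
  case x_zero => simp only [S.θ_zero, seminormH1_zero hh]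
  case r_zero =>
    refine S.ρ_zero.trans ?_
    have : K * τ ≤ K * ω := by
      gcongr
      rw [hωdef]
      linarith [sq_nonneg h]
    have : K * ω ≤ C * ω := by gcongr; linarith
    linarith
  case x_succ =>
    intro n hn
    have := seminormH1_add_le hh (θ n) (θ (n + 1) - θ n)
    rwa [add_sub_cancel] at this
  case x_one => exact seminormH1_le_stepNorm hh τ (S.θ_ends 1 S.one_le)
  case E_zero =>
    simp only [zero_add, S.θ_zero, sub_zero]
    exact seminormH1_le_stepNorm hh τ (S.θ_ends 1 S.one_le)
  case y_le =>
    intro h0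
    have a1 := F0 0 S.one_le h0
    have a2 := mul_le_mul_of_nonneg_left a1 hτ.le
    rw [S.θ_zero, seminormH1_zero hh, zero_add, add_zero] at a2
    have := S.stepNorm_one_le
    linarith
  case r_one =>
    intro hN hx
    have a1 := H2 0 (by omega) hx
    have a2 := seminormH1_sub_le hh (ρ 1 + ρ 0) (ρ 0)
    rw [add_sub_cancel_right] at a2
    rw [zero_add] at a1
    have p := nn (θ 1)
    have a3 : C₂ * (seminormH1 h (θ 1) + τ ^ 2 + h ^ 2) ≤ C * (seminormH1 h (θ 1) + ω) := by
      calc _ ≤ C₂ * ((1 + T) * (seminormH1 h (θ 1) + ω)) := by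
            gcongr
            nlinarith
        _ = C₂ * (1 + T) * (seminormH1 h (θ 1) + ω) := by ring
        _ ≤ _ := by
          gcongr
          linarith
    linarith
  case s_zero =>
    intro hN h0 h1
    -- θ² - θ¹ is propagated from θ¹ - θ⁰ = θ¹, and θ² - θ⁰ is the sum of the two: hence 2y.
    have a1 := S.step_sub (m := 1) (k := 0) (by omega) (by omega)
    simp only [zero_add, show 1 + 1 = 2 from rfl] at a1 ⊢
    have a2 := stepNorm_le_of_step hh hτ.le (ends2 (by omega) (by omega)) a1
    have a3 := stepNorm_add_le hh τ (θ 2 - θ 1) (θ 1 - θ 0)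
    rw [sub_add_sub_cancel] at a3
    have a4 := Fsub 0 (by omega) h0 h1
    simp only [zero_add] at a4
    rw [S.θ_zero, sub_zero] at a2 a3
    rw [S.θ_zero, seminormH1_zero hh] at a4
    rw [S.θ_zero]
    simp only [sub_zero] at a3 ⊢
    linarith
  case x_two =>
    intro hN
    have := seminormH1_le_stepNorm hh τ (S.θ_ends 2 (by omega))
    simpa [S.θ_zero] using this
  case E_le =>
    intro n hn h0 h1
    -- Consecutive one-step differences are the two ends of a Crank-Nicolson step, and their sum is
    -- θ^{n+2} - θ^n. The forcing F^{n+1} - F^n is estimated by sizes only, since it comes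
    -- multiplied by τ.
    have a1 := S.step_sub (m := n + 1) (k := n) hn (by omega)
    rw [show n + 1 + 1 = n + 2 from rfl] at a1
    have hv : VanishesAtEnds (θ (n + 2) - θ (n + 1) + (θ (n + 1) - θ n)) :=
      (ends2 (by omega) (by omega)).add (ends2 (by omega) (by omega))
    obtain ⟨a2, a3⟩ := seminormH1_le_of_step hh hτ.le hv a1
    rw [sub_add_sub_cancel] at a2 a3
    have a4 := Fsub n hn h0 h1
    exact ⟨a3.trans (add_le_add le_rfl a4), a2.trans (add_le_add le_rfl a4)⟩
  case d_le =>
    intro n hn h0 h1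
    refine (H1 n hn h0 h1).trans ?_
    have p1 := nn (θ (n + 1))
    have p2 := nn (θ (n + 2))
    have p3 := nn (θ (n + 2) - θ (n + 1))
    refine mul_le_mul_of_nonneg_right (by linarith) (by positivity)
  case r_two =>
    intro n hn
    have := seminormH1_add_le hh (ρ n) (ρ (n + 2) - ρ n)
    rwa [add_sub_cancel] at this
  case s_succ =>
    intro n hn h0 h1 h2
    have a1 := S.step_sub (m := n + 2) (k := n) (by omega) (by omega)
    rw [show n + 2 + 1 = n + 3 from rfl] at a1
    have a2 := stepNorm_le_of_step hh hτ.le (ends2 (by omega) (by omega)) a1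
    have a3 := H3 n hn h0 h1 h2
    refine a2.trans (add_le_add le_rfl (mul_le_mul_of_nonneg_left (a3.trans ?_) hτ.le))
    have p1 := nn (ρ (n + 2) - ρ n)
    have p2 := sn (θ (n + 3) - θ (n + 1))
    have p3 := sn (θ (n + 2) - θ n)
    have p4 := nn (ρ n)
    have p5 := nn (θ n)
    have p6 := nn (θ (n + 1))
    exact mul_le_mul_of_nonneg_right (by linarith) (by positivity)

/-- The sums θ^{n+1} + θ^n obey a step with forcing F^{n+1} + F^n, in which the alternating part of
ρ cancels up to τρ^n. With τρ^n and the one-step differences already O(τ² + h²), the recursion is of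
Grönwall type at that order. -/
theorem stepNorm_add_succ_le (S : ErrorSystem G K L T h τ N U P e ρ θ R) {n : ℕ}
    (hn : n + 1 < N) {C₂ C₄ B : ℝ} (hC₂ : 0 ≤ C₂) (hC₄ : 0 ≤ C₄) (hB : 0 ≤ B)
    (hF : seminormH1 h (errorForcing U P e ρ R (n + 1) + errorForcing U P e ρ R n)
      ≤ C₄ * (seminormH1 h (ρ (n + 1) + ρ n) + τ * seminormH1 h (ρ n) + seminormH1 h (θ n)
          + seminormH1 h (θ (n + 1)) + seminormH1 h (θ (n + 2)) + τ ^ 2 + h ^ 2))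
    (hρ : seminormH1 h (ρ (n + 1) + ρ n) ≤ C₂ * (seminormH1 h (θ (n + 1)) + τ ^ 2 + h ^ 2))
    (hρ' : τ * seminormH1 h (ρ n) ≤ B * (τ ^ 2 + h ^ 2))
    (h0 : seminormH1 h (θ n) ≤ stepNorm τ h (θ (n + 1) + θ n) + B * (τ ^ 2 + h ^ 2))
    (h1 : seminormH1 h (θ (n + 1)) ≤ stepNorm τ h (θ (n + 1) + θ n) + B * (τ ^ 2 + h ^ 2))
    (h2 : seminormH1 h (θ (n + 2)) ≤ stepNorm τ h (θ (n + 2) + θ (n + 1)) + B * (τ ^ 2 + h ^ 2)) :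
    stepNorm τ h (θ (n + 2) + θ (n + 1)) ≤ stepNorm τ h (θ (n + 1) + θ n)
      + C₄ * (C₂ * (B + 1) + 4 * B + 2) * τ * (stepNorm τ h (θ (n + 1) + θ n)
        + stepNorm τ h (θ (n + 2) + θ (n + 1)) + (τ ^ 2 + h ^ 2)) := by
  have hτ := S.τ_pos
  have a1 := stepNorm_le_of_step S.h_pos hτ.le ((S.θ_ends (n + 1) (by omega)).add
    (S.θ_ends n (by omega))) (S.step_add hn)
  have f0 := stepNorm_nonneg (h := h) τ (θ (n + 1) + θ n)
  have f1 := stepNorm_nonneg (h := h) τ (θ (n + 2) + θ (n + 1))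
  set f := stepNorm τ h (θ (n + 1) + θ n)
  set f' := stepNorm τ h (θ (n + 2) + θ (n + 1))
  set F := seminormH1 h (errorForcing U P e ρ R (n + 1) + errorForcing U P e ρ R n)
  have hq0 : 0 ≤ τ ^ 2 + h ^ 2 := by positivity
  set q := τ ^ 2 + h ^ 2 with hq
  set W := f + f' + q with hW
  have a2 : seminormH1 h (θ (n + 1)) + τ ^ 2 + h ^ 2 ≤ (B + 1) * W := by
    have : 0 ≤ B * (f + f') := by positivity
    linarith
  have a3 : C₂ * (seminormH1 h (θ (n + 1)) + τ ^ 2 + h ^ 2) ≤ C₂ * ((B + 1) * W) := by gcongr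
  have a4 : seminormH1 h (ρ (n + 1) + ρ n) + τ * seminormH1 h (ρ n) + seminormH1 h (θ n)
      + seminormH1 h (θ (n + 1)) + seminormH1 h (θ (n + 2)) + τ ^ 2 + h ^ 2
      ≤ (C₂ * (B + 1) + 4 * B + 2) * W := by
    have : 0 ≤ B * (f + f') := by positivity
    linarith
  have a5 : F ≤ C₄ * ((C₂ * (B + 1) + 4 * B + 2) * W) := hF.trans (by gcongr)
  have a6 := mul_le_mul_of_nonneg_left a5 hτ.le
  linarith

end ErrorSystem

set_option maxHeartbeats 400000 in
/-- Stability of the relaxation scheme: consistency implies convergence. -/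
theorem exists_error_bounds {G : ℂ → ℂ} (hG : ContDiff ℝ 3 G) {K L T : ℝ} (hK : 0 ≤ K)
    (hL : 0 < L) (hT : 0 < T) :
    ∃ ε > 0, ∃ C ≥ 0, ∀ (J N : ℕ) (h τ : ℝ) (U P e ρ θ R : ℕ → Grid J ℂ),
      ErrorSystem G K L T h τ N U P e ρ θ R → τ + h ^ 2 ≤ ε →
      (∀ n < N, seminormH1 h (ρ n) ≤ C * (τ + h ^ 2)) ∧
      ∀ n ≤ N, seminormH1 h (e n) ≤ C * (τ ^ 2 + h ^ 2) := by
  obtain ⟨C₁, hC₁, H1⟩ := exists_ρ_sub_le hG hK hL (T := T)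
  obtain ⟨C₂, hC₂, H2⟩ := exists_ρ_add_le hG hK hL (T := T)
  set C₀ := K * (1 + L) + √L + K + (K * (1 + L) + 2 * √L) * K with hC₀'
  set C₃ := 6 * K * (1 + L) * (1 + K) + 8 * √L * (1 + K) * (1 + L ^ 2) + K with hC₃'
  set C₄ := 4 * K * (1 + L) * (1 + K) + 4 * √L * (1 + K) + 2 * K with hC₄'
  have hC₀ : 0 ≤ C₀ := by positivity
  have hC₃ : 0 ≤ C₃ := by positivity
  have hC₄ : 0 ≤ C₄ := by positivity
  set C := 1 + (C₀ * (1 + T) + C₁ + C₂ * (1 + T) + C₃ + K) with hC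
  have hC1 : 1 ≤ C := by
    have : 0 ≤ C₀ * (1 + T) + C₁ + C₂ * (1 + T) + C₃ + K := by positivity
    linarith
  obtain ⟨ε, hε, B, hB, H⟩ := RelaxationRecursion.bounds T hC1
  set B' := B * (1 + T) with hB'
  have hB'0 : 0 ≤ B' := by positivity
  set D := C₄ * (C₂ * (B' + 1) + 4 * B' + 2) with hD
  have hD0 : 0 ≤ D := by positivity
  set X := Real.exp (4 * D * T) with hX
  have hX0 : 0 < X := Real.exp_pos _
  -- The second bound gives Dτ ≤ 1/4 for the Grönwall argument on the sums.
  refine ⟨min ε (1 / (4 * D + 1)), by positivity, B + X * (B' + 1) + B' + K, by positivity, ?_⟩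
  intro J N h τ U P e ρ θ R S hsmall
  have hh := S.h_pos
  have hτ := S.τ_pos
  have hτT := S.τ_le
  have hrec := S.recursion hC₀ hC₁ hC₂ hC₃ hT.le (C := C) (by linarith)
    (fun n hn => S.forcing_le hn) (H1 J N h τ U P e ρ θ R S) (H2 J N h τ U P e ρ θ R S)
    (fun n hn => S.forcing_sub_le hn)
  obtain ⟨hy, hr, hx⟩ := H τ (τ + h ^ 2) N _ _ _ _ _ _ hrec hτ S.mul_τ.le S.one_le
    (by linarith [sq_nonneg h]) (hsmall.trans (min_le_left _ _))
  have hDτ : D * τ ≤ 1 / 4 := by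
    have h1 := hsmall.trans (min_le_right _ _)
    rw [le_div_iff₀ (by positivity)] at h1
    have h2 : 0 ≤ h ^ 2 * (4 * D + 1) := by positivity
    clear_value D
    clear * - h1 h2 hτ
    linarith
  have nn := fun v : Grid J ℂ => seminormH1_nonneg (h := h) v
  have sn := fun v : Grid J ℂ => stepNorm_nonneg (h := h) τ v
  set q := τ ^ 2 + h ^ 2 with hq
  have hq0 : 0 ≤ q := by positivity
  have hτω : τ * (τ + h ^ 2) ≤ (1 + T) * q := by
    have h1 : τ * h ^ 2 ≤ T * h ^ 2 := by gcongr
    have h2 : 0 ≤ T * τ ^ 2 := by positivity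
    have h3 := sq_nonneg h
    rw [hq]
    clear * - h1 h2 h3
    linarith
  have hBq : B * (τ * (τ + h ^ 2)) ≤ B' * q := by
    calc _ ≤ B * ((1 + T) * q) := by gcongr
      _ = _ := by rw [hB']; ring
  have hEq : ∀ n < N, seminormH1 h (θ (n + 1) - θ n) ≤ B' * q := fun n hn =>
    (hr n hn).2.2.trans hBq
  set f : ℕ → ℝ := fun n => stepNorm τ h (θ (n + 1) + θ n) with hf
  -- θ^{n+1} and θ^n are half the sum plus or minus half the difference, and the difference is
  -- already O(τ² + h²).
  have hxf : ∀ n < N, seminormH1 h (θ (n + 1)) ≤ f n + B' * q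
      ∧ seminormH1 h (θ n) ≤ f n + B' * q := by
    intro n hn
    have h1 : seminormH1 h (θ (n + 1) + θ n) ≤ f n :=
      seminormH1_le_stepNorm hh τ ((S.θ_ends _ hn).add (S.θ_ends _ hn.le))
    have h2 := hEq n hn
    have h3 := seminormH1_add_le hh (θ (n + 1) + θ n) (θ (n + 1) - θ n)
    have h4 := seminormH1_sub_le hh (θ (n + 1) + θ n) (θ (n + 1) - θ n)
    have e3 : θ (n + 1) + θ n + (θ (n + 1) - θ n) = (2 : ℂ) • θ (n + 1) := by
      rw [two_smul]; abel
    have e4 : θ (n + 1) + θ n - (θ (n + 1) - θ n) = (2 : ℂ) • θ n := by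
      rw [two_smul]; abel
    rw [e3, seminormH1_smul hh, Complex.norm_ofNat] at h3
    rw [e4, seminormH1_smul hh, Complex.norm_ofNat] at h4
    have := nn (θ (n + 1))
    have := nn (θ n)
    constructor <;> linarith
  have hf0 : f 0 ≤ B' * q := by
    simp only [hf, S.θ_zero, zero_add, add_zero]
    exact hy.trans hBq
  have hstep : ∀ n < N - 1, f (n + 1) ≤ f n + D * τ * (f n + f (n + 1) + q) := by
    intro n hn
    have hn1 : n + 1 < N := by omega
    have a4 : τ * seminormH1 h (ρ n) ≤ B' * q := by
      have := mul_le_mul_of_nonneg_left (hr n (by omega)).1 hτ.le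
      linarith
    exact S.stepNorm_add_succ_le hn1 hC₂ hC₄ hB'0 (S.forcing_add_le hn1 (hr n (by omega)).2.1
      (hr (n + 1) hn1).2.1) (H2 J N h τ U P e ρ θ R S n hn1 (hx (n + 1) (by omega)).2) a4
      (hxf n (by omega)).2 (hxf n (by omega)).1 (hxf (n + 1) hn1).1
  have hcN : Real.exp (4 * (D * τ) * (N - 1 : ℕ)) ≤ X := by
    rw [hX]
    refine Real.exp_le_exp.2 ?_
    have : ((N - 1 : ℕ) : ℝ) ≤ N := by exact_mod_cast Nat.sub_le N 1
    calc 4 * (D * τ) * ((N - 1 : ℕ) : ℝ) ≤ 4 * (D * τ) * N := by gcongr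
      _ = 4 * D * (N * τ) := by ring
      _ ≤ _ := by rw [S.mul_τ]
  have hfb : ∀ n < N, f n + q ≤ X * (B' + 1) * q := by
    intro n hn
    have hfn : ∀ n, 0 ≤ f n := fun n => sn _
    have hDτ0 : 0 ≤ D * τ := mul_nonneg hD0 hτ.le
    clear_value f D X B' q
    -- The recursion for the sums holds unconditionally by now, so the threshold may be any
    -- admissible value; the Grönwall bound itself is taken.
    have g1 := implicit_gronwall (a := f) (b := q) (c := D * τ) hfn hq0 hDτ0 hDτ (N - 1) le_rfl
      (fun n hn _ => hstep n hn) n (by omega)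
    have g2 : f 0 + q ≤ B' * q + q := add_le_add hf0 le_rfl
    have g3 := mul_le_mul hcN g2 (add_nonneg (hfn 0) hq0) hX0.le
    calc _ ≤ X * (B' * q + q) := g1.trans g3
      _ = _ := by ring
  refine ⟨fun n hn => (hr n hn).1.trans ?_, fun n hn => ?_⟩
  · refine mul_le_mul_of_nonneg_right ?_ (by positivity)
    have : 0 ≤ X * (B' + 1) + B' + K := by positivity
    linarith
  · have hxn : seminormH1 h (θ n) ≤ X * (B' + 1) * q + B' * q := by
      rcases Nat.lt_or_ge n N with hd | hd
      · linarith [hfb n hd, (hxf n hd).2]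
      · obtain ⟨k, rfl⟩ : ∃ k, n = k + 1 := ⟨n - 1, by have := S.one_le; omega⟩
        linarith [hfb k (by omega), (hxf k (by omega)).1]
    have h1 := S.e_le hn
    have h2 : K * h ^ 2 ≤ K * q := by
      gcongr
      rw [hq]
      linarith [sq_nonneg τ]
    have h3 : 0 ≤ B * q := by positivity
    linarith

end Stability

/-! ### Taylor estimates with one-sided derivatives. -/

section Taylor

variable {a b M : ℝ} {φ φ₁ φ₂ φ₃ φ₄ : ℝ → ℂ}

theorem hasDerivWithinAt_comp_add {t s : ℝ} (h : ∀ x ∈ Icc a b, HasDerivWithinAt φ (φ₁ x) (Icc a b) x)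
    (ht : t ∈ Icc a b) (hts : t + s ∈ Icc a b) {σ : ℝ} (hσ : σ ∈ Icc 0 s) :
    HasDerivWithinAt (fun σ => φ (t + σ)) (φ₁ (t + σ)) (Icc 0 s) σ := by
  have hm : MapsTo (fun σ : ℝ => t + σ) (Icc 0 s) (Icc a b) := fun y hy =>
    ⟨by linarith [ht.1, hy.1], by linarith [hts.2, hy.2]⟩
  have h1 : HasDerivWithinAt (fun σ : ℝ => t + σ) 1 (Icc 0 s) σ :=
    ((hasDerivAt_id σ).const_add t).hasDerivWithinAt
  have h2 := (h _ (hm hσ)).scomp σ h1 hm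
  rw [one_smul] at h2
  exact h2

theorem hasDerivWithinAt_comp_sub {t s : ℝ} (h : ∀ x ∈ Icc a b, HasDerivWithinAt φ (φ₁ x) (Icc a b) x)
    (ht : t ∈ Icc a b) (hts : t - s ∈ Icc a b) {σ : ℝ} (hσ : σ ∈ Icc 0 s) :
    HasDerivWithinAt (fun σ => φ (t - σ)) (-φ₁ (t - σ)) (Icc 0 s) σ := by
  have hm : MapsTo (fun σ : ℝ => t - σ) (Icc 0 s) (Icc a b) := fun y hy =>
    ⟨by linarith [hts.1, hy.2], by linarith [ht.2, hy.1]⟩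
  have h1 : HasDerivWithinAt (fun σ : ℝ => t - σ) (-1) (Icc 0 s) σ :=
    ((hasDerivAt_id σ).const_sub t).hasDerivWithinAt
  have h2 := (h _ (hm hσ)).scomp σ h1 hm
  rw [neg_one_smul] at h2
  exact h2

theorem norm_sub_le_of_deriv (h : ∀ x ∈ Icc a b, HasDerivWithinAt φ (φ₁ x) (Icc a b) x)
    (hM : ∀ x ∈ Icc a b, ‖φ₁ x‖ ≤ M) {x y : ℝ} (hx : x ∈ Icc a b) (hy : y ∈ Icc a b) :
    ‖φ y - φ x‖ ≤ M * |y - x| :=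
  (convex_Icc a b).norm_image_sub_le_of_norm_hasDerivWithin_le h hM hx hy

/-- The mean value inequality in the offset σ: the derivative φ₁(t + σ) - φ₁(t - σ) is at most 2Mσ.
Constants here and below are not optimal. -/
theorem norm_second_diff_le (h : ∀ x ∈ Icc a b, HasDerivWithinAt φ (φ₁ x) (Icc a b) x)
    (h₁ : ∀ x ∈ Icc a b, HasDerivWithinAt φ₁ (φ₂ x) (Icc a b) x)
    (hM : ∀ x ∈ Icc a b, ‖φ₂ x‖ ≤ M) {t s : ℝ} (hs : 0 ≤ s) (hp : t + s ∈ Icc a b)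
    (hm : t - s ∈ Icc a b) :
    ‖φ (t + s) + φ (t - s) - 2 * φ t‖ ≤ 2 * M * s ^ 2 := by
  have ht : t ∈ Icc a b := ⟨by linarith [hm.1], by linarith [hp.2]⟩
  have hM0 : 0 ≤ M := (norm_nonneg _).trans (hM t ht)
  have key := norm_image_sub_le_of_norm_deriv_le_segment' (a := 0) (b := s)
    (f := fun σ => φ (t + σ) + φ (t - σ)) (f' := fun σ => φ₁ (t + σ) + -φ₁ (t - σ))
    (C := 2 * M * s)
    (fun σ hσ => (hasDerivWithinAt_comp_add h ht hp hσ).add (hasDerivWithinAt_comp_sub h ht hm hσ))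
    (fun σ hσ => by
      have h2 := norm_sub_le_of_deriv h₁ hM (x := t - σ) (y := t + σ)
        ⟨by linarith [hm.1, hσ.2], by linarith [ht.2, hσ.1]⟩
        ⟨by linarith [ht.1, hσ.1], by linarith [hp.2, hσ.2]⟩
      rw [show t + σ - (t - σ) = 2 * σ by ring, abs_of_nonneg (by linarith [hσ.1])] at h2
      rw [← sub_eq_add_neg]
      refine h2.trans ?_
      nlinarith [hσ.2])
    s ⟨hs, le_rfl⟩
  simp only [add_zero, sub_zero] at key
  rw [← two_mul] at key
  refine key.trans (le_of_eq (by ring))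

/-- The σ-derivative of the trapezoidal defect is half of φ₁(t + σ) - φ₁(t) - σφ₂(t + σ), and the
derivative of that is -σφ₃(t + σ). Two mean value inequalities give the third power. -/
theorem norm_trapezoid_le (h : ∀ x ∈ Icc a b, HasDerivWithinAt φ (φ₁ x) (Icc a b) x)
    (h₁ : ∀ x ∈ Icc a b, HasDerivWithinAt φ₁ (φ₂ x) (Icc a b) x)
    (h₂ : ∀ x ∈ Icc a b, HasDerivWithinAt φ₂ (φ₃ x) (Icc a b) x)
    (hM : ∀ x ∈ Icc a b, ‖φ₃ x‖ ≤ M) {t s : ℝ} (hs : 0 ≤ s) (ht : t ∈ Icc a b)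
    (hp : t + s ∈ Icc a b) :
    ‖φ (t + s) - φ t - (s / 2 : ℂ) * (φ₁ (t + s) + φ₁ t)‖ ≤ M * s ^ 3 := by
  have hM0 : 0 ≤ M := (norm_nonneg _).trans (hM t ht)
  have hmem : ∀ σ ∈ Icc 0 s, t + σ ∈ Icc a b := fun σ hσ =>
    ⟨by linarith [ht.1, hσ.1], by linarith [hp.2, hσ.2]⟩
  have hl : ∀ σ : ℝ, HasDerivWithinAt (fun σ : ℝ => (σ / 2 : ℂ)) (1 / 2) (Icc 0 s) σ := fun σ => by
    simpa using ((Complex.ofRealCLM.hasDerivAt (x := σ)).div_const 2).hasDerivWithinAt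
  have inner : ∀ σ ∈ Icc 0 s, ‖φ₁ (t + σ) - φ₁ t - (σ : ℂ) * φ₂ (t + σ)‖ ≤ M * s ^ 2 := by
    intro σ hσ
    have key := norm_image_sub_le_of_norm_deriv_le_segment' (a := 0) (b := s)
      (f := fun σ : ℝ => φ₁ (t + σ) - (σ : ℂ) * φ₂ (t + σ))
      (f' := fun σ : ℝ => φ₂ (t + σ) - (1 * φ₂ (t + σ) + (σ : ℂ) * φ₃ (t + σ))) (C := M * s)
      (fun σ hσ => (hasDerivWithinAt_comp_add h₁ ht hp hσ).sub
        ((Complex.ofRealCLM.hasDerivAt (x := σ)).hasDerivWithinAt.mul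
          (hasDerivWithinAt_comp_add h₂ ht hp hσ)))
      (fun σ hσ => by
        have e : φ₂ (t + σ) - (1 * φ₂ (t + σ) + (σ : ℂ) * φ₃ (t + σ)) = -((σ : ℂ) * φ₃ (t + σ)) := by
          ring
        rw [e, norm_neg, norm_mul, Complex.norm_real, Real.norm_of_nonneg hσ.1, mul_comm]
        exact mul_le_mul (hM _ (hmem σ (Ico_subset_Icc_self hσ))) hσ.2.le hσ.1 hM0)
      σ hσ
    simp only [add_zero, Complex.ofReal_zero, zero_mul, sub_zero] at key
    rw [sub_right_comm]
    refine key.trans ?_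
    rw [pow_two, ← mul_assoc]
    exact mul_le_mul_of_nonneg_left hσ.2 (by positivity)
  have key := norm_image_sub_le_of_norm_deriv_le_segment' (a := 0) (b := s)
    (f := fun σ : ℝ => φ (t + σ) - (σ / 2 : ℂ) * (φ₁ (t + σ) + φ₁ t))
    (f' := fun σ : ℝ => φ₁ (t + σ) - (1 / 2 * (φ₁ (t + σ) + φ₁ t) + (σ / 2 : ℂ) * φ₂ (t + σ)))
    (C := M * s ^ 2)
    (fun σ hσ => (hasDerivWithinAt_comp_add h ht hp hσ).sub
      ((hl σ).mul ((hasDerivWithinAt_comp_add h₁ ht hp hσ).add_const _)))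
    (fun σ hσ => by
      have e : φ₁ (t + σ) - (1 / 2 * (φ₁ (t + σ) + φ₁ t) + (σ / 2 : ℂ) * φ₂ (t + σ))
          = (1 / 2 : ℂ) * (φ₁ (t + σ) - φ₁ t - (σ : ℂ) * φ₂ (t + σ)) := by ring
      rw [e, norm_mul]
      have h3 := inner σ (Ico_subset_Icc_self hσ)
      have : ‖(1 / 2 : ℂ)‖ = 1 / 2 := by norm_num
      rw [this]
      have : 0 ≤ M * s ^ 2 := by positivity
      linarith)
    s ⟨hs, le_rfl⟩
  simp only [add_zero, Complex.ofReal_zero, zero_div, zero_mul, sub_zero] at key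
  rw [sub_right_comm]
  refine key.trans (le_of_eq (by ring))

/-- Differentiating twice in σ turns the defect into the symmetric second difference of φ₂, to which
`norm_second_diff_le` applies. -/
theorem norm_laplacian_defect_le (h : ∀ x ∈ Icc a b, HasDerivWithinAt φ (φ₁ x) (Icc a b) x)
    (h₁ : ∀ x ∈ Icc a b, HasDerivWithinAt φ₁ (φ₂ x) (Icc a b) x)
    (h₂ : ∀ x ∈ Icc a b, HasDerivWithinAt φ₂ (φ₃ x) (Icc a b) x)
    (h₃ : ∀ x ∈ Icc a b, HasDerivWithinAt φ₃ (φ₄ x) (Icc a b) x)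
    (hM : ∀ x ∈ Icc a b, ‖φ₄ x‖ ≤ M) {t s : ℝ} (hs : 0 ≤ s) (hp : t + s ∈ Icc a b)
    (hm : t - s ∈ Icc a b) :
    ‖φ (t - s) - 2 * φ t + φ (t + s) - (s : ℂ) ^ 2 * φ₂ t‖ ≤ 2 * M * s ^ 4 := by
  have ht : t ∈ Icc a b := ⟨by linarith [hm.1], by linarith [hp.2]⟩
  have hM0 : 0 ≤ M := (norm_nonneg _).trans (hM t ht)
  have hq : ∀ σ : ℝ, HasDerivWithinAt (fun σ : ℝ => (σ : ℂ) ^ 2) (2 * σ) (Icc 0 s) σ := fun σ => by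
    have := ((Complex.ofRealCLM.hasDerivAt (x := σ)).pow 2).hasDerivWithinAt (s := Icc 0 s)
    exact this.congr_deriv (by simp)
  have hl : ∀ σ : ℝ, HasDerivWithinAt (fun σ : ℝ => 2 * (σ : ℂ)) 2 (Icc 0 s) σ := fun σ => by
    have := ((Complex.ofRealCLM.hasDerivAt (x := σ)).const_mul 2).hasDerivWithinAt (s := Icc 0 s)
    simpa using this
  have inner : ∀ σ ∈ Icc 0 s, ‖φ₁ (t + σ) - φ₁ (t - σ) - 2 * (σ : ℂ) * φ₂ t‖ ≤ 2 * M * s ^ 3 := by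
    intro σ hσ
    have key := norm_image_sub_le_of_norm_deriv_le_segment' (a := 0) (b := s)
      (f := fun σ : ℝ => φ₁ (t + σ) - φ₁ (t - σ) - 2 * (σ : ℂ) * φ₂ t)
      (f' := fun σ : ℝ => φ₂ (t + σ) - -φ₂ (t - σ) - 2 * φ₂ t) (C := 2 * M * s ^ 2)
      (fun σ hσ => ((hasDerivWithinAt_comp_add h₁ ht hp hσ).sub
        (hasDerivWithinAt_comp_sub h₁ ht hm hσ)).sub ((hl σ).mul_const _))
      (fun σ hσ => by
        rw [sub_neg_eq_add]
        refine (norm_second_diff_le h₂ h₃ hM hσ.1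
          ⟨by linarith [ht.1, hσ.1], by linarith [hp.2, hσ.2]⟩
          ⟨by linarith [hm.1, hσ.2], by linarith [ht.2, hσ.1]⟩).trans ?_
        have := hσ.1
        gcongr
        exact hσ.2.le)
      σ hσ
    simp only [add_zero, Complex.ofReal_zero, mul_zero, zero_mul, sub_zero, sub_self] at key
    refine key.trans ?_
    have : 2 * M * s ^ 2 * σ ≤ 2 * M * s ^ 2 * s := by
      have := hσ.2
      gcongr
    linarith
  have key := norm_image_sub_le_of_norm_deriv_le_segment' (a := 0) (b := s)
    (f := fun σ : ℝ => φ (t + σ) + φ (t - σ) - (σ : ℂ) ^ 2 * φ₂ t)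
    (f' := fun σ : ℝ => φ₁ (t + σ) + -φ₁ (t - σ) - 2 * σ * φ₂ t) (C := 2 * M * s ^ 3)
    (fun σ hσ => ((hasDerivWithinAt_comp_add h ht hp hσ).add
      (hasDerivWithinAt_comp_sub h ht hm hσ)).sub ((hq σ).mul_const _))
    (fun σ hσ => by
      rw [← sub_eq_add_neg]
      exact inner σ (Ico_subset_Icc_self hσ))
    s ⟨hs, le_rfl⟩
  simp only [add_zero, Complex.ofReal_zero, sub_zero, ne_eq, OfNat.ofNat_ne_zero,
    not_false_eq_true, zero_pow, zero_mul] at key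
  have e : φ (t - s) - 2 * φ t + φ (t + s) - (s : ℂ) ^ 2 * φ₂ t
      = φ (t + s) + φ (t - s) - (s : ℂ) ^ 2 * φ₂ t - (φ t + φ t) := by ring
  rw [e]
  refine key.trans (le_of_eq (by ring))

end Taylor

/-! ### Partial derivatives on the closed cylinder. -/

section Partial

variable {T xa xb : ℝ} {F : ℝ × ℝ → ℂ}

/-- The partial derivative in time on the cylinder. -/
def timeDeriv (T xa xb : ℝ) (F : ℝ × ℝ → ℂ) (p : ℝ × ℝ) : ℂ :=
  fderivWithin ℝ F (cylinder T xa xb) p (1, 0)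

/-- The partial derivative in space on the cylinder. -/
def spaceDeriv (T xa xb : ℝ) (F : ℝ × ℝ → ℂ) (p : ℝ × ℝ) : ℂ :=
  fderivWithin ℝ F (cylinder T xa xb) p (0, 1)

theorem uniqueDiffOn_cylinder (hT : 0 < T) (hx : xa < xb) :
    UniqueDiffOn ℝ (cylinder T xa xb) :=
  (uniqueDiffOn_Icc hT).prod (uniqueDiffOn_Icc hx)

theorem contDiffOn_timeDeriv (hT : 0 < T) (hx : xa < xb) {m n : ℕ} (hmn : m + 1 ≤ n)
    (hF : ContDiffOn ℝ n F (cylinder T xa xb)) :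
    ContDiffOn ℝ m (timeDeriv T xa xb F) (cylinder T xa xb) :=
  (hF.fderivWithin (uniqueDiffOn_cylinder hT hx) (by exact_mod_cast hmn)).clm_apply
    contDiffOn_const

theorem contDiffOn_spaceDeriv (hT : 0 < T) (hx : xa < xb) {m n : ℕ} (hmn : m + 1 ≤ n)
    (hF : ContDiffOn ℝ n F (cylinder T xa xb)) :
    ContDiffOn ℝ m (spaceDeriv T xa xb F) (cylinder T xa xb) :=
  (hF.fderivWithin (uniqueDiffOn_cylinder hT hx) (by exact_mod_cast hmn)).clm_apply
    contDiffOn_const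

theorem hasDerivWithinAt_timeDeriv {n : ℕ} (hn : 1 ≤ n)
    (hF : ContDiffOn ℝ n F (cylinder T xa xb)) {x : ℝ} (hx : x ∈ Icc xa xb) :
    ∀ t ∈ Icc 0 T, HasDerivWithinAt (fun s => F (s, x)) (timeDeriv T xa xb F (t, x)) (Icc 0 T) t := by
  intro t ht
  have h1 := ((hF.differentiableOn (by exact_mod_cast (by omega : n ≠ 0))) (t, x)
    ⟨ht, hx⟩).hasFDerivWithinAt
  exact h1.comp_hasDerivWithinAt t
    ((hasDerivWithinAt_id t (Icc 0 T)).prodMk (hasDerivWithinAt_const t (Icc 0 T) x))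
    (fun s hs => mk_mem_prod hs hx)

theorem hasDerivWithinAt_spaceDeriv {n : ℕ} (hn : 1 ≤ n)
    (hF : ContDiffOn ℝ n F (cylinder T xa xb)) {t : ℝ} (ht : t ∈ Icc 0 T) :
    ∀ x ∈ Icc xa xb,
      HasDerivWithinAt (fun y => F (t, y)) (spaceDeriv T xa xb F (t, x)) (Icc xa xb) x := by
  intro x hx
  have h1 := ((hF.differentiableOn (by exact_mod_cast (by omega : n ≠ 0))) (t, x)
    ⟨ht, hx⟩).hasFDerivWithinAt
  exact h1.comp_hasDerivWithinAt x
    ((hasDerivWithinAt_const x (Icc xa xb) t).prodMk (hasDerivWithinAt_id x (Icc xa xb)))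
    (fun s hs => mk_mem_prod ht hs)

theorem exists_bound_on_cylinder {n : ℕ} (hF : ContDiffOn ℝ n F (cylinder T xa xb)) :
    ∃ K, ∀ p ∈ cylinder T xa xb, ‖F p‖ ≤ K :=
  (isCompact_Icc.prod isCompact_Icc).exists_bound_of_continuousOn hF.continuousOn

end Partial

/-! ### Grid values of smooth functions. -/

section TameGrids

variable {T xa xb : ℝ} {F : ℝ × ℝ → ℂ} {J : ℕ} {K : ℝ}

/-- The grid function with the values of `F (t, ·)` at the nodes. -/
def sample (xa xb : ℝ) (J : ℕ) (F : ℝ × ℝ → ℂ) (t : ℝ) : Grid J ℂ := fun j => F (t, node xa xb J j)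

theorem meshWidth_pos (hx : xa < xb) : 0 < meshWidth xa xb J :=
  div_pos (by linarith) (by positivity)

theorem meshWidth_mul : meshWidth xa xb J * (J + 1) = xb - xa := by
  rw [meshWidth]
  field_simp

theorem node_mem (hx : xa < xb) (j : Fin (J + 2)) : node xa xb J j ∈ Icc xa xb := by
  have h1 := meshWidth_pos (J := J) hx
  have h2 : ((j : ℕ) : ℝ) ≤ J + 1 := by exact_mod_cast (by omega : (j : ℕ) ≤ J + 1)
  have h3 := meshWidth_mul (xa := xa) (xb := xb) (J := J)
  refine ⟨?_, ?_⟩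
  · rw [node]
    have : 0 ≤ ((j : ℕ) : ℝ) * meshWidth xa xb J := by positivity
    linarith
  · rw [node]
    nlinarith

theorem node_succ_sub (j : Fin (J + 1)) :
    node xa xb J j.succ - node xa xb J j.castSucc = meshWidth xa xb J := by
  simp only [node, Fin.val_succ, Fin.val_castSucc]
  push_cast
  ring

theorem tame_sample (hx : xa < xb) {n : ℕ} (hn : 1 ≤ n) (hF : ContDiffOn ℝ n F (cylinder T xa xb))
    (h0 : ∀ p ∈ cylinder T xa xb, ‖F p‖ ≤ K)
    (h1 : ∀ p ∈ cylinder T xa xb, ‖spaceDeriv T xa xb F p‖ ≤ K) {t : ℝ} (ht : t ∈ Icc 0 T) :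
    Tame K (meshWidth xa xb J) (sample xa xb J F t) := by
  refine ⟨fun j => h0 _ ⟨ht, node_mem hx j⟩, fun j => ?_⟩
  have := norm_sub_le_of_deriv (hasDerivWithinAt_spaceDeriv hn hF ht)
    (fun x hx' => h1 _ ⟨ht, hx'⟩) (node_mem hx j.castSucc) (node_mem hx j.succ)
  rwa [node_succ_sub, abs_of_pos (meshWidth_pos hx)] at this

/-- For the increments, the scalar time estimate is applied to the difference of F at two adjacent
nodes, whose time derivative is at most Kh by `tame_sample` for the time derivative. Only the space
derivative of time derivatives is used, so mixed partials never have to be interchanged; the next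
two lemmas work likewise. -/
theorem tame_sample_sub (hT : 0 < T) (hx : xa < xb) {n : ℕ} (hn : 2 ≤ n)
    (hF : ContDiffOn ℝ n F (cylinder T xa xb))
    (h0 : ∀ p ∈ cylinder T xa xb, ‖timeDeriv T xa xb F p‖ ≤ K)
    (h1 : ∀ p ∈ cylinder T xa xb, ‖spaceDeriv T xa xb (timeDeriv T xa xb F) p‖ ≤ K)
    {t s : ℝ} (ht : t ∈ Icc 0 T) (hs : s ∈ Icc 0 T) :
    Tame (K * |t - s|) (meshWidth xa xb J) (sample xa xb J F t - sample xa xb J F s) := by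
  have hd := fun j : Fin (J + 2) =>
    hasDerivWithinAt_timeDeriv (by omega) hF (node_mem (J := J) hx j)
  have htame := fun t (ht : t ∈ Icc 0 T) => tame_sample (J := J) hx le_rfl
    (contDiffOn_timeDeriv hT hx (m := 1) hn hF) h0 h1 ht
  refine ⟨fun j => norm_sub_le_of_deriv (hd j) (fun t ht => (htame t ht).1 j) hs ht, fun j => ?_⟩
  have := norm_sub_le_of_deriv (fun t ht => (hd j.succ t ht).sub (hd j.castSucc t ht))
    (fun t ht => (htame t ht).2 j) hs ht
  rw [mul_right_comm]
  refine le_trans (le_of_eq ?_) this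
  congr 1
  simp only [Pi.sub_apply, sample]
  ring

theorem tame_sample_second_diff (hT : 0 < T) (hx : xa < xb) {n : ℕ} (hn : 3 ≤ n)
    (hF : ContDiffOn ℝ n F (cylinder T xa xb))
    (h0 : ∀ p ∈ cylinder T xa xb, ‖timeDeriv T xa xb (timeDeriv T xa xb F) p‖ ≤ K)
    (h1 : ∀ p ∈ cylinder T xa xb,
      ‖spaceDeriv T xa xb (timeDeriv T xa xb (timeDeriv T xa xb F)) p‖ ≤ K)
    {t s : ℝ} (hs : 0 ≤ s) (hp : t + s ∈ Icc 0 T) (hm : t - s ∈ Icc 0 T) :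
    Tame (2 * K * s ^ 2) (meshWidth xa xb J)
      (sample xa xb J F (t + s) + sample xa xb J F (t - s) - (2 : ℂ) • sample xa xb J F t) := by
  have hF1 := contDiffOn_timeDeriv hT hx (m := 2) hn hF
  have hd := fun j : Fin (J + 2) =>
    hasDerivWithinAt_timeDeriv (by omega) hF (node_mem (J := J) hx j)
  have hd1 := fun j : Fin (J + 2) =>
    hasDerivWithinAt_timeDeriv (by omega) hF1 (node_mem (J := J) hx j)
  have htame := fun t (ht : t ∈ Icc 0 T) => tame_sample (J := J) hx le_rfl
    (contDiffOn_timeDeriv hT hx (m := 1) le_rfl hF1) h0 h1 ht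
  refine ⟨fun j => norm_second_diff_le (hd j) (hd1 j) (fun t ht => (htame t ht).1 j) hs hp hm,
    fun j => ?_⟩
  have := norm_second_diff_le (fun t ht => (hd j.succ t ht).sub (hd j.castSucc t ht))
    (fun t ht => (hd1 j.succ t ht).sub (hd1 j.castSucc t ht))
    (fun t ht => (htame t ht).2 j) hs hp hm
  refine (le_of_eq ?_).trans (this.trans (le_of_eq (by ring)))
  congr 1
  simp only [Pi.sub_apply, Pi.add_apply, Pi.smul_apply, smul_eq_mul, sample]
  ring

theorem tame_sample_trapezoid (hT : 0 < T) (hx : xa < xb) {n : ℕ} (hn : 4 ≤ n)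
    (hF : ContDiffOn ℝ n F (cylinder T xa xb))
    (h0 : ∀ p ∈ cylinder T xa xb,
      ‖timeDeriv T xa xb (timeDeriv T xa xb (timeDeriv T xa xb F)) p‖ ≤ K)
    (h1 : ∀ p ∈ cylinder T xa xb,
      ‖spaceDeriv T xa xb (timeDeriv T xa xb (timeDeriv T xa xb (timeDeriv T xa xb F))) p‖ ≤ K)
    {t s : ℝ} (hs : 0 ≤ s) (ht : t ∈ Icc 0 T) (hp : t + s ∈ Icc 0 T) :
    Tame (K * s ^ 3) (meshWidth xa xb J)
      (sample xa xb J F (t + s) - sample xa xb J F t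
        - (s / 2 : ℂ) • (sample xa xb J (timeDeriv T xa xb F) (t + s)
          + sample xa xb J (timeDeriv T xa xb F) t)) := by
  have hF1 := contDiffOn_timeDeriv hT hx (m := 3) hn hF
  have hF2 := contDiffOn_timeDeriv hT hx (m := 2) le_rfl hF1
  have hd := fun j : Fin (J + 2) =>
    hasDerivWithinAt_timeDeriv (by omega) hF (node_mem (J := J) hx j)
  have hd1 := fun j : Fin (J + 2) =>
    hasDerivWithinAt_timeDeriv (by omega) hF1 (node_mem (J := J) hx j)
  have hd2 := fun j : Fin (J + 2) =>
    hasDerivWithinAt_timeDeriv (by omega) hF2 (node_mem (J := J) hx j)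
  have htame := fun t (ht : t ∈ Icc 0 T) => tame_sample (J := J) hx le_rfl
    (contDiffOn_timeDeriv hT hx (m := 1) le_rfl hF2) h0 h1 ht
  refine ⟨fun j => norm_trapezoid_le (hd j) (hd1 j) (hd2 j) (fun t ht => (htame t ht).1 j) hs ht hp,
    fun j => ?_⟩
  have := norm_trapezoid_le (fun t ht => (hd j.succ t ht).sub (hd j.castSucc t ht))
    (fun t ht => (hd1 j.succ t ht).sub (hd1 j.castSucc t ht))
    (fun t ht => (hd2 j.succ t ht).sub (hd2 j.castSucc t ht))
    (fun t ht => (htame t ht).2 j) hs ht hp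
  refine (le_of_eq ?_).trans (this.trans (le_of_eq (by ring)))
  congr 1
  simp only [Pi.sub_apply, Pi.add_apply, Pi.smul_apply, smul_eq_mul, sample]
  ring

end TameGrids

/-! ### The error of the discrete elliptic projection. -/

section EllipticProjection

variable {T xa xb : ℝ} {J : ℕ}

theorem node_zero : node xa xb J 0 = xa := by simp [node]

theorem node_last : node xa xb J (Fin.last (J + 1)) = xb := by
  have := meshWidth_mul (xa := xa) (xb := xb) (J := J)
  simp only [node, Fin.val_last]
  push_cast
  linarith

theorem interior_or_end (j : Fin (J + 2)) :
    (0 < (j : ℕ) ∧ (j : ℕ) < J + 1) ∨ j = 0 ∨ j = Fin.last (J + 1) := by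
  rcases Nat.eq_zero_or_pos (j : ℕ) with h0 | h0
  · exact Or.inr (Or.inl (Fin.ext h0))
  · rcases Nat.lt_or_ge (j : ℕ) (J + 1) with h1 | h1
    · exact Or.inl ⟨h0, h1⟩
    · exact Or.inr (Or.inr (Fin.ext (by simp only [Fin.val_last]; omega)))

theorem interpZero_sub (z₁ z₂ : ℝ → ℂ) :
    interpZero xa xb J (fun x => z₁ x - z₂ x) = interpZero xa xb J z₁ - interpZero xa xb J z₂ := by
  ext j
  simp only [interpZero, Pi.sub_apply]
  split_ifs <;> simp

theorem interpZero_congr (hx : xa < xb) {z₁ z₂ : ℝ → ℂ} (h : ∀ x ∈ Icc xa xb, z₁ x = z₂ x) :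
    interpZero xa xb J z₁ = interpZero xa xb J z₂ := by
  ext j
  simp only [interpZero, h _ (node_mem hx j)]

/-- The discrete `H¹` error of the elliptic projection. -/
theorem seminormH1_sub_projection_le (hx : xa < xb) {φ φ₁ φ₂ φ₃ φ₄ : ℝ → ℂ} {M : ℝ}
    (h : ∀ x ∈ Icc xa xb, HasDerivWithinAt φ (φ₁ x) (Icc xa xb) x)
    (h₁ : ∀ x ∈ Icc xa xb, HasDerivWithinAt φ₁ (φ₂ x) (Icc xa xb) x)
    (h₂ : ∀ x ∈ Icc xa xb, HasDerivWithinAt φ₂ (φ₃ x) (Icc xa xb) x)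
    (h₃ : ∀ x ∈ Icc xa xb, HasDerivWithinAt φ₃ (φ₄ x) (Icc xa xb) x)
    (hM : ∀ x ∈ Icc xa xb, ‖φ₄ x‖ ≤ M) {v w : Grid J ℂ} (hv : ∀ j, v j = φ (node xa xb J j))
    (hvw : VanishesAtEnds (v - w))
    (hw : discreteLaplacian (meshWidth xa xb J) w = interpZero xa xb J φ₂) :
    seminormH1 (meshWidth xa xb J) (v - w)
      ≤ 4 * (xb - xa) * √(xb - xa) * M * meshWidth xa xb J ^ 2 := by
  have hh := meshWidth_pos (J := J) hx
  have hM0 : 0 ≤ M := (norm_nonneg _).trans (hM xa ⟨le_rfl, hx.le⟩)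
  -- At interior nodes Δ_h(v - w) is the consistency error of the second difference quotient,
  -- because Δ_h w was prescribed as φ₂.
  have key := seminormH1_le_of_discreteLaplacian_le hh hvw
    (A := 2 * M * meshWidth xa xb J ^ 2) (fun j => by
      rw [discreteLaplacian_sub, Pi.sub_apply, hw]
      by_cases hj : 0 < (j : ℕ) ∧ (j : ℕ) < J + 1
      · have h4 := norm_laplacian_defect_le h h₁ h₂ h₃ hM (t := node xa xb J j)
          (s := meshWidth xa xb J) hh.le (by
            have : node xa xb J j + meshWidth xa xb J = node xa xb J ⟨j + 1, by omega⟩ := by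
              simp only [node]; push_cast; ring
            rw [this]
            exact node_mem hx _) (by
            have : node xa xb J j - meshWidth xa xb J = node xa xb J ⟨j - 1, by omega⟩ := by
              simp only [node]; push_cast [Nat.cast_sub hj.1]; ring
            rw [this]
            exact node_mem hx _)
        simp only [discreteLaplacian, interpZero, dif_pos hj, if_pos hj, hv]
        have e1 : node xa xb J j + meshWidth xa xb J = node xa xb J ⟨j + 1, by omega⟩ := by
          simp only [node]; push_cast; ring
        have e2 : node xa xb J j - meshWidth xa xb J = node xa xb J ⟨j - 1, by omega⟩ := by
          simp only [node]; push_cast [Nat.cast_sub hj.1]; ring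
        rw [e1, e2] at h4
        have hc : (meshWidth xa xb J : ℂ) ≠ 0 := by exact_mod_cast hh.ne'
        rw [div_sub' (pow_ne_zero 2 hc), norm_div, div_le_iff₀ (norm_pos_iff.2 (pow_ne_zero 2 hc))]
        refine h4.trans (le_of_eq ?_)
        rw [norm_pow, Complex.norm_real, Real.norm_of_nonneg hh.le]
        ring
      · simp only [discreteLaplacian, interpZero, dif_neg hj, if_neg hj, sub_zero, norm_zero]
        positivity)
  rw [meshWidth_mul] at key
  exact key.trans (le_of_eq (by ring))

/-- Identifies W⁰ with the projection of the exact solution at time 0, so that θ⁰ = 0. -/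
theorem isEllipticProjection_unique (hx : xa < xb) {v : ℝ → ℂ} {w₁ w₂ : Grid J ℂ}
    (h₁ : IsEllipticProjection xa xb J v w₁) (h₂ : IsEllipticProjection xa xb J v w₂) :
    w₁ = w₂ := by
  have hh := meshWidth_pos (J := J) hx
  have hv : VanishesAtEnds (w₁ - w₂) := h₁.1.sub h₂.1
  have h0 := seminormH1_le_of_discreteLaplacian_le hh hv (A := 0) (fun j => by
    rw [discreteLaplacian_sub, h₁.2, h₂.2, sub_self]
    simp)
  rw [mul_zero] at h0
  have h1 := le_antisymm h0 (seminormH1_nonneg _)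
  ext j
  have := norm_le_seminormH1 hh hv.1 j
  rw [h1, mul_zero] at this
  exact sub_eq_zero.1 (norm_le_zero_iff.1 this)

variable {F : ℝ × ℝ → ℂ}

theorem iteratedDerivWithin_two_eq (hT : 0 < T) (hx : xa < xb) {n : ℕ} (hn : 2 ≤ n)
    (hF : ContDiffOn ℝ n F (cylinder T xa xb)) {t : ℝ} (ht : t ∈ Icc 0 T) :
    ∀ x ∈ Icc xa xb, iteratedDerivWithin 2 (fun y => F (t, y)) (Icc xa xb) x
      = spaceDeriv T xa xb (spaceDeriv T xa xb F) (t, x) := by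
  intro x hx'
  have hu := uniqueDiffOn_Icc hx
  rw [iteratedDerivWithin_succ, iteratedDerivWithin_one]
  have e : ∀ y ∈ Icc xa xb, derivWithin (fun y => F (t, y)) (Icc xa xb) y
      = spaceDeriv T xa xb F (t, y) := fun y hy =>
    (hasDerivWithinAt_spaceDeriv (by omega) hF ht y hy).derivWithin (hu y hy)
  have hF1 := contDiffOn_spaceDeriv hT hx (m := 1) hn hF
  exact ((hasDerivWithinAt_spaceDeriv le_rfl hF1 ht x hx').congr e (e x hx')).derivWithin (hu x hx')

/-- Bounds for the errors of the elliptic projections at several time levels. -/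
theorem exists_projection_bounds (hT : 0 < T) (hx : xa < xb)
    (hF : ContDiffOn ℝ 6 F (cylinder T xa xb))
    (hF0 : ∀ t ∈ Icc 0 T, F (t, xa) = 0 ∧ F (t, xb) = 0) :
    ∃ C ≥ 0, ∀ (J : ℕ) (w : ℝ → Grid J ℂ),
      (∀ t ∈ Icc 0 T, IsEllipticProjection xa xb J (fun x => F (t, x)) (w t)) →
      (∀ t ∈ Icc 0 T, VanishesAtEnds (sample xa xb J F t - w t) ∧
        seminormH1 (meshWidth xa xb J) (sample xa xb J F t - w t)
          ≤ C * meshWidth xa xb J ^ 2) ∧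
      (∀ t ∈ Icc 0 T, ∀ s ∈ Icc 0 T, seminormH1 (meshWidth xa xb J)
        ((sample xa xb J F t - w t) - (sample xa xb J F s - w s))
          ≤ C * (|t - s| * meshWidth xa xb J ^ 2)) ∧
      (∀ t s, 0 ≤ s → t + s ∈ Icc 0 T → t - s ∈ Icc 0 T → seminormH1 (meshWidth xa xb J)
        (((sample xa xb J F (t + s) - w (t + s)) - (sample xa xb J F t - w t))
          - ((sample xa xb J F t - w t) - (sample xa xb J F (t - s) - w (t - s))))
          ≤ C * (s ^ 2 * meshWidth xa xb J ^ 2)) := by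
  set F1 := spaceDeriv T xa xb F
  set F2 := spaceDeriv T xa xb F1 with hF2'
  set F3 := spaceDeriv T xa xb F2
  set F4 := spaceDeriv T xa xb F3
  have c1 : ContDiffOn ℝ (5 : ℕ) F1 (cylinder T xa xb) :=
    contDiffOn_spaceDeriv hT hx (n := 6) le_rfl hF
  have c2 : ContDiffOn ℝ (4 : ℕ) F2 (cylinder T xa xb) :=
    contDiffOn_spaceDeriv hT hx le_rfl c1
  have c3 : ContDiffOn ℝ (3 : ℕ) F3 (cylinder T xa xb) :=
    contDiffOn_spaceDeriv hT hx le_rfl c2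
  have c4 : ContDiffOn ℝ (2 : ℕ) F4 (cylinder T xa xb) :=
    contDiffOn_spaceDeriv hT hx le_rfl c3
  have c5 : ContDiffOn ℝ (1 : ℕ) (timeDeriv T xa xb F4) (cylinder T xa xb) :=
    contDiffOn_timeDeriv hT hx le_rfl c4
  have c6 : ContDiffOn ℝ (0 : ℕ) (timeDeriv T xa xb (timeDeriv T xa xb F4)) (cylinder T xa xb) :=
    contDiffOn_timeDeriv hT hx le_rfl c5
  obtain ⟨K0, hK0⟩ := exists_bound_on_cylinder c4
  obtain ⟨K1, hK1⟩ := exists_bound_on_cylinder c5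
  obtain ⟨K2, hK2⟩ := exists_bound_on_cylinder c6
  have hp : ((0 : ℝ), xa) ∈ cylinder T xa xb := ⟨⟨le_rfl, hT.le⟩, ⟨le_rfl, hx.le⟩⟩
  have p0 : 0 ≤ K0 := (norm_nonneg _).trans (hK0 _ hp)
  have p1 : 0 ≤ K1 := (norm_nonneg _).trans (hK1 _ hp)
  have p2 : 0 ≤ K2 := (norm_nonneg _).trans (hK2 _ hp)
  have hL : 0 < xb - xa := by linarith
  set c := 4 * (xb - xa) * √(xb - xa) with hc
  have hc0 : 0 ≤ c := by positivity
  refine ⟨c * (K0 + K1 + 2 * K2), by positivity, fun J w hw => ?_⟩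
  have hh := meshWidth_pos (J := J) hx
  have ends : ∀ t ∈ Icc 0 T, VanishesAtEnds (sample xa xb J F t - w t) := by
    intro t ht
    refine VanishesAtEnds.sub ⟨?_, ?_⟩ (hw t ht).1
    · simpa [sample, node_zero] using (hF0 t ht).1
    · simpa [sample, node_last] using (hF0 t ht).2
  have lap : ∀ t ∈ Icc 0 T, discreteLaplacian (meshWidth xa xb J) (w t)
      = interpZero xa xb J (fun x => F2 (t, x)) := by
    intro t ht
    rw [(hw t ht).2]
    exact interpZero_congr hx (iteratedDerivWithin_two_eq hT hx (n := 6) (by norm_num) hF ht)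
  have d0 := fun t (ht : t ∈ Icc 0 T) =>
    hasDerivWithinAt_spaceDeriv (xa := xa) (xb := xb) (n := 6) (by norm_num) hF ht
  have d1 := fun t (ht : t ∈ Icc 0 T) => hasDerivWithinAt_spaceDeriv (by norm_num) c1 ht
  have d2 := fun t (ht : t ∈ Icc 0 T) => hasDerivWithinAt_spaceDeriv (by norm_num) c2 ht
  have d3 := fun t (ht : t ∈ Icc 0 T) => hasDerivWithinAt_spaceDeriv (by norm_num) c3 ht
  have t4 := fun x (hx' : x ∈ Icc xa xb) => hasDerivWithinAt_timeDeriv (by norm_num) c4 hx'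
  have t5 := fun x (hx' : x ∈ Icc xa xb) => hasDerivWithinAt_timeDeriv (by norm_num) c5 hx'
  refine ⟨fun t ht => ⟨ends t ht, ?_⟩, fun t ht s hs => ?_, fun t s hs hp hm => ?_⟩
  · refine (seminormH1_sub_projection_le hx (d0 t ht) (d1 t ht) (d2 t ht) (d3 t ht)
      (fun x hx' => hK0 _ ⟨ht, hx'⟩) (fun j => rfl) (ends t ht) (lap t ht)).trans ?_
    gcongr
    linarith
  -- The projection is linear, so its error for a time difference of F is governed by the same time
  -- difference of the fourth space derivative. The second difference treated next costs four space
  -- and two time derivatives, exactly the available six.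
  · have e : (sample xa xb J F t - w t) - (sample xa xb J F s - w s)
        = (sample xa xb J F t - sample xa xb J F s) - (w t - w s) := by abel
    have := seminormH1_sub_projection_le (J := J) (M := K1 * |t - s|) hx
      (fun x hx' => (d0 t ht x hx').sub (d0 s hs x hx'))
      (fun x hx' => (d1 t ht x hx').sub (d1 s hs x hx'))
      (fun x hx' => (d2 t ht x hx').sub (d2 s hs x hx'))
      (fun x hx' => (d3 t ht x hx').sub (d3 s hs x hx'))
      (fun x hx' => norm_sub_le_of_deriv (t4 x hx') (fun r hr => hK1 _ ⟨hr, hx'⟩) hs ht)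
      (v := sample xa xb J F t - sample xa xb J F s) (w := w t - w s) (fun j => rfl)
      (by rw [← e]; exact (ends t ht).sub (ends s hs))
      (by rw [discreteLaplacian_sub, lap t ht, lap s hs]; exact (interpZero_sub _ _).symm)
    rw [e]
    refine this.trans ?_
    have q : 0 ≤ c * (K0 + 2 * K2) * (|t - s| * meshWidth xa xb J ^ 2) := by positivity
    linarith
  · have ht : t ∈ Icc 0 T := ⟨by linarith [hm.1], by linarith [hp.2]⟩
    have e : ((sample xa xb J F (t + s) - w (t + s)) - (sample xa xb J F t - w t))
          - ((sample xa xb J F t - w t) - (sample xa xb J F (t - s) - w (t - s)))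
        = ((sample xa xb J F (t + s) - sample xa xb J F t)
          - (sample xa xb J F t - sample xa xb J F (t - s)))
          - ((w (t + s) - w t) - (w t - w (t - s))) := by abel
    have := seminormH1_sub_projection_le (J := J) (M := 2 * K2 * s ^ 2) hx
      (fun x hx' => ((d0 _ hp x hx').sub (d0 t ht x hx')).sub
        ((d0 t ht x hx').sub (d0 _ hm x hx')))
      (fun x hx' => ((d1 _ hp x hx').sub (d1 t ht x hx')).sub
        ((d1 t ht x hx').sub (d1 _ hm x hx')))
      (fun x hx' => ((d2 _ hp x hx').sub (d2 t ht x hx')).sub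
        ((d2 t ht x hx').sub (d2 _ hm x hx')))
      (fun x hx' => ((d3 _ hp x hx').sub (d3 t ht x hx')).sub
        ((d3 t ht x hx').sub (d3 _ hm x hx')))
      (fun x hx' => by
        have := norm_second_diff_le (t4 x hx') (t5 x hx') (fun r hr => hK2 _ ⟨hr, hx'⟩) hs hp hm
        refine (le_of_eq ?_).trans this
        congr 1
        ring)
      (v := (sample xa xb J F (t + s) - sample xa xb J F t)
          - (sample xa xb J F t - sample xa xb J F (t - s)))
      (w := (w (t + s) - w t) - (w t - w (t - s))) (fun j => rfl)
      (by
        rw [← e]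
        exact ((ends _ hp).sub (ends t ht)).sub ((ends t ht).sub (ends _ hm)))
      (by
        rw [discreteLaplacian_sub, discreteLaplacian_sub, discreteLaplacian_sub, lap t ht,
          lap _ hp, lap _ hm, interpZero_sub, interpZero_sub, interpZero_sub])
    rw [e]
    refine this.trans ?_
    have q : 0 ≤ c * (K0 + K1) * (s ^ 2 * meshWidth xa xb J ^ 2) := by positivity
    linarith

end EllipticProjection

/-! ### Uniform bounds for the derivatives. -/

section TimeBounds

variable {T xa xb : ℝ} {F : ℝ × ℝ → ℂ}

/-- Bounds for the derivatives which control `sample F`. -/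
structure TimeBounds (T xa xb K : ℝ) (F : ℝ × ℝ → ℂ) : Prop where
  b0 : ∀ p ∈ cylinder T xa xb, ‖F p‖ ≤ K
  bx0 : ∀ p ∈ cylinder T xa xb, ‖spaceDeriv T xa xb F p‖ ≤ K
  b1 : ∀ p ∈ cylinder T xa xb, ‖timeDeriv T xa xb F p‖ ≤ K
  bx1 : ∀ p ∈ cylinder T xa xb, ‖spaceDeriv T xa xb (timeDeriv T xa xb F) p‖ ≤ K
  b2 : ∀ p ∈ cylinder T xa xb, ‖timeDeriv T xa xb (timeDeriv T xa xb F) p‖ ≤ K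
  bx2 : ∀ p ∈ cylinder T xa xb,
    ‖spaceDeriv T xa xb (timeDeriv T xa xb (timeDeriv T xa xb F)) p‖ ≤ K
  b3 : ∀ p ∈ cylinder T xa xb,
    ‖timeDeriv T xa xb (timeDeriv T xa xb (timeDeriv T xa xb F)) p‖ ≤ K
  bx3 : ∀ p ∈ cylinder T xa xb,
    ‖spaceDeriv T xa xb (timeDeriv T xa xb (timeDeriv T xa xb (timeDeriv T xa xb F))) p‖ ≤ K

theorem TimeBounds.mono {K K' : ℝ} (h : TimeBounds T xa xb K F) (hK : K ≤ K') :
    TimeBounds T xa xb K' F :=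
  ⟨fun p hp => (h.b0 p hp).trans hK, fun p hp => (h.bx0 p hp).trans hK,
    fun p hp => (h.b1 p hp).trans hK, fun p hp => (h.bx1 p hp).trans hK,
    fun p hp => (h.b2 p hp).trans hK, fun p hp => (h.bx2 p hp).trans hK,
    fun p hp => (h.b3 p hp).trans hK, fun p hp => (h.bx3 p hp).trans hK⟩

theorem exists_timeBounds (hT : 0 < T) (hx : xa < xb) (hF : ContDiffOn ℝ 6 F (cylinder T xa xb)) :
    ∃ K, TimeBounds T xa xb K F := by
  have c0 : ContDiffOn ℝ (6 : ℕ) F (cylinder T xa xb) := hF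
  have c1 := contDiffOn_timeDeriv hT hx (m := 5) le_rfl c0
  have c2 := contDiffOn_timeDeriv hT hx (m := 4) le_rfl c1
  have c3 := contDiffOn_timeDeriv hT hx (m := 3) le_rfl c2
  obtain ⟨k0, h0⟩ := exists_bound_on_cylinder c0
  obtain ⟨k1, h1⟩ := exists_bound_on_cylinder c1
  obtain ⟨k2, h2⟩ := exists_bound_on_cylinder c2
  obtain ⟨k3, h3⟩ := exists_bound_on_cylinder c3
  obtain ⟨l0, g0⟩ := exists_bound_on_cylinder (contDiffOn_spaceDeriv hT hx (m := 5) le_rfl c0)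
  obtain ⟨l1, g1⟩ := exists_bound_on_cylinder (contDiffOn_spaceDeriv hT hx (m := 4) le_rfl c1)
  obtain ⟨l2, g2⟩ := exists_bound_on_cylinder (contDiffOn_spaceDeriv hT hx (m := 3) le_rfl c2)
  obtain ⟨l3, g3⟩ := exists_bound_on_cylinder (contDiffOn_spaceDeriv hT hx (m := 2) le_rfl c3)
  have e : ∀ a : ℝ, a ≤ |a| := le_abs_self
  have n : ∀ a : ℝ, 0 ≤ |a| := abs_nonneg
  refine ⟨|k0| + |k1| + |k2| + |k3| + |l0| + |l1| + |l2| + |l3|, ?_⟩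
  constructor <;> intro p hp
  · exact (h0 p hp).trans (by linarith [e k0, n k1, n k2, n k3, n l0, n l1, n l2, n l3])
  · exact (g0 p hp).trans (by linarith [e l0, n k0, n k1, n k2, n k3, n l1, n l2, n l3])
  · exact (h1 p hp).trans (by linarith [e k1, n k0, n k2, n k3, n l0, n l1, n l2, n l3])
  · exact (g1 p hp).trans (by linarith [e l1, n k0, n k1, n k2, n k3, n l0, n l2, n l3])
  · exact (h2 p hp).trans (by linarith [e k2, n k0, n k1, n k3, n l0, n l1, n l2, n l3])
  · exact (g2 p hp).trans (by linarith [e l2, n k0, n k1, n k2, n k3, n l0, n l1, n l3])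
  · exact (h3 p hp).trans (by linarith [e k3, n k0, n k1, n k2, n l0, n l1, n l2, n l3])
  · exact (g3 p hp).trans (by linarith [e l3, n k0, n k1, n k2, n k3, n l0, n l1, n l2])

end TimeBounds

/-! ### Consistency: the exact solution satisfies the error equations. -/

section Consistency

/-- |z|² is real-smooth and nonnegative, so regularity of g on the half line gives regularity of z ↦
g(|z|²) on all of ℂ; no truncation of the nonlinearity is needed. -/
theorem contDiff_comp_norm_sq {g : ℝ → ℝ} (hg : ContDiffOn ℝ 6 g (Ici 0)) :
    ContDiff ℝ 6 (fun z : ℂ => ((g (‖z‖ ^ 2) : ℝ) : ℂ)) := by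
  have h1 : ContDiff ℝ 6 (fun z : ℂ => ‖z‖ ^ 2) := contDiff_norm_sq ℝ
  have h2 : ContDiff ℝ 6 (fun z : ℂ => g (‖z‖ ^ 2)) := by
    rw [← contDiffOn_univ]
    exact hg.comp h1.contDiffOn (fun z _ => sq_nonneg ‖z‖)
  exact Complex.ofRealCLM.contDiff.comp h2

variable {T xa xb : ℝ}

theorem timeStep_pos (hT : 0 < T) {N : ℕ} (hN : 1 ≤ N) : 0 < timeStep T N :=
  div_pos hT (by exact_mod_cast hN)

theorem mul_timeStep {N : ℕ} (hN : 1 ≤ N) : N * timeStep T N = T := by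
  have : (N : ℝ) ≠ 0 := by exact_mod_cast (by omega : N ≠ 0)
  rw [timeStep]
  field_simp

theorem timeNode_succ (N n : ℕ) : timeNode T N (n + 1) = timeNode T N n + timeStep T N := by
  simp only [timeNode]
  push_cast
  ring

theorem timeNode_mem (hT : 0 < T) {N n : ℕ} (hN : 1 ≤ N) (hn : n ≤ N) :
    timeNode T N n ∈ Icc 0 T := by
  have h1 := timeStep_pos hT hN
  have h2 : (n : ℝ) ≤ N := by exact_mod_cast hn
  refine ⟨by rw [timeNode]; positivity, ?_⟩
  calc timeNode T N n ≤ N * timeStep T N := by rw [timeNode]; gcongr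
    _ = T := mul_timeStep hN

theorem midTimeNode_mem (hT : 0 < T) {N n : ℕ} (hN : 1 ≤ N) (hn : n < N) :
    midTimeNode T N n ∈ Icc 0 T := by
  have h1 := timeStep_pos hT hN
  have h2 := timeNode_mem hT hN hn.le
  have h3 := timeNode_mem hT hN hn
  rw [Nat.succ_eq_add_one, timeNode_succ] at h3
  rw [midTimeNode]
  exact ⟨by linarith [h2.1], by linarith [h3.2]⟩

variable {J : ℕ}

/-- The error equation at an interior node. -/
theorem step_interior {h τ : ℝ} {U U' w w' W W' P ρ Φ p p' a a' b b' f f' : Grid J ℂ}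
    {j : Fin (J + 2)}
    (hw : discreteLaplacian h w j = b j) (hw' : discreteLaplacian h w' j = b' j)
    (hf : a j = Complex.I * b j + Complex.I * p j * U j + f j)
    (hf' : a' j = Complex.I * b' j + Complex.I * p' j * U' j + f' j)
    (hρ : ρ j = P j - Φ j)
    (hW : W' j - W j = Complex.I * τ * discreteLaplacian h (fun k => (W' k + W k) / 2) j
      + Complex.I * τ * (Φ j * ((W' j + W j) / 2)) + τ * ((f' j + f j) / 2)) {R : Grid J ℂ}
    (hR : (τ : ℂ) * R j = (U' j - U j - (τ / 2 : ℂ) * (a' j + a j))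
      - ((U' j - w' j) - (U j - w j))
      + τ * (Complex.I * ((p' j * U' j + p j * U j) / 2 - P j * (U' j + U j) / 2))) :
    (w' j - W' j) - (w j - W j)
      = Complex.I * (τ / 2) * discreteLaplacian h ((w' - W') + (w - W)) j
        + τ * (Complex.I * (1 / 2 * (P j * ((U' j - W' j) + (U j - W j)))
          + 1 / 2 * (ρ j * (U' j + U j))
          - 1 / 2 * (ρ j * ((U' j - W' j) + (U j - W j)))) + R j) := by
  have e1 : (fun k => (W' k + W k) / 2) = (1 / 2 : ℂ) • (W' + W) := by
    ext k
    simp only [Pi.smul_apply, Pi.add_apply, smul_eq_mul]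
    ring
  rw [e1, discreteLaplacian_smul, discreteLaplacian_add] at hW
  rw [discreteLaplacian_add, discreteLaplacian_sub, discreteLaplacian_sub]
  simp only [Pi.smul_apply, Pi.add_apply, Pi.sub_apply, smul_eq_mul] at hW ⊢
  rw [hw, hw', hρ]
  linear_combination -hW - hR + (τ / 2 : ℂ) * hf + (τ / 2 : ℂ) * hf'

/-- The average of `p U` against the product of the midpoint value of `p` with the average of
`U`. -/
theorem tame_midpoint_defect {K h τ : ℝ} {U U' P p p' : Grid J ℂ}
    (hU : Tame K h U) (hdU : Tame (K * τ) h (U' - U)) (hdp : Tame (K * (τ / 2)) h (p' - P))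
    (hp : Tame (2 * K * (τ / 2) ^ 2) h (p' + p - (2 : ℂ) • P)) :
    Tame (K ^ 2 * τ ^ 2) h (fun j => (p' j * U' j + p j * U j) / 2 - P j * (U' j + U j) / 2) := by
  -- The defect is half of (p' + p - 2P)U plus half of (p' - P)(U' - U): a centred second
  -- difference, and a product of two first differences.
  have h1 := ((hp.mul hU).smul (1 / 2)).add ((hdp.mul hdU).smul (1 / 2))
  have e : (1 / 2 : ℂ) • ((p' + p - (2 : ℂ) • P) * U) + (1 / 2 : ℂ) • ((p' - P) * (U' - U))
      = fun j => (p' j * U' j + p j * U j) / 2 - P j * (U' j + U j) / 2 := by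
    ext j
    simp only [Pi.smul_apply, Pi.add_apply, Pi.sub_apply, Pi.mul_apply, smul_eq_mul]
    ring
  rw [e] at h1
  convert h1 using 1
  have : ‖(1 / 2 : ℂ)‖ = 1 / 2 := by norm_num
  rw [this]
  ring

theorem seminormH1_consistency_le {h τ c q : ℝ} (hh : 0 < h) (hτ : 0 < τ) {A B Q : Grid J ℂ}
    (hA : seminormH1 h A ≤ c * τ) (hB : seminormH1 h B ≤ q * τ) :
    seminormH1 h ((τ : ℂ)⁻¹ • A - (τ : ℂ)⁻¹ • B + Complex.I • Q) ≤ c + q + seminormH1 h Q := by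
  have h1 := seminormH1_add_le hh ((τ : ℂ)⁻¹ • A - (τ : ℂ)⁻¹ • B) (Complex.I • Q)
  have h2 := seminormH1_sub_le hh ((τ : ℂ)⁻¹ • A) ((τ : ℂ)⁻¹ • B)
  rw [seminormH1_smul hh, seminormH1_smul hh, norm_inv, Complex.norm_real,
    Real.norm_of_nonneg hτ.le] at h2
  rw [seminormH1_smul hh Complex.I, Complex.norm_I, one_mul] at h1
  have h3 : τ⁻¹ * seminormH1 h A ≤ c := by
    rw [inv_mul_le_iff₀ hτ]; linarith
  have h4 : τ⁻¹ * seminormH1 h B ≤ q := by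
    rw [inv_mul_le_iff₀ hτ]; linarith
  linarith

set_option maxHeartbeats 1000000 in
/-- The approximations and the exact solution satisfy the error equations. -/
theorem exists_errorSystem (hT : 0 < T) (hx : xa < xb) {g : ℝ → ℝ} {f : ℝ → ℝ → ℂ}
    {u₀ : ℝ → ℂ} {u : ℝ → ℝ → ℂ} (hg : ContDiffOn ℝ 6 g (Ici 0))
    (hu : ContDiffOn ℝ 6 (fun p : ℝ × ℝ => u p.1 p.2) (cylinder T xa xb))
    (hsol : IsSolution T xa xb g f u₀ u) :
    ∃ K ≥ 0, ∀ N J : ℕ, 1 ≤ N → ∀ (W : ℕ → Grid J ℂ) (Φ : ℕ → Grid J ℝ),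
      IsApprox T xa xb g f u₀ N J W Φ → ∃ θ R : ℕ → Grid J ℂ,
      ErrorSystem (fun z => ((g (‖z‖ ^ 2) : ℝ) : ℂ)) K (xb - xa) T (meshWidth xa xb J)
        (timeStep T N) N (fun n j => u (timeNode T N n) (node xa xb J j))
        (fun n j => ((g (‖u (midTimeNode T N n) (node xa xb J j)‖ ^ 2) : ℝ) : ℂ))
        (fun n j => u (timeNode T N n) (node xa xb J j) - W n j)
        (fun n j => ((g (‖u (midTimeNode T N n) (node xa xb J j)‖ ^ 2) - Φ n j : ℝ) : ℂ)) θ R := by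
  set F : ℝ × ℝ → ℂ := fun p => u p.1 p.2 with hF
  set p : ℝ × ℝ → ℂ := fun q => ((g (‖u q.1 q.2‖ ^ 2) : ℝ) : ℂ) with hp
  have hpC : ContDiffOn ℝ 6 p (cylinder T xa xb) := (contDiff_comp_norm_sq hg).comp_contDiffOn hu
  have hFt : ContDiffOn ℝ (6 : ℕ) F (cylinder T xa xb) := hu
  have hpt : ContDiffOn ℝ (6 : ℕ) p (cylinder T xa xb) := hpC
  obtain ⟨K₁, B₁⟩ := exists_timeBounds hT hx hu
  obtain ⟨K₂, B₂⟩ := exists_timeBounds hT hx hpC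
  have hF0 : ∀ t ∈ Icc 0 T, F (t, xa) = 0 ∧ F (t, xb) = 0 := hsol.boundary
  obtain ⟨c, hc, HP⟩ := exists_projection_bounds hT hx hu hF0
  have BF := B₁.mono (le_max_left K₁ K₂)
  have Bp := B₂.mono (le_max_right K₁ K₂)
  set K := max K₁ K₂
  have hK : 0 ≤ K := (norm_nonneg _).trans (BF.b0 (0, xa) ⟨⟨le_rfl, hT.le⟩, ⟨le_rfl, hx.le⟩⟩)
  have hL : 0 < xb - xa := by linarith
  set Λ := √(xb - xa) with hΛ
  have hΛ0 : 0 ≤ Λ := Real.sqrt_nonneg _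
  set D := K + 2 * K * Λ + 2 * K ^ 2 * Λ + 2 * c with hD
  have q1 : 0 ≤ K * Λ := by positivity
  have q2 : 0 ≤ K ^ 2 * Λ := by positivity
  have hKD : K ≤ D := by linarith
  refine ⟨D, by linarith, fun N J hN W Φ S => ?_⟩
  have hh := meshWidth_pos (J := J) hx
  have hτ := timeStep_pos hT hN
  have hmt := fun n (hn : n ≤ N) => timeNode_mem (n := n) hT hN hn
  have hmm := fun n (hn : n < N) => midTimeNode_mem (n := n) hT hN hn
  have hts := timeNode_succ (T := T) N
  set τ := timeStep T N
  set h := meshWidth xa xb J with hh'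
  choose w hw using fun t : ℝ => exists_isEllipticProjection hx J (fun x => F (t, x))
  obtain ⟨hη, hη1, hη2⟩ := HP J w (fun t _ => hw t)
  have hmid : ∀ n, midTimeNode T N n = timeNode T N n + τ / 2 := fun n => rfl
  set U : ℕ → Grid J ℂ := fun n => sample xa xb J F (timeNode T N n) with hU
  set P : ℕ → Grid J ℂ := fun n => sample xa xb J p (midTimeNode T N n) with hP
  set p₀ : ℕ → Grid J ℂ := fun n => sample xa xb J p (timeNode T N n) with hp₀
  set a : ℕ → Grid J ℂ := fun n => sample xa xb J (timeDeriv T xa xb F) (timeNode T N n) with ha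
  set η : ℕ → Grid J ℂ := fun n => U n - w (timeNode T N n) with hηdef
  set A : ℕ → Grid J ℂ := fun n => U (n + 1) - U n - (τ / 2 : ℂ) • (a (n + 1) + a n) with hA
  set Q : ℕ → Grid J ℂ := fun n j =>
    (p₀ (n + 1) j * U (n + 1) j + p₀ n j * U n j) / 2 - P n j * (U (n + 1) j + U n j) / 2 with hQ
  -- Three consistency errors: the trapezoidal defect A of u_t, the time difference of the
  -- projection error η, and the midpoint defect Q of the potential term. There is no Laplacian
  -- defect, thanks to the projection.
  set R : ℕ → Grid J ℂ := fun n =>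
    (τ : ℂ)⁻¹ • A n - (τ : ℂ)⁻¹ • (η (n + 1) - η n) + Complex.I • Q n with hR
  -- bounds for the smooth grid functions
  have hUt : ∀ n ≤ N, Tame K h (U n) := fun n hn =>
    tame_sample hx (by norm_num) hFt BF.b0 BF.bx0 (hmt n hn)
  have hUd : ∀ n < N, Tame (K * τ) h (U (n + 1) - U n) := by
    intro n hn
    have := tame_sample_sub (J := J) hT hx (by norm_num) hFt BF.b1 BF.bx1 (hmt (n + 1) hn)
      (hmt n hn.le)
    rwa [hts, add_sub_cancel_left, abs_of_pos hτ, ← hts] at this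
  have hPt : ∀ n < N, Tame K h (P n) := fun n hn =>
    tame_sample hx (by norm_num) hpt Bp.b0 Bp.bx0 (hmm n hn)
  have hPd : ∀ n, n + 1 < N → Tame (K * τ) h (P (n + 1) - P n) := by
    intro n hn
    have := tame_sample_sub (J := J) hT hx (by norm_num) hpt Bp.b1 Bp.bx1 (hmm (n + 1) hn)
      (hmm n (by omega))
    have e : midTimeNode T N (n + 1) - midTimeNode T N n = τ := by rw [hmid, hmid, hts]; ring
    rwa [e, abs_of_pos hτ] at this
  have hPm : ∀ n, n + 1 < N →
      Tame (2 * K * (τ / 2) ^ 2) h (P (n + 1) + P n - (2 : ℂ) • p₀ (n + 1)) := by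
    intro n hn
    have e1 : midTimeNode T N (n + 1) = timeNode T N (n + 1) + τ / 2 := rfl
    have e2 : midTimeNode T N n = timeNode T N (n + 1) - τ / 2 := by rw [hmid, hts]; ring
    have m1 := hmm (n + 1) hn
    have m2 := hmm n (by omega)
    simp only [hP, hp₀]
    rw [e1] at m1 ⊢
    rw [e2] at m2 ⊢
    exact tame_sample_second_diff hT hx (by norm_num) hpt Bp.b2 Bp.bx2 (by positivity) m1 m2
  have hpm : ∀ n < N, Tame (2 * K * (τ / 2) ^ 2) h (p₀ (n + 1) + p₀ n - (2 : ℂ) • P n) := by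
    intro n hn
    have e1 : timeNode T N (n + 1) = midTimeNode T N n + τ / 2 := by rw [hmid, hts]; ring
    have e2 : timeNode T N n = midTimeNode T N n - τ / 2 := by rw [hmid]; ring
    have m1 := hmt (n + 1) hn
    have m2 := hmt n hn.le
    simp only [hP, hp₀]
    rw [e1] at m1 ⊢
    rw [e2] at m2
    have := tame_sample_second_diff (J := J) hT hx (by norm_num) hpt Bp.b2 Bp.bx2
      (by positivity) m1 m2
    rwa [← e2] at this
  have hpd : ∀ n < N, Tame (K * (τ / 2)) h (p₀ (n + 1) - P n) := by
    intro n hn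
    have := tame_sample_sub (J := J) hT hx (by norm_num) hpt Bp.b1 Bp.bx1 (hmt (n + 1) hn)
      (hmm n hn)
    have e : timeNode T N (n + 1) - midTimeNode T N n = τ / 2 := by rw [hmid, hts]; ring
    rwa [e, abs_of_pos (by positivity)] at this
  have hAt : ∀ n < N, Tame (K * τ ^ 3) h (A n) := by
    intro n hn
    have m := hmt (n + 1) hn
    rw [hts] at m
    have := tame_sample_trapezoid (J := J) hT hx (by norm_num) hFt BF.b3 BF.bx3 hτ.le
      (hmt n hn.le) m
    rwa [← hts] at this
  have hQt : ∀ n < N, Tame (K ^ 2 * τ ^ 2) h (Q n) := fun n hn =>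
    tame_midpoint_defect (hUt n hn.le) (hUd n hn) (hpd n hn) (hpm n hn)
  have hnorm : ∀ {B : ℝ} {v : Grid J ℂ}, Tame B h v → seminormH1 h v ≤ B * Λ := fun hv => by
    have := hv.seminormH1_le hh
    rwa [meshWidth_mul] at this
  have hηd : ∀ n < N, seminormH1 h (η (n + 1) - η n) ≤ c * (τ * h ^ 2) := by
    intro n hn
    have := hη1 _ (hmt (n + 1) hn) _ (hmt n hn.le)
    have e : |timeNode T N (n + 1) - timeNode T N n| = τ := by
      rw [hts, add_sub_cancel_left, abs_of_pos hτ]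
    rwa [e] at this
  have hηdd : ∀ n, n + 1 < N →
      seminormH1 h ((η (n + 2) - η (n + 1)) - (η (n + 1) - η n)) ≤ c * (τ ^ 2 * h ^ 2) := by
    intro n hn
    have e1 : timeNode T N (n + 1) + τ = timeNode T N (n + 2) := (hts (n + 1)).symm
    have e2 : timeNode T N (n + 1) - τ = timeNode T N n := by rw [hts]; ring
    have m1 := hmt (n + 2) hn
    have m2 := hmt n (by omega)
    have := hη2 (timeNode T N (n + 1)) τ hτ.le (by rw [e1]; exact m1) (by rw [e2]; exact m2)
    rwa [e1, e2] at this
  -- end values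
  have hUe : ∀ n ≤ N, VanishesAtEnds (U n) := fun n hn =>
    ⟨by simpa [hU, sample, node_zero] using (hF0 _ (hmt n hn)).1,
      by simpa [hU, sample, node_last] using (hF0 _ (hmt n hn)).2⟩
  -- Differentiating the boundary condition in time; this is needed for R, which has to vanish at
  -- the end nodes for the equation to hold there.
  have hae : ∀ n ≤ N, VanishesAtEnds (a n) := by
    intro n hn
    have key : ∀ x ∈ Icc xa xb, (∀ s ∈ Icc 0 T, F (s, x) = 0) →
        timeDeriv T xa xb F (timeNode T N n, x) = 0 := by
      intro x hx' h0
      have h1 := hasDerivWithinAt_timeDeriv (n := 6) (by norm_num) hFt hx' _ (hmt n hn)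
      have h2 : HasDerivWithinAt (fun s => F (s, x)) 0 (Icc 0 T) (timeNode T N n) :=
        (hasDerivWithinAt_const _ _ (0 : ℂ)).congr h0 (h0 _ (hmt n hn))
      exact (uniqueDiffOn_Icc hT _ (hmt n hn)).eq_deriv _ h1 h2
    constructor
    · simp only [ha, sample, node_zero]
      exact key xa ⟨le_rfl, hx.le⟩ fun s hs => (hF0 s hs).1
    · simp only [ha, sample, node_last]
      exact key xb ⟨hx.le, le_rfl⟩ fun s hs => (hF0 s hs).2
  have hAe : ∀ n < N, VanishesAtEnds (A n) := fun n hn =>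
    ((hUe (n + 1) hn).sub (hUe n hn.le)).sub (((hae (n + 1) hn).add (hae n hn.le)).smul _)
  have hηe : ∀ n ≤ N, VanishesAtEnds (η n) := fun n hn => (hη _ (hmt n hn)).1
  have hQe : ∀ n < N, VanishesAtEnds (Q n) := fun n hn =>
    ⟨by simp [hQ, (hUe (n + 1) hn).1, (hUe n hn.le).1],
      by simp [hQ, (hUe (n + 1) hn).2, (hUe n hn.le).2]⟩
  have hRe : ∀ n < N, VanishesAtEnds (R n) := fun n hn =>
    (((hAe n hn).smul _).sub (((hηe (n + 1) hn).sub (hηe n hn.le)).smul _)).add ((hQe n hn).smul _)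
  have h00 : timeNode T N 0 = 0 := by simp [timeNode]
  have hu₀ : ∀ x ∈ Icc xa xb, F (0, x) = u₀ x := hsol.initial
  -- At the end nodes the relaxation reads Φ = 2g(0) - g(0), so Φ stays equal to g(0), the exact
  -- potential there, and ρ vanishes.
  have hΦe : ∀ j : Fin (J + 2), j = 0 ∨ j = Fin.last (J + 1) → ∀ n < N, Φ n j = g 0 := by
    intro j hj n
    induction n with
    | zero =>
      intro hn
      have e : u₀ (node xa xb J j) = 0 := by
        rw [← hu₀ _ (node_mem hx j)]
        rcases hj with rfl | rfl
        · rw [node_zero]; exact (hF0 0 ⟨le_rfl, hT.le⟩).1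
        · rw [node_last]; exact (hF0 0 ⟨le_rfl, hT.le⟩).2
      rw [S.relax_start, e]
      simp
    | succ n ih =>
      intro hn
      have e : W (n + 1) j = 0 := by
        rcases hj with rfl | rfl
        · exact (S.vanish _ hn.le).1
        · exact (S.vanish _ hn.le).2
      rw [S.relax_step _ (by omega) hn, Nat.add_sub_cancel, ih (by omega), e]
      simp
      ring
  have hρe : ∀ n < N, VanishesAtEnds (fun j =>
      ((g (‖u (midTimeNode T N n) (node xa xb J j)‖ ^ 2) - Φ n j : ℝ) : ℂ)) := by
    intro n hn
    constructor
    · simp only [node_zero, (hsol.boundary _ (hmm n hn)).1, hΦe 0 (Or.inl rfl) n hn]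
      simp
    · simp only [node_last, (hsol.boundary _ (hmm n hn)).2, hΦe _ (Or.inr rfl) n hn]
      simp
  have hθ : ∀ n, U n - W n - (w (timeNode T N n) - W n) = η n := fun n => by
    simp only [hηdef]
    abel
  refine ⟨fun n => w (timeNode T N n) - W n, R, ?_⟩
  exact {
    h_pos := hh
    h_mul := meshWidth_mul
    τ_pos := hτ
    mul_τ := mul_timeStep hN
    one_le := hN
    e_ends := fun n hn => (hUe n hn).sub (S.vanish n hn)
    θ_ends := fun n hn => (hw _).1.sub (S.vanish n hn)
    ρ_ends := hρe
    U_tame := fun n hn => (hUt n hn).mono hh hKD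
    U_diff := fun n hn => (hUd n hn).mono hh (by gcongr)
    P_tame := fun n hn => (hPt n hn).mono hh hKD
    P_diff := fun n hn => (hPd n hn).mono hh (by gcongr)
    P_mid := fun n hn => by
      refine (hnorm (hPm n hn)).trans ?_
      have : K * Λ / 2 * τ ^ 2 ≤ D * τ ^ 2 := by gcongr; linarith
      linarith
    e_sub := fun n hn => by
      refine (congrArg (seminormH1 h) (hθ n)).le.trans ((hη _ (hmt n hn)).2.trans ?_)
      gcongr
      linarith
    e_diff := fun n hn => by
      refine (congrArg (seminormH1 h) (congrArg₂ (· - ·) (hθ (n + 1)) (hθ n))).le.trans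
        ((hηd n hn).trans ?_)
      gcongr
      linarith
    R_le := fun n hn => by
      have h1 := seminormH1_consistency_le hh hτ (A := A n) (B := η (n + 1) - η n) (Q := Q n)
        (c := K * Λ * τ ^ 2) (q := c * h ^ 2) ((hnorm (hAt n hn)).trans (le_of_eq (by ring)))
        ((hηd n hn).trans (le_of_eq (by ring)))
      refine h1.trans ?_
      have h2 := hnorm (hQt n hn)
      have h3 : (K * Λ + K ^ 2 * Λ) * τ ^ 2 ≤ D * τ ^ 2 := by gcongr; linarith
      have h4 : c * h ^ 2 ≤ D * h ^ 2 := by gcongr; linarith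
      linarith
    R_diff := fun n hn => by
      -- A/τ and Q are already O(τ²), so the triangle inequality suffices for them. The projection
      -- part of R is only O(h²) and gains its factor τ from the second time differences of η, two
      -- of which add up to the difference taken here.
      have e : R (n + 2) - R n = (τ : ℂ)⁻¹ • (A (n + 2) - A n)
          - (τ : ℂ)⁻¹ • ((η (n + 3) - η (n + 2)) - (η (n + 1) - η n))
          + Complex.I • (Q (n + 2) - Q n) := by
        simp only [hR]
        module
      have h1 : seminormH1 h (A (n + 2) - A n) ≤ 2 * (K * Λ) * τ ^ 2 * τ := by
        have := seminormH1_sub_le hh (A (n + 2)) (A n)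
        have := hnorm (hAt (n + 2) hn)
        have := hnorm (hAt n (by omega))
        linarith
      have h2 : seminormH1 h ((η (n + 3) - η (n + 2)) - (η (n + 1) - η n))
          ≤ 2 * c * (τ * h ^ 2) * τ := by
        have := seminormH1_add_le hh ((η (n + 3) - η (n + 2)) - (η (n + 2) - η (n + 1)))
          ((η (n + 2) - η (n + 1)) - (η (n + 1) - η n))
        rw [sub_add_sub_cancel] at this
        have := hηdd (n + 1) (by omega)
        have := hηdd n (by omega)
        linarith
      have h3 : seminormH1 h (Q (n + 2) - Q n) ≤ 2 * (K ^ 2 * Λ) * τ ^ 2 := by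
        have := seminormH1_sub_le hh (Q (n + 2)) (Q n)
        have := hnorm (hQt (n + 2) hn)
        have := hnorm (hQt n (by omega))
        linarith
      have h4 := seminormH1_consistency_le hh hτ h1 h2 (Q := Q (n + 2) - Q n)
      rw [e]
      refine h4.trans ?_
      have h5 : (2 * (K * Λ) + 2 * (K ^ 2 * Λ)) * τ ^ 2 ≤ D * τ ^ 2 := by gcongr; linarith
      have h6 : 2 * c * (τ * h ^ 2) ≤ D * (τ * h ^ 2) := by gcongr; linarith
      linarith
    θ_zero := by
      refine sub_eq_zero.2 (isEllipticProjection_unique hx (hw _) ⟨S.start.1, ?_⟩)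
      rw [S.start.2, h00]
      refine interpZero_congr hx fun x hx' => ?_
      exact iteratedDerivWithin_congr (fun y hy => (hu₀ y hy).symm) hx'
    ρ_zero := by
      -- The starting potential is the exact one half a step too early; this is where first order in
      -- τ enters.
      have m0 := hmm 0 hN
      have e : (fun j => ((g (‖u (midTimeNode T N 0) (node xa xb J j)‖ ^ 2) - Φ 0 j : ℝ) : ℂ))
          = sample xa xb J p (midTimeNode T N 0) - sample xa xb J p (timeNode T N 0) := by
        ext j
        have : u₀ (node xa xb J j) = u 0 (node xa xb J j) := (hu₀ _ (node_mem hx j)).symm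
        simp only [S.relax_start, this, Pi.sub_apply, sample, hp, h00]
        push_cast
        rfl
      have h1 := tame_sample_sub (J := J) hT hx (by norm_num) hpt Bp.b1 Bp.bx1 m0
        (hmt 0 (Nat.zero_le _))
      have e2 : midTimeNode T N 0 - timeNode T N 0 = τ / 2 := by rw [hmid]; ring
      rw [e2, abs_of_pos (by positivity)] at h1
      refine (congrArg (seminormH1 h) e).le.trans ((hnorm h1).trans ?_)
      have : K * Λ / 2 * τ ≤ D * τ := by gcongr; linarith
      linarith
    step := fun n hn => by
      ext j
      -- The differential equation is used at interior nodes only; at the end nodes every term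
      -- vanishes.
      rcases interior_or_end j with hj | hj
      · have hb : ∀ m ≤ N, discreteLaplacian h (w (timeNode T N m)) j
            = sample xa xb J (fun q => iteratedDerivWithin 2 (u q.1) (Icc xa xb) q.2)
              (timeNode T N m) j := fun m hm => by
          rw [(hw _).2, interpZero, if_pos hj]
          rfl
        have hf : ∀ m ≤ N, a m j = Complex.I * sample xa xb J
              (fun q => iteratedDerivWithin 2 (u q.1) (Icc xa xb) q.2) (timeNode T N m) j
            + Complex.I * p₀ m j * U m j + sample xa xb J (fun q => f q.1 q.2) (timeNode T N m) j :=
          fun m hm => by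
          have h1 := hasDerivWithinAt_timeDeriv (n := 6) (by norm_num) hFt (node_mem hx j) _
            (hmt m hm)
          exact (h1.derivWithin (uniqueDiffOn_Icc hT _ (hmt m hm))).symm.trans
            (hsol.pde _ (hmt m hm) _ (node_mem hx j))
        have hW := S.step n hn j
        rw [interpZero, if_pos hj] at hW
        have hτc : (τ : ℂ) ≠ 0 := by exact_mod_cast hτ.ne'
        exact step_interior (τ := τ) (Φ := fun j => ((Φ n j : ℝ) : ℂ)) (P := P n)
          (ρ := fun j => ((g (‖u (midTimeNode T N n) (node xa xb J j)‖ ^ 2) - Φ n j : ℝ) : ℂ))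
          (hb n hn.le) (hb (n + 1) hn) (hf n hn.le) (hf (n + 1) hn) (by
            simp only [hP, sample, hp]
            push_cast
            rfl) hW (by
            simp only [hR, hA, hQ, hηdef, Pi.add_apply, Pi.sub_apply, Pi.smul_apply, smul_eq_mul]
            field_simp)
      · have hz : ∀ {v : Grid J ℂ}, VanishesAtEnds v → v j = 0 := fun hv => by
          rcases hj with rfl | rfl
          · exact hv.1
          · exact hv.2
        have u0 : ∀ m ≤ N, u (timeNode T N m) (node xa xb J j) = 0 := fun m hm => hz (hUe m hm)
        have W0 : ∀ m ≤ N, W m j = 0 := fun m hm => hz (S.vanish m hm)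
        simp only [errorForcing, potentialDefect, Pi.add_apply, Pi.sub_apply, Pi.smul_apply,
          Pi.mul_apply, smul_eq_mul, hz (hw _).1, hz (vanishesAtEnds_discreteLaplacian _ _),
          hz (hRe n hn), u0 n hn.le, u0 (n + 1) hn, W0 n hn.le, W0 (n + 1) hn]
        ring
    relax := fun n hn => by
      ext j
      have h1 := S.relax_step (n + 1) (by omega) hn j
      rw [Nat.add_sub_cancel] at h1
      simp only [Pi.add_apply, Pi.sub_apply, Pi.smul_apply, smul_eq_mul, h1, sub_sub_cancel]
      push_cast
      ring }

end Consistency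

/-! ### Passage to the full norm and choice of the constants. -/

theorem normH1_ofReal {J : ℕ} (h : ℝ) (v : Grid J ℝ) :
    normH1 h (fun j => ((v j : ℝ) : ℂ)) = normH1 h v := by
  have e : ∀ j, ‖discreteDeriv h (fun j => ((v j : ℝ) : ℂ)) j‖ = ‖discreteDeriv h v j‖ := by
    intro j
    simp only [discreteDeriv, norm_smul, ← Complex.ofReal_sub, Complex.norm_real]
  simp only [normH1, normL2, seminormH1, e, Complex.norm_real]

theorem normH1_le_of_seminormH1_le {J : ℕ} {xa xb B : ℝ} (hx : xa < xb) {v : Grid J ℂ}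
    (hv : VanishesAtEnds v) (hB : seminormH1 (meshWidth xa xb J) v ≤ B) :
    normH1 (meshWidth xa xb J) v ≤ √(1 + 2 * (xb - xa) ^ 2) * B := by
  have h1 := normH1_le (meshWidth_pos (J := J) hx) hv
  rw [meshWidth_mul] at h1
  exact h1.trans (by gcongr)

end RFD

end

theorem mainTheorem2 (T xa xb : ℝ) (hT : 0 < T) (hx : xa < xb)
    (g : ℝ → ℝ) (f : ℝ → ℝ → ℂ) (u₀ : ℝ → ℂ) (u : ℝ → ℝ → ℂ)
    (hg : ContDiffOn ℝ 6 g (Set.Ici 0))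
    (hu : ContDiffOn ℝ 6 (fun p : ℝ × ℝ => u p.1 p.2) (RFD.cylinder T xa xb))
    (hsol : RFD.IsSolution T xa xb g f u₀ u)
    (δ : ℝ) (hδ : 2 * max (RFD.uMax T xa xb u) (RFD.gMax T xa xb g u) ≤ δ) :
    ∃ CA > 0, ∃ CB > 0, ∃ CD ≥ CA, ∃ CE > 0, ∀ N J : ℕ, 1 ≤ N → 1 ≤ J →
      ∀ (W : ℕ → RFD.Grid J ℂ) (Φ : ℕ → RFD.Grid J ℝ),
        RFD.IsApprox T xa xb g f u₀ N J W Φ →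
        RFD.timeStep T N * CA ≤ 1 / 2 →
        CB * √(xb - xa) * (RFD.timeStep T N + RFD.meshWidth xa xb J ^ 2) ≤ δ / 2 →
          (∀ m < N,
            RFD.normH1 (RFD.meshWidth xa xb J)
              (fun j => g (‖u (RFD.midTimeNode T N m) (RFD.node xa xb J j)‖ ^ 2) - Φ m j)
              ≤ CB * (RFD.timeStep T N + RFD.meshWidth xa xb J ^ 2)) ∧
          (RFD.timeStep T N * CD ≤ 1 / 2 →
            ∀ m ≤ N,
              RFD.normH1 (RFD.meshWidth xa xb J)
                (fun j => u (RFD.timeNode T N m) (RFD.node xa xb J j) - W m j)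
                ≤ CE * (RFD.timeStep T N ^ 2 + RFD.meshWidth xa xb J ^ 2)) := by
  have hL : 0 < xb - xa := by linarith
  obtain ⟨K, hK, HS⟩ := RFD.exists_errorSystem hT hx hg hu hsol
  obtain ⟨ε, hε, C, hC, HB⟩ := RFD.exists_error_bounds
    ((RFD.contDiff_comp_norm_sq hg).of_le (by norm_num)) hK hL hT
  set B := √(1 + 2 * (xb - xa) ^ 2)
  have hB : 0 ≤ B * C := mul_nonneg (Real.sqrt_nonneg _) hC
  have hΛ : 0 < √(xb - xa) := Real.sqrt_pos.2 hL
  have hr : 0 ≤ |δ| / (2 * √(xb - xa) * ε) := by positivity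
  -- The last summand of CB turns the mesh condition into τ + h² ≤ ε: if τ + h² exceeded ε, then CB
  -- √L (τ + h²) would exceed |δ|/2. The absolute value avoids having to determine the sign of δ,
  -- and the summands 1 ensure positivity.
  refine ⟨1, one_pos, B * C + 1 + |δ| / (2 * √(xb - xa) * ε), by positivity, 1, le_rfl, B * C + 1,
    by positivity, fun N J hN _ W Φ S _ hsmall => ?_⟩
  obtain ⟨θ, R, E⟩ := HS N J hN W Φ S
  have hτ := E.τ_pos
  have hs : 0 ≤ RFD.timeStep T N + RFD.meshWidth xa xb J ^ 2 := by positivity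
  have hle : RFD.timeStep T N + RFD.meshWidth xa xb J ^ 2 ≤ ε := by
    by_contra hlt
    have h1 : (B * C + 1 + |δ| / (2 * √(xb - xa) * ε)) * √(xb - xa) * ε
        < (B * C + 1 + |δ| / (2 * √(xb - xa) * ε)) * √(xb - xa)
          * (RFD.timeStep T N + RFD.meshWidth xa xb J ^ 2) :=
      mul_lt_mul_of_pos_left (not_le.1 hlt) (by positivity)
    have h2 : (B * C + 1 + |δ| / (2 * √(xb - xa) * ε)) * √(xb - xa) * ε
        = (B * C + 1) * √(xb - xa) * ε + |δ| / 2 := by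
      field_simp
    have h3 : 0 ≤ (B * C + 1) * √(xb - xa) * ε := by positivity
    linarith [le_abs_self δ]
  obtain ⟨hρ, he⟩ := HB J N _ _ _ _ _ _ _ _ E hle
  refine ⟨fun m hm => ?_, fun _ m hm => ?_⟩
  · rw [← RFD.normH1_ofReal]
    refine (RFD.normH1_le_of_seminormH1_le hx (E.ρ_ends m hm) (hρ m hm)).trans ?_
    rw [← mul_assoc]
    exact mul_le_mul_of_nonneg_right (by linarith) hs
  · refine (RFD.normH1_le_of_seminormH1_le hx (E.e_ends m hm) (he m hm)).trans ?_
    rw [← mul_assoc]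
    exact mul_le_mul_of_nonneg_right (by linarith) (by positivity)
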